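/- **Setting.** Let $\mathbb K$ be an algebraically closed field of characteristic zero, $M=\mathbb Z^n$ the character lattice of the torus $T=(\mathbb K^*)^n$, $\hat T=\mathbb K^*\times T$ with character lattice $\hat M=\mathbb Z\oplus M$, and $P\subseteq M_{\mathbb R}$ a full-dimensional normal lattice polytope. Put $\Lambda=P\cap M$, $V=\mathbb K^{\Lambda}$. Let $\hat X_P\subseteq V$ be the Zariski closure of $\{\sum_{\chi\in\Lambda} c\,\chi(t)e_\chi \mid (c,t)\in\hat T\}$, the affine cone over the embedded toric variety $X_P\subseteq\mathbb P(V)$. The torus $\hat T$ acts on $\mathbb K[\hat X_P]$ by $(\hat t\cdot g)(v)=g(\hat t^{-1}v)$. Let $A$ be the set of nonempty faces of $P$ (including $P$), ordered by inclusion. A *combinatorial Seshadri stratification* is a choice, for every $\sigma\in A$, of a nonzero $\hat T$-eigenfunction $f_\sigma\in\mathbb K[\hat X_P]$ of degree $\deg f_\sigma\ge 1$ and weight $\mu_\sigma=(-\deg f_\sigma,\tilde\mu_\sigma)$ such that $u_\sigma:=-\tilde\mu_\sigma/\deg f_\sigma$ lies in the relative interior of $\sigma$. Its triangulation $\mathcal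 T=(\Delta_C)_C$ is indexed by the chains $C\subseteq A$, where $\Delta_C$ is the convex hull of $\{u_\sigma\mid\sigma\in C\}$. For a maximal chain $\mathfrak C$ the weights $(\mu_\sigma)_{\sigma\in\mathfrak C}$ form a basis of $\hat M_{\mathbb Q}$; for a $\hat T$-eigenfunction $g\ne0$ of weight $\sum_{\sigma\in\mathfrak C}a_\sigma\mu_\sigma$ put $\nu_{\mathfrak C}(g)=\sum_{\sigma\in\mathfrak C} a_\sigma e_\sigma\in\mathbb Q^A$. Fix a total order $>^t$ on $A$ refining the partial order, and order $\mathbb Q^A$ lexicographically, the $>^t$-largest face being compared first. For arbitrary $g\neq 0$, $\nu_{\mathfrak C}(g)$ is the minimum of the values on the $\hat T$-eigencomponents of $g$, and $\nu(g)=\min_{\mathfrak C}\nu_{\mathfrak C}(g)$, the minimum being over all maximal chains. Let $\Gamma=\{\nu(g)\mid g\ne0\}\subseteq\mathbb Q^A$, and for $C\subseteq A$ let $\Gamma_C=\{a\in\Gamma\mid\operatorname{supp}a\subseteq C\}$. Let $\operatorname{gr}_\nu\mathbb K[\hat X_P]=\bigoplus_{a}\{\nu\ge a\}/\{\nu>a\}$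 be the associated graded algebra. The *fan algebra* $\mathbb K[\Gamma]$ is the commutative $\mathbb K$-algebra generated by $y_a$, $a\in\Gamma$, with relations $y_0=1$, $y_ay_b=y_{a+b}$ if $a,b$ lie in a common cone spanned by $\{e_\sigma\mid\sigma\in C\}$ for a chain $C\subseteq A$, and $y_ay_b=0$ otherwise. It is graded by $\deg y_a=\sum_\sigma a_\sigma\deg f_\sigma\in\mathbb N$. Let $\mathbb K[\Gamma_C]\subseteq\mathbb K[\Gamma]$ be the graded subalgebra generated by the $y_a$, $a\in\Gamma_C$. **Theorem.** 1. There is an isomorphism of $\mathbb K$-algebras $\mathbb K[\Gamma]\cong\operatorname{gr}_\nu\mathbb K[\hat X_P]$ which maps each $y_a$ into the leaf $\{\nu\ge a\}/\{\nu>a\}$. 2. The set $\Gamma$, hence $\mathbb K[\Gamma]$, is independent of the linearization $>^t$. The algebra $\operatorname{gr}_\nu\mathbb K[\hat X_P]$ depends, up to isomorphism, only on $\mathcal T$: given two combinatorial Seshadri stratifications with the same triangulation, with any choice of linearizations and with associated quasi-valuations $\nu,\nu'$, there is a $\mathbb K$-algebra isomorphism $\operatorname{gr}_\nu\mathbb K[\hat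 X_P]\cong\operatorname{gr}_{\nu'}\mathbb K[\hat X_P]$ which maps the class of each $\hat T$-eigenfunction to the class of the same function. 3. The scheme $X_0=\operatorname{Proj}\mathbb K[\Gamma]$ is reduced. 4. For every maximal chain $\mathfrak C$, $\Gamma_{\mathfrak C}$ is a finitely generated submonoid of $\mathbb Q^A$ and $\mathbb K[\Gamma_{\mathfrak C}]$ is its semigroup algebra, with $y_a$ corresponding to $a$. So $X_{\mathfrak C}=\operatorname{Proj}\mathbb K[\Gamma_{\mathfrak C}]$ is a toric variety. It is integral, and the graded $\mathbb K$-algebra homomorphism $\mathbb K[\Gamma]\to\mathbb K[\Gamma_{\mathfrak C}]$ with $y_a\mapsto y_a$ for $a\in\Gamma_{\mathfrak C}$ and $y_a\mapsto0$ otherwise induces a closed immersion $X_{\mathfrak C}\hookrightarrow X_0$. $X_0$ is the irredundant union of the images of the $X_{\mathfrak C}$, $\mathfrak C$ running over all maximal chains, and these images are precisely the irreducible components of $X_0$. 5. $X_0$ is equidimensional: every irreducible component of $X_0$ has dimension $\dim X_P$. -/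

import Mathlib

noncomputable section

namespace FanDegeneration

open scoped DirectSum Pointwise

/-! ### Graded algebra generalities -/

section Generalities

variable {K R : Type*} [Field K] [CommRing R] [Algebra K R]

section Quot

variable {ι : Type*} [DecidableEq ι] [AddCommMonoid ι]

/-- The image in `R ⧸ I` of a grading of `R`. -/
def quotGrading (𝒜 : ι → Submodule K R) (I : Ideal R) (i : ι) : Submodule K (R ⧸ I) :=
  (𝒜 i).map (Ideal.Quotient.mkₐ K I).toLinearMap

/-- The quotient of a graded algebra by a homogeneous ideal is graded. -/
abbrev quotGradedAlgebra (𝒜 : ι → Submodule K R) [GradedAlgebra 𝒜] (I : Ideal R)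
    (hI : I.IsHomogeneous 𝒜) : GradedAlgebra (quotGrading 𝒜 I) := by
  have hmon : SetLike.GradedMonoid (quotGrading 𝒜 I) :=
    { one_mem := ⟨1, SetLike.GradedOne.one_mem, map_one (Ideal.Quotient.mkₐ K I)⟩
      mul_mem := by
        rintro i j _ _ ⟨x, hx, rfl⟩ ⟨y, hy, rfl⟩
        exact ⟨x * y, SetLike.GradedMul.mul_mem hx hy, map_mul (Ideal.Quotient.mkₐ K I) x y⟩ }
  have hint : DirectSum.IsInternal (quotGrading 𝒜 I) := by
    classical
    refine ⟨?_, ?_⟩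
    · rw [injective_iff_map_eq_zero]
      intro z hz
      have hlift : ∀ i, ∃ x : R, x ∈ 𝒜 i ∧ Ideal.Quotient.mk I x = (z i : R ⧸ I) := fun i => by
        obtain ⟨x, hx, h⟩ := (z i).2
        exact ⟨x, hx, h⟩
      choose x hx hxz using hlift
      set s := DFinsupp.support z
      have hsum : ∑ i ∈ s, x i ∈ I := by
        rw [← Ideal.Quotient.eq_zero_iff_mem, map_sum]
        rw [DirectSum.coeAddMonoidHom_eq_dfinsuppSum, DFinsupp.sum] at hz
        rw [← hz]
        exact Finset.sum_congr rfl fun i _ => hxz i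
      ext i
      by_cases hi : i ∈ s
      · have h1 := hI i hsum
        rw [DirectSum.decompose_sum, DFinsupp.finsetSum_apply, AddSubmonoidClass.coe_finsetSum,
          Finset.sum_eq_single i] at h1
        · rw [DirectSum.decompose_of_mem_same _ (hx i)] at h1
          rw [← hxz i, Ideal.Quotient.eq_zero_iff_mem.2 h1]
          rfl
        · intro j _ hj
          exact DirectSum.decompose_of_mem_ne _ (hx j) hj
        · exact fun h => absurd hi h
      · rw [DFinsupp.notMem_support_iff.1 hi]
        rfl
    · intro y
      obtain ⟨r, rfl⟩ := Ideal.Quotient.mk_surjective y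
      induction r using DirectSum.Decomposition.inductionOn 𝒜 with
      | zero => exact ⟨0, by simp⟩
      | @homogeneous i m =>
        exact ⟨DirectSum.of (fun i => quotGrading 𝒜 I i) i ⟨_, m, m.2, rfl⟩, by
          rw [DirectSum.coeAddMonoidHom_of]; rfl⟩
      | add a b ha hb =>
        obtain ⟨x, hx⟩ := ha
        obtain ⟨y, hy⟩ := hb
        exact ⟨x + y, by rw [map_add, hx, hy, map_add]⟩
  exact { hmon with toDecomposition := hint.chooseDecomposition }

end Quot

section Sub

variable {ι : Type*} [DecidableEq ι] [AddCommMonoid ι]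

/-- The trace on a subalgebra of a grading. -/
def subGrading (𝒜 : ι → Submodule K R) (B : Subalgebra K R) (i : ι) : Submodule K B :=
  (𝒜 i).comap B.val.toLinearMap

/-- A subalgebra generated by homogeneous elements is graded. -/
abbrev subGradedAlgebra (𝒜 : ι → Submodule K R) [GradedAlgebra 𝒜] (s : Set R)
    (hs : ∀ x ∈ s, ∃ i, x ∈ 𝒜 i) : GradedAlgebra (subGrading 𝒜 (Algebra.adjoin K s)) := by
  have hmon : SetLike.GradedMonoid (subGrading 𝒜 (Algebra.adjoin K s)) :=
    { one_mem := by
        change (1 : R) ∈ 𝒜 0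
        exact SetLike.GradedOne.one_mem
      mul_mem := by
        intro i j x y hx hy
        change (x : R) * (y : R) ∈ 𝒜 (i + j)
        exact SetLike.GradedMul.mul_mem hx hy }
  have hint : DirectSum.IsInternal (subGrading 𝒜 (Algebra.adjoin K s)) := by
    classical
    refine ⟨?_, ?_⟩
    · rw [injective_iff_map_eq_zero]
      intro z hz
      rw [DirectSum.coeAddMonoidHom_eq_dfinsuppSum, DFinsupp.sum] at hz
      have hz' := congrArg (fun w : Algebra.adjoin K s => (w : R)) hz
      simp only [AddSubmonoidClass.coe_finsetSum, ZeroMemClass.coe_zero] at hz'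
      ext i
      by_cases hi : i ∈ DFinsupp.support z
      · have h1 := congrArg (fun r => ((DirectSum.decompose 𝒜 r) i : R)) hz'
        beta_reduce at h1
        rw [DirectSum.decompose_sum, DFinsupp.finsetSum_apply, AddSubmonoidClass.coe_finsetSum,
          DirectSum.decompose_zero, DirectSum.zero_apply, ZeroMemClass.coe_zero,
          Finset.sum_eq_single i] at h1
        · have h2 : ((z i : Algebra.adjoin K s) : R) ∈ 𝒜 i := (z i).2
          rw [DirectSum.decompose_of_mem_same _ h2] at h1
          simpa using h1
        · intro j _ hj
          have h2 : ((z j : Algebra.adjoin K s) : R) ∈ 𝒜 j := (z j).2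
          exact DirectSum.decompose_of_mem_ne _ h2 hj
        · exact fun h => absurd hi h
      · rw [DFinsupp.notMem_support_iff.1 hi]
        rfl
    · have key : ∀ y : Algebra.adjoin K s,
          y ∈ ⨆ i, subGrading 𝒜 (Algebra.adjoin K s) i := by
        intro ⟨y, hy⟩
        have hmon' : ∀ x ∈ Submonoid.closure s, ∃ i, x ∈ 𝒜 i := by
          intro x hx
          induction hx using Submonoid.closure_induction with
          | mem x hx => exact hs x hx
          | one => exact ⟨0, SetLike.GradedOne.one_mem⟩
          | mul x y _ _ hx hy =>
            obtain ⟨i, hi⟩ := hx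
            obtain ⟨j, hj⟩ := hy
            exact ⟨i + j, SetLike.GradedMul.mul_mem hi hj⟩
        have hy2 := hy
        rw [← Subalgebra.mem_toSubmodule, Algebra.adjoin_eq_span] at hy2
        induction hy2 using Submodule.span_induction with
        | mem x hx =>
          obtain ⟨i, hi⟩ := hmon' x hx
          exact Submodule.mem_iSup_of_mem i hi
        | zero => exact Submodule.zero_mem _
        | add a b ha hb iha ihb =>
          have ha' : a ∈ Algebra.adjoin K s := by
            rw [← Subalgebra.mem_toSubmodule, Algebra.adjoin_eq_span]; exact ha
          have hb' : b ∈ Algebra.adjoin K s := by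
            rw [← Subalgebra.mem_toSubmodule, Algebra.adjoin_eq_span]; exact hb
          exact Submodule.add_mem _ (iha ha') (ihb hb')
        | smul c a ha iha =>
          have ha' : a ∈ Algebra.adjoin K s := by
            rw [← Subalgebra.mem_toSubmodule, Algebra.adjoin_eq_span]; exact ha
          exact Submodule.smul_mem _ c (iha ha')
      intro y
      have := (Submodule.mem_iSup_iff_exists_dfinsupp _ _).1 (key y)
      obtain ⟨f, hf⟩ := this
      refine ⟨f, ?_⟩
      rw [DirectSum.coeAddMonoidHom_eq_dfinsuppSum, ← hf]
      simp [DFinsupp.lsum_apply_apply, DFinsupp.sumAddHom_apply]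
  exact { hmon with toDecomposition := hint.chooseDecomposition }

end Sub

/-- Eigenvectors of a family of operators for distinct characters are independent. -/
theorem eigen_sum_eq_zero {G V ι : Type*} [Monoid G] [AddCommGroup V] [Module K V]
    (ρ : G → V →ₗ[K] V) (χ : ι → G →* K) (hχ : Function.Injective χ) (s : Finset ι) (v : ι → V)
    (hv : ∀ i ∈ s, ∀ g, ρ g (v i) = χ i g • v i) (hsum : ∑ i ∈ s, v i = 0) :
    ∀ i ∈ s, v i = 0 := by
  intro i hi
  have hlin : LinearIndependent K (fun i => (χ i : G → K)) :=
    (linearIndependent_monoidHom G K).comp χ hχ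
  rw [← Module.forall_dual_apply_eq_zero_iff K]
  intro φ
  refine (linearIndependent_iff'.1 hlin) s (fun j => φ (v j)) ?_ i hi
  funext g
  have := congrArg (fun v => φ (ρ g v)) hsum
  simp only [map_sum, map_zero] at this
  rw [Finset.sum_apply]
  simp only [Pi.smul_apply, smul_eq_mul, Pi.zero_apply]
  rw [← this]
  refine Finset.sum_congr rfl fun j hj => ?_
  rw [hv j hj g, map_smul, smul_eq_mul, mul_comm]

theorem iSupIndep_eigen {G V ι : Type*} [Monoid G] [AddCommGroup V] [Module K V]
    (ρ : G → V →ₗ[K] V) (χ : ι → G →* K) (hχ : Function.Injective χ) (W : ι → Submodule K V)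
    (hW : ∀ i, ∀ v ∈ W i, ∀ g, ρ g v = χ i g • v) : iSupIndep W := by
  classical
  rw [iSupIndep_iff_dfinsupp_lsum_injective, ← LinearMap.ker_eq_bot, LinearMap.ker_eq_bot']
  intro z hz
  rw [DFinsupp.lsum_apply_apply, DFinsupp.sumAddHom_apply, DFinsupp.sum] at hz
  simp only [LinearMap.toAddMonoidHom_coe, Submodule.coe_subtype] at hz
  have h0 := eigen_sum_eq_zero ρ χ hχ z.support (fun i => (z i : V))
    (fun i _ => hW i _ (z i).2) hz
  ext i
  by_cases hi : i ∈ z.support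
  · exact h0 i hi
  · rw [DFinsupp.notMem_support_iff.1 hi]
    rfl

end Generalities

/-! ### Quasi-valuations and their associated graded algebras -/

/-- A quasi-valuation on `R` with values in `G`, extended by the value `⊤` at `0`. -/
structure QuasiValuation (K R G : Type*) [Field K] [CommRing R] [Algebra K R]
    [AddCommGroup G] [LinearOrder G] [IsOrderedAddMonoid G] where
  /-- The underlying function. -/
  toFun : R → WithTop G
  eq_top_iff : ∀ g, toFun g = ⊤ ↔ g = 0
  min_le_add : ∀ g h, min (toFun g) (toFun h) ≤ toFun (g + h)
  smul : ∀ (c : K) g, c ≠ 0 → toFun (c • g) = toFun g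
  add_le_mul : ∀ g h, toFun g + toFun h ≤ toFun (g * h)
  zero_le_one : 0 ≤ toFun 1

namespace QuasiValuation

variable {K R G : Type*} [Field K] [CommRing R] [Algebra K R]
    [AddCommGroup G] [LinearOrder G] [IsOrderedAddMonoid G] (v : QuasiValuation K R G)

/-- The set `Γ` of values of nonzero elements. -/
def values : Set G := {a | ∃ g : R, g ≠ 0 ∧ v.toFun g = a}

/-- The subspace `R_{≥ a}`. -/
def geSub (a : G) : Submodule K R where
  carrier := {g | (a : WithTop G) ≤ v.toFun g}
  zero_mem' := by
    change (a : WithTop G) ≤ v.toFun 0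
    rw [(v.eq_top_iff 0).2 rfl]; exact le_top
  add_mem' {g h} hg hh := (le_min hg hh).trans (v.min_le_add g h)
  smul_mem' c g hg := by
    change (a : WithTop G) ≤ v.toFun (c • g)
    by_cases hc : c = 0
    · rw [hc, zero_smul, (v.eq_top_iff 0).2 rfl]; exact le_top
    · rw [v.smul c g hc]; exact hg

/-- The subspace `R_{> a}`. -/
def gtSub (a : G) : Submodule K R where
  carrier := {g | (a : WithTop G) < v.toFun g}
  zero_mem' := by
    change (a : WithTop G) < v.toFun 0
    rw [(v.eq_top_iff 0).2 rfl]; exact WithTop.coe_lt_top a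
  add_mem' {g h} hg hh := lt_of_lt_of_le (lt_min hg hh) (v.min_le_add g h)
  smul_mem' c g hg := by
    change (a : WithTop G) < v.toFun (c • g)
    by_cases hc : c = 0
    · rw [hc, zero_smul, (v.eq_top_iff 0).2 rfl]; exact WithTop.coe_lt_top a
    · rw [v.smul c g hc]; exact hg

theorem mul_mem_geSub {a b : G} {g h : R} (hg : g ∈ v.geSub a) (hh : h ∈ v.geSub b) :
    g * h ∈ v.geSub (a + b) := by
  change ((a + b : G) : WithTop G) ≤ v.toFun (g * h)
  rw [WithTop.coe_add]
  exact (add_le_add hg hh).trans (v.add_le_mul g h)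

theorem mul_mem_gtSub_left {a b : G} {g h : R} (hg : g ∈ v.gtSub a) (hh : h ∈ v.geSub b) :
    g * h ∈ v.gtSub (a + b) := by
  change ((a + b : G) : WithTop G) < v.toFun (g * h)
  rw [WithTop.coe_add]
  refine lt_of_lt_of_le ?_ (v.add_le_mul g h)
  exact WithTop.add_lt_add_of_lt_of_le (WithTop.coe_ne_top) hg hh

theorem mul_mem_gtSub_right {a b : G} {g h : R} (hg : g ∈ v.geSub a) (hh : h ∈ v.gtSub b) :
    g * h ∈ v.gtSub (a + b) := by
  rw [mul_comm, add_comm]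
  exact v.mul_mem_gtSub_left hh hg

/-- The leaf `R_{≥ a} / R_{> a}`. -/
def Leaf (a : G) : Type _ := v.geSub a ⧸ (v.gtSub a).submoduleOf (v.geSub a)

instance (a : G) : AddCommGroup (v.Leaf a) :=
  inferInstanceAs (AddCommGroup (v.geSub a ⧸ (v.gtSub a).submoduleOf (v.geSub a)))

instance (a : G) : Module K (v.Leaf a) :=
  inferInstanceAs (Module K (v.geSub a ⧸ (v.gtSub a).submoduleOf (v.geSub a)))

/-- The class of `g` in the leaf at `a ≤ v g`. -/
def leafMk (a : G) (g : v.geSub a) : v.Leaf a := Submodule.Quotient.mk g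

/-- Multiplication of leaves. -/
def leafMul (a b : G) : v.Leaf a →ₗ[K] v.Leaf b →ₗ[K] v.Leaf (a + b) :=
  LinearMap.liftQ₂ ((v.gtSub a).submoduleOf (v.geSub a)) ((v.gtSub b).submoduleOf (v.geSub b))
    (LinearMap.mk₂ K (fun (x : v.geSub a) (y : v.geSub b) =>
        v.leafMk (a + b) ⟨x.1 * y.1, v.mul_mem_geSub x.2 y.2⟩)
      (fun x x' y => congrArg (v.leafMk (a + b)) (Subtype.ext (add_mul x.1 x'.1 y.1)))
      (fun c x y => congrArg (v.leafMk (a + b)) (Subtype.ext (smul_mul_assoc c x.1 y.1)))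
      (fun x y y' => congrArg (v.leafMk (a + b)) (Subtype.ext (mul_add x.1 y.1 y'.1)))
      (fun c x y => congrArg (v.leafMk (a + b)) (Subtype.ext (mul_smul_comm c x.1 y.1))))
    (fun _ hx => LinearMap.ext fun y =>
      (Submodule.Quotient.mk_eq_zero _).2 (v.mul_mem_gtSub_left hx y.2))
    (fun _ hy => LinearMap.ext fun x =>
      (Submodule.Quotient.mk_eq_zero _).2 (v.mul_mem_gtSub_right x.2 hy))

theorem leafMul_mk (a b : G) (x : v.geSub a) (y : v.geSub b) :
    v.leafMul a b (v.leafMk a x) (v.leafMk b y)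
      = v.leafMk (a + b) ⟨x.1 * y.1, v.mul_mem_geSub x.2 y.2⟩ := rfl

theorem mk_leafMk_eq {a b : G} (h : a = b) (x : v.geSub a) (y : v.geSub b) (hxy : x.1 = y.1) :
    (GradedMonoid.mk a (v.leafMk a x) : GradedMonoid v.Leaf)
      = GradedMonoid.mk b (v.leafMk b y) := by
  subst h
  rw [Subtype.ext hxy]

theorem leafMk_surjective (a : G) : Function.Surjective (v.leafMk a) :=
  Submodule.Quotient.mk_surjective _

theorem one_mem_geSub : (1 : R) ∈ v.geSub 0 := v.zero_le_one

instance : GradedMonoid.GOne v.Leaf := ⟨v.leafMk 0 ⟨1, v.one_mem_geSub⟩⟩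

instance : GradedMonoid.GMul v.Leaf := ⟨fun {a b} x y => v.leafMul a b x y⟩

instance : DirectSum.GCommRing v.Leaf where
  mul_zero _ := map_zero _
  zero_mul y := by
    change v.leafMul _ _ 0 y = 0
    rw [map_zero, LinearMap.zero_apply]
  mul_add _ _ _ := map_add _ _ _
  add_mul x x' y := by
    change v.leafMul _ _ (x + x') y = _
    rw [map_add, LinearMap.add_apply]; rfl
  one_mul := by
    rintro ⟨a, x⟩
    obtain ⟨x, rfl⟩ := v.leafMk_surjective a x
    exact v.mk_leafMk_eq (zero_add a) _ _ (one_mul x.1)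
  mul_one := by
    rintro ⟨a, x⟩
    obtain ⟨x, rfl⟩ := v.leafMk_surjective a x
    exact v.mk_leafMk_eq (add_zero a) _ _ (mul_one x.1)
  mul_assoc := by
    rintro ⟨a, x⟩ ⟨b, y⟩ ⟨c, z⟩
    obtain ⟨x, rfl⟩ := v.leafMk_surjective a x
    obtain ⟨y, rfl⟩ := v.leafMk_surjective b y
    obtain ⟨z, rfl⟩ := v.leafMk_surjective c z
    exact v.mk_leafMk_eq (add_assoc a b c) _ _ (mul_assoc x.1 y.1 z.1)
  mul_comm := by
    rintro ⟨a, x⟩ ⟨b, y⟩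
    obtain ⟨x, rfl⟩ := v.leafMk_surjective a x
    obtain ⟨y, rfl⟩ := v.leafMk_surjective b y
    exact v.mk_leafMk_eq (add_comm a b) _ _ (mul_comm x.1 y.1)
  natCast m := (m : K) • v.leafMk 0 ⟨1, v.one_mem_geSub⟩
  natCast_zero := by rw [Nat.cast_zero, zero_smul]
  natCast_succ m := by rw [Nat.cast_succ, add_smul, one_smul]; rfl
  intCast m := (m : K) • v.leafMk 0 ⟨1, v.one_mem_geSub⟩
  intCast_ofNat m := by rw [Int.cast_natCast]
  intCast_negSucc_ofNat m := by
    rw [← neg_smul]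
    congr 1
    push_cast
    ring

instance : DirectSum.GAlgebra K v.Leaf where
  toFun :=
    { toFun := fun c => c • v.leafMk 0 ⟨1, v.one_mem_geSub⟩
      map_zero' := zero_smul _ _
      map_add' := fun c d => add_smul c d _ }
  map_one := one_smul _ _
  map_mul c d := v.mk_leafMk_eq (zero_add 0).symm _ _
    (show (c * d) • (1 : R) = (c • (1 : R)) * (d • (1 : R)) by
      rw [smul_mul_smul_comm, mul_one])
  commutes c := by
    rintro ⟨a, x⟩
    obtain ⟨x, rfl⟩ := v.leafMk_surjective a x
    exact v.mk_leafMk_eq ((zero_add a).trans (add_zero a).symm) _ _ (mul_comm (c • (1 : R)) x.1)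
  smul_def c := by
    rintro ⟨a, x⟩
    obtain ⟨x, rfl⟩ := v.leafMk_surjective a x
    exact v.mk_leafMk_eq (zero_add a).symm (c • x) _
      (show c • x.1 = (c • (1 : R)) * x.1 by rw [smul_mul_assoc, one_mul])

/-- The associated graded algebra, the direct sum of all leaves. -/
abbrev Gr : Type _ := ⨁ a, v.Leaf a

/-- The subspace of `gr R` formed by the leaf at `a`. -/
def leafSub (a : G) : Submodule K v.Gr := LinearMap.range (DirectSum.lof K G v.Leaf a)

/-- The class of `g ≠ 0` in the leaf at `v g` (and `0` for `g = 0`). -/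
def symbol (g : R) : v.Gr := by
  classical
  exact if h : g = 0 then 0 else
    DirectSum.of v.Leaf ((v.toFun g).untop (mt (v.eq_top_iff g).1 h))
      (v.leafMk _ ⟨g, show ((_ : G) : WithTop G) ≤ v.toFun g from (WithTop.coe_untop _ _).le⟩)


end QuasiValuation

/-! ### Polytopes and faces -/

/-- The lattice `ℤⁿ` inside `ℝⁿ`. -/
def latticePoint {n : ℕ} (χ : Fin n → ℤ) : Fin n → ℝ := fun i => (χ i : ℝ)

/-- A full-dimensional normal lattice polytope in `ℝⁿ`. -/
structure NormalLatticePolytope (n : ℕ) where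
  /-- The underlying set. -/
  carrier : Set (Fin n → ℝ)
  isLatticePolytope : ∃ s : Finset (Fin n → ℤ), carrier = convexHull ℝ (latticePoint '' (s : Set _))
  fullDimensional : affineSpan ℝ carrier = ⊤
  normal : ∀ (k l : ℕ) (χ : Fin n → ℤ), latticePoint χ ∈ ((k + l : ℕ) : ℝ) • carrier →
    ∃ α β : Fin n → ℤ, latticePoint α ∈ (k : ℝ) • carrier ∧ latticePoint β ∈ (l : ℝ) • carrier ∧
      α + β = χ

variable {n : ℕ} (P : NormalLatticePolytope n)

/-- The set `A` of (nonempty) faces of `P`, ordered by inclusion. -/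
abbrev Face : Type := {F : Set (Fin n → ℝ) // F.Nonempty ∧ IsExposed ℝ P.carrier F}

theorem NormalLatticePolytope.nonempty : P.carrier.Nonempty := by
  rw [Set.nonempty_iff_ne_empty]
  intro h
  have := P.fullDimensional
  rw [h, AffineSubspace.span_empty] at this
  exact AffineSubspace.bot_ne_top ℝ (Fin n → ℝ) (Fin n → ℝ) this

instance : Nonempty (Face P) := ⟨⟨P.carrier, P.nonempty, IsExposed.refl P.carrier⟩⟩

instance : Finite (Face P) := by
  obtain ⟨s, hs⟩ := P.isLatticePolytope
  have hfin : (latticePoint '' (s : Set (Fin n → ℤ))).Finite := s.finite_toSet.image _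
  have hcomp : IsCompact P.carrier := hs ▸ hfin.isCompact_convexHull ℝ
  have hconv : Convex ℝ P.carrier := hs ▸ convex_convexHull ℝ _
  have : Finite (Set.powerset (latticePoint '' (s : Set (Fin n → ℤ)))) := hfin.powerset.to_subtype
  have hsub : ∀ F : Face P, Set.extremePoints ℝ F.1 ⊆ latticePoint '' (s : Set (Fin n → ℤ)) := by
    intro F
    refine F.2.2.isExtreme.extremePoints_subset_extremePoints.trans ?_
    rw [hs]
    exact extremePoints_convexHull_subset
  refine Finite.of_injective
    (fun F : Face P => (⟨Set.extremePoints ℝ F.1, hsub F⟩ :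
      Set.powerset (latticePoint '' (s : Set (Fin n → ℤ))))) ?_
  intro F F' h
  have h' : Set.extremePoints ℝ F.1 = Set.extremePoints ℝ F'.1 := congrArg Subtype.val h
  apply Subtype.ext
  rw [← closure_convexHull_extremePoints (F.2.2.isCompact hcomp) (F.2.2.convex hconv), h',
    closure_convexHull_extremePoints (F'.2.2.isCompact hcomp) (F'.2.2.convex hconv)]

/-- `Flag (Face P)` is Mathlib's type of maximal chains of faces. -/
instance : Finite (Flag (Face P)) :=
  Finite.of_injective (fun C : Flag (Face P) => (C : Set (Face P))) SetLike.coe_injective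

/-- A linearization `>ᵗ` of the partial order on the set of faces. -/
structure Linearization where
  /-- The total order. -/
  order : LinearOrder (Face P)
  lt_of_lt : ∀ σ τ : Face P, σ < τ → order.lt σ τ

/-! ### The embedded toric variety -/

/-- The lattice points of `P`. -/
abbrev Lambda : Type := {χ : Fin n → ℤ // latticePoint χ ∈ P.carrier}

variable (K : Type*) [Field K]

/-- The torus `T̂ = K* × T`, where `T = (K*)ⁿ`. -/
abbrev TorusHat (n : ℕ) : Type _ := Kˣ × (Fin n → Kˣ)

/-- The character lattice `M̂ = ℤ ⊕ M` of `T̂`, where `M = ℤⁿ`. -/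
abbrev WeightLattice (n : ℕ) : Type := ℤ × (Fin n → ℤ)

variable {K}

/-- The character of `T̂` given by an element of `M̂`. -/
def character (w : WeightLattice n) : TorusHat K n →* Kˣ where
  toFun t := t.1 ^ w.1 * ∏ i, t.2 i ^ w.2 i
  map_one' := by simp
  map_mul' s t := by
    simp only [Prod.fst_mul, Prod.snd_mul, Pi.mul_apply, mul_zpow, Finset.prod_mul_distrib]
    exact mul_mul_mul_comm _ _ _ _

theorem character_add (w w' : WeightLattice n) (t : TorusHat K n) :
    character (w + w') t = character w t * character w' t := by
  simp only [character, MonoidHom.coe_mk, OneHom.coe_mk, Prod.fst_add, Prod.snd_add, Pi.add_apply,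
    zpow_add, Finset.prod_mul_distrib]
  exact mul_mul_mul_comm _ _ _ _

theorem character_zero (t : TorusHat K n) : character (0 : WeightLattice n) t = 1 := by
  simp [character]

theorem character_neg (w : WeightLattice n) (t : TorusHat K n) :
    character (-w) t = (character w t)⁻¹ := by
  rw [eq_inv_iff_mul_eq_one, ← character_add, neg_add_cancel, character_zero]

theorem character_injective [CharZero K] : Function.Injective
    (fun w : WeightLattice n => (Units.coeHom K).comp (character (K := K) w)) := by
  have h2 : (2 : K) ≠ 0 := two_ne_zero
  have hz : ∀ a b : ℤ, (2 : K) ^ a = (2 : K) ^ b → a = b := by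
    intro a b h
    have h' : ((2 : ℚ) ^ a) = (2 : ℚ) ^ b := by
      have : (((2 : ℚ) ^ a : ℚ) : K) = (((2 : ℚ) ^ b : ℚ) : K) := by
        push_cast; exact h
      exact_mod_cast this
    exact zpow_right_injective₀ (by norm_num) (by norm_num) h'
  intro w w' h
  have hev : ∀ t : TorusHat K n, ((character w t : Kˣ) : K) = (character w' t : Kˣ) :=
    fun t => DFunLike.congr_fun h t
  refine Prod.ext ?_ (funext fun i => ?_)
  · have := hev (Units.mk0 2 h2, 1)
    simp only [character, MonoidHom.coe_mk, OneHom.coe_mk, Pi.one_apply, one_zpow,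
      Finset.prod_const_one, mul_one, Units.val_zpow_eq_zpow_val, Units.val_mk0] at this
    exact hz _ _ this
  · have := hev (1, Function.update 1 i (Units.mk0 2 h2))
    simp only [character, MonoidHom.coe_mk, OneHom.coe_mk, one_zpow, one_mul] at this
    rw [Finset.prod_eq_single i, Finset.prod_eq_single i] at this
    · simp only [Function.update_self, Units.val_zpow_eq_zpow_val, Units.val_mk0] at this
      exact hz _ _ this
    all_goals first
      | (intro j _ hj; rw [Function.update_of_ne hj]; simp)
      | (intro hh; exact absurd (Finset.mem_univ i) hh)

variable (K)

/-- The map `ι̂ : T̂ → V = K^Λ`, `(c, t) ↦ ∑ c χ(t) e_χ`. -/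
def iotaHat (t : TorusHat K n) : Lambda P → K := fun χ => (character (1, χ.1) t : Kˣ)

/-- The affine cone `X̂_P ⊆ V`, the Zariski closure of the image of `ι̂`. -/
def affineCone : Set (Lambda P → K) :=
  MvPolynomial.zeroLocus K (MvPolynomial.vanishingIdeal K (Set.range (iotaHat P K)))

/-- The vanishing ideal of `X̂_P`. -/
def coneIdeal : Ideal (MvPolynomial (Lambda P) K) :=
  MvPolynomial.vanishingIdeal K (affineCone P K)

/-- The coordinate ring `K[X̂_P]` of the affine cone, which is also the homogeneous coordinate ring
of `X_P ⊆ ℙ(V)`. -/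
abbrev CoordRing : Type _ := MvPolynomial (Lambda P) K ⧸ coneIdeal P K

theorem mem_coneIdeal (p : MvPolynomial (Lambda P) K) :
    p ∈ coneIdeal P K ↔ ∀ t : TorusHat K n, MvPolynomial.aeval (iotaHat P K t) p = 0 := by
  constructor
  · intro h t
    exact h _ (fun q hq => hq _ ⟨t, rfl⟩)
  · intro h x hx
    refine hx p ?_
    rintro _ ⟨t, rfl⟩
    exact h t

/-- The action of `T̂` on polynomial functions on `V`, `(t · g)(v) = g(t⁻¹ v)`. -/
def polyAction (t : TorusHat K n) : MvPolynomial (Lambda P) K →ₐ[K] MvPolynomial (Lambda P) K :=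
  MvPolynomial.aeval fun χ =>
    MvPolynomial.C (((character (1, χ.1) t)⁻¹ : Kˣ) : K) * MvPolynomial.X χ

theorem aeval_polyAction (t : TorusHat K n) (v : Lambda P → K) (p : MvPolynomial (Lambda P) K) :
    MvPolynomial.aeval v (polyAction P K t p)
      = MvPolynomial.aeval (fun χ => (((character (1, χ.1) t)⁻¹ : Kˣ) : K) * v χ) p := by
  rw [polyAction, ← AlgHom.comp_apply]
  congr 1
  ext χ
  simp

theorem polyAction_mem (t : TorusHat K n) {p : MvPolynomial (Lambda P) K}
    (hp : p ∈ coneIdeal P K) : polyAction P K t p ∈ coneIdeal P K := by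
  rw [mem_coneIdeal] at hp ⊢
  intro s
  rw [aeval_polyAction]
  convert hp (t⁻¹ * s) using 3
  funext χ
  simp only [iotaHat]
  rw [map_mul, map_inv, Units.val_mul]

/-- The induced action of `T̂` on `K[X̂_P]`. -/
def torusAction (t : TorusHat K n) : CoordRing P K →ₐ[K] CoordRing P K :=
  Ideal.quotientMapₐ (coneIdeal P K) (polyAction P K t) fun _ hp => polyAction_mem P K t hp

/-- The space of `T̂`-eigenfunctions of weight `w` (together with `0`). -/
def weightSpace (w : WeightLattice n) : Submodule K (CoordRing P K) where
  carrier := {g | ∀ t, torusAction P K t g = (character w t : K) • g}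
  zero_mem' t := by rw [map_zero, smul_zero]
  add_mem' {g h} hg hh t := by rw [map_add, hg t, hh t, smul_add]
  smul_mem' c g hg t := by rw [map_smul, hg t, smul_comm]

instance : SetLike.GradedMonoid (weightSpace P K) where
  one_mem t := by rw [map_one, character_zero, Units.val_one, one_smul]
  mul_mem w w' g h hg hh t := by
    rw [map_mul, hg t, hh t, character_add, Units.val_mul, smul_mul_smul_comm]

/-- The weight of a monomial. -/
def monWeight (m : Lambda P →₀ ℕ) : WeightLattice n :=
  -(m.sum fun χ k => (k • ((1 : ℤ), χ.1) : WeightLattice n))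

theorem monomial_mem (m : Lambda P →₀ ℕ) (c : K) :
    Ideal.Quotient.mk (coneIdeal P K) (MvPolynomial.monomial m c)
      ∈ weightSpace P K (monWeight P m) := by
  induction m using Finsupp.induction generalizing c with
  | zero =>
    intro t
    have h0 : monWeight P (0 : Lambda P →₀ ℕ) = 0 := by
      rw [monWeight, Finsupp.sum_zero_index, neg_zero]
    rw [h0, character_zero, Units.val_one, one_smul]
    exact (torusAction P K t).commutes c
  | single_add χ k m _ _ ih =>
    have hX : Ideal.Quotient.mk (coneIdeal P K) (MvPolynomial.X χ)
        ∈ weightSpace P K (-((1 : ℤ), χ.1)) := by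
      intro t
      change Ideal.Quotient.mk (coneIdeal P K) (polyAction P K t (MvPolynomial.X χ)) = _
      rw [polyAction, MvPolynomial.aeval_X, character_neg, ← MvPolynomial.smul_eq_C_mul]
      rfl
    have hmul := SetLike.GradedMul.mul_mem (SetLike.pow_mem_graded k hX) (ih c)
    rw [← map_pow, ← map_mul, MvPolynomial.X_pow_eq_monomial, MvPolynomial.monomial_mul,
      one_mul] at hmul
    convert hmul using 2
    rw [monWeight, Finsupp.sum_add_index' (by simp) (by intros; rw [add_smul]),
      Finsupp.sum_single_index (by simp), monWeight, neg_add, smul_neg]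

theorem iSup_weightSpace (g : CoordRing P K) : g ∈ ⨆ w, weightSpace P K w := by
  obtain ⟨p, rfl⟩ := Ideal.Quotient.mk_surjective g
  induction p using MvPolynomial.induction_on' with
  | monomial m c => exact Submodule.mem_iSup_of_mem _ (monomial_mem P K m c)
  | add p q hp hq => rw [map_add]; exact Submodule.add_mem _ hp hq

theorem monWeight_fst (m : Lambda P →₀ ℕ) : (monWeight P m).1 = -((m.degree : ℕ) : ℤ) := by
  induction m using Finsupp.induction with
  | zero => simp [monWeight]
  | single_add χ k m _ _ ih =>
    have h : monWeight P (Finsupp.single χ k + m)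
        = -(k • ((1 : ℤ), χ.1)) + monWeight P m := by
      rw [monWeight, Finsupp.sum_add_index' (by simp) (by intros; rw [add_smul]),
        Finsupp.sum_single_index (by simp), monWeight, neg_add]
    rw [h, Prod.fst_add, ih, map_add, Finsupp.degree_single]
    simp
    ring

variable [CharZero K]

theorem iSupIndep_weightSpace : iSupIndep (weightSpace P K) :=
  iSupIndep_eigen (fun t => (torusAction P K t).toLinearMap)
    (fun w => (Units.coeHom K).comp (character w)) character_injective _ fun _ _ hg t => hg t

/-- Every function is uniquely a sum of `T̂`-eigenfunctions of distinct weights. -/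
instance : GradedAlgebra (weightSpace P K) where
  toDecomposition := DirectSum.IsInternal.chooseDecomposition _
    (DirectSum.isInternal_submodule_of_iSupIndep_of_iSup_eq_top (iSupIndep_weightSpace P K)
      (eq_top_iff.2 fun g _ => iSup_weightSpace P K g))

variable {P K} in
/-- The weights `η` for which the component `g_η` of `g` is nonzero. -/
def weightSupport (g : CoordRing P K) : Finset (WeightLattice n) := by
  classical
  exact (DirectSum.decompose (weightSpace P K) g).support

section

variable {P K}

theorem mem_weightSupport {g : CoordRing P K} {w : WeightLattice n} :
    w ∈ weightSupport g ↔ (DirectSum.decompose (weightSpace P K) g w : CoordRing P K) ≠ 0 := by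
  classical
  rw [weightSupport, DFinsupp.mem_support_iff, ne_eq, ne_eq, ZeroMemClass.coe_eq_zero]

theorem weightSupport_eq_empty {g : CoordRing P K} : weightSupport g = ∅ ↔ g = 0 := by
  classical
  rw [weightSupport, DFinsupp.support_eq_empty]
  exact (DirectSum.decomposeAddEquiv (weightSpace P K)).map_eq_zero_iff

theorem exists_monWeight {g : CoordRing P K} {w : WeightLattice n} (h : w ∈ weightSupport g) :
    ∃ m, w = monWeight P m := by
  rw [mem_weightSupport] at h
  obtain ⟨p, rfl⟩ := Ideal.Quotient.mk_surjective g
  by_contra hne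
  push Not at hne
  apply h
  induction p using MvPolynomial.induction_on' with
  | monomial m c => exact DirectSum.decompose_of_mem_ne _ (monomial_mem P K m c) (hne m).symm
  | add p q hp hq =>
    rw [map_add, DirectSum.decompose_add, DirectSum.add_apply, Submodule.coe_add]
    rw [not_not.1 (fun h' => h' (by_contra fun h'' => h'' (hp h''))),
      not_not.1 (fun h' => h' (by_contra fun h'' => h'' (hq h''))), add_zero]

theorem weightSupport_add {g h : CoordRing P K} {w : WeightLattice n}
    (hw : w ∈ weightSupport (g + h)) : w ∈ weightSupport g ∨ w ∈ weightSupport h := by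
  rw [mem_weightSupport] at hw
  rw [mem_weightSupport, mem_weightSupport]
  by_contra hne
  push Not at hne
  apply hw
  rw [DirectSum.decompose_add, DirectSum.add_apply, Submodule.coe_add, hne.1, hne.2, add_zero]

theorem weightSupport_smul {g : CoordRing P K} {c : K} (hc : c ≠ 0) :
    weightSupport (c • g) = weightSupport g := by
  ext w
  rw [mem_weightSupport, mem_weightSupport, DirectSum.decompose_smul, DirectSum.smul_apply,
    Submodule.coe_smul, smul_ne_zero_iff]
  exact ⟨fun h => h.2, fun h => ⟨hc, h⟩⟩

theorem weightSupport_mul {g h : CoordRing P K} {w : WeightLattice n}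
    (hw : w ∈ weightSupport (g * h)) :
    ∃ w₁ ∈ weightSupport g, ∃ w₂ ∈ weightSupport h, w = w₁ + w₂ := by
  classical
  rw [mem_weightSupport] at hw
  by_contra hne
  push Not at hne
  apply hw
  have hg := DirectSum.sum_support_decompose (weightSpace P K) g
  have hh := DirectSum.sum_support_decompose (weightSpace P K) h
  rw [← hg, ← hh, Finset.sum_mul_sum, DirectSum.decompose_sum, DFinsupp.finsetSum_apply,
    AddSubmonoidClass.coe_finsetSum]
  refine Finset.sum_eq_zero fun w₁ h₁ => ?_
  rw [DirectSum.decompose_sum, DFinsupp.finsetSum_apply, AddSubmonoidClass.coe_finsetSum]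
  refine Finset.sum_eq_zero fun w₂ h₂ => ?_
  refine DirectSum.decompose_of_mem_ne _ (SetLike.GradedMul.mul_mem (Subtype.mem _) (Subtype.mem _))
    (hne w₁ ?_ w₂ ?_).symm
  · rw [weightSupport]; convert h₁
  · rw [weightSupport]; convert h₂

theorem weightSupport_one {w : WeightLattice n} (hw : w ∈ weightSupport (1 : CoordRing P K)) :
    w = 0 := by
  rw [mem_weightSupport] at hw
  by_contra hne
  exact hw (DirectSum.decompose_of_mem_ne _ (SetLike.GradedOne.one_mem) (Ne.symm hne))

end

attribute [local instance] MvPolynomial.gradedAlgebra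

theorem coneIdeal_isHomogeneous :
    (coneIdeal P K).IsHomogeneous (MvPolynomial.homogeneousSubmodule (Lambda P) K) := by
  have hzinj : Function.Injective (fun m : ℕ =>
      (Units.coeHom K).comp (zpowGroupHom (α := Kˣ) (-(m : ℤ)))) := by
    intro m m' h
    have := character_injective (K := K) (n := 0) (a₁ := (-(m : ℤ), 0)) (a₂ := (-(m' : ℤ), 0)) (by
      ext t
      have := DFunLike.congr_fun h t.1
      simpa [character] using this)
    simpa using congrArg Prod.fst this
  have hind : ∀ m, ∀ v ∈ quotGrading (MvPolynomial.homogeneousSubmodule (Lambda P) K)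
      (coneIdeal P K) m, ∀ c : Kˣ, (torusAction P K (c, 1)).toLinearMap v
        = ((Units.coeHom K).comp (zpowGroupHom (α := Kˣ) (-(m : ℤ)))) c • v := by
    rintro m _ ⟨p, hp, rfl⟩ c
    change torusAction P K (c, 1) (Ideal.Quotient.mk _ p) = _ • Ideal.Quotient.mk _ p
    conv_lhs => rw [p.as_sum]
    conv_rhs => rw [p.as_sum]
    rw [map_sum, map_sum, Finset.smul_sum]
    refine Finset.sum_congr rfl fun s hs => ?_
    rw [monomial_mem P K s _ (c, 1)]
    congr 1
    have hdeg : s.degree = m := by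
      have := (MvPolynomial.mem_homogeneousSubmodule _ _).1 hp (MvPolynomial.mem_support_iff.1 hs)
      rw [Finsupp.degree_eq_weight_one]; exact this
    simp only [character, MonoidHom.coe_mk, OneHom.coe_mk, Pi.one_apply, one_zpow,
      Finset.prod_const_one, mul_one, monWeight_fst, hdeg]
    rfl
  intro i p hp
  classical
  have hsum := DirectSum.sum_support_decompose (MvPolynomial.homogeneousSubmodule (Lambda P) K) p
  by_cases hi : i ∈ (DirectSum.decompose (MvPolynomial.homogeneousSubmodule (Lambda P) K) p).support
  · rw [← Ideal.Quotient.eq_zero_iff_mem]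
    rw [← hsum, ← Ideal.Quotient.eq_zero_iff_mem, map_sum] at hp
    exact eigen_sum_eq_zero (fun c : Kˣ => (torusAction P K (c, 1)).toLinearMap) _ hzinj _
      (fun j => Ideal.Quotient.mk (coneIdeal P K)
        (DirectSum.decompose (MvPolynomial.homogeneousSubmodule (Lambda P) K) p j))
      (fun j _ => hind j _ ⟨_, Subtype.mem _, rfl⟩) hp i hi
  · rw [DFinsupp.notMem_support_iff.1 hi]
    exact Ideal.zero_mem _

/-- The grading of the homogeneous coordinate ring. -/
abbrev coordGrading : ℕ → Submodule K (CoordRing P K) :=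
  quotGrading (MvPolynomial.homogeneousSubmodule (Lambda P) K) (coneIdeal P K)

instance : GradedAlgebra (coordGrading P K) :=
  quotGradedAlgebra _ _ (coneIdeal_isHomogeneous P K)

/-! ### Combinatorial Seshadri stratifications -/

/-- A combinatorial Seshadri stratification on `X_P`. The orbit closures `X_σ` are determined by
the faces `σ`, so the data are the functions `f_σ`. The `T̂`-weight of `f_σ` is
`μ_σ = (-deg f_σ, wt σ)`. -/
structure SeshadriStratification where
  /-- The function `f_σ`. -/
  f : Face P → CoordRing P K
  /-- The degree of `f_σ`. -/
  deg : Face P → ℕ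
  /-- The second component of the `T̂`-weight of `f_σ`. -/
  wt : Face P → Fin n → ℤ
  f_ne_zero : ∀ σ, f σ ≠ 0
  deg_pos : ∀ σ, 1 ≤ deg σ
  f_mem : ∀ σ, f σ ∈ weightSpace P K (-(deg σ : ℤ), wt σ)
  mem_relInt : ∀ σ, (fun i => -(wt σ i : ℝ) / (deg σ : ℝ)) ∈ intrinsicInterior ℝ σ.1

/-- The set of faces, ordered by `>ᵗ`. -/
def OrderedFace {P : NormalLatticePolytope n} (_ : Linearization P) : Type := Face P

instance {P : NormalLatticePolytope n} (t : Linearization P) : LinearOrder (OrderedFace t) :=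
  t.order

instance {P : NormalLatticePolytope n} (t : Linearization P) : Finite (OrderedFace t) :=
  inferInstanceAs (Finite (Face P))

/-- `ℚ^A`. -/
def RatVec {P : NormalLatticePolytope n} (_ : Linearization P) : Type := Face P → ℚ

namespace RatVec

variable {P} (t : Linearization P)

instance : AddCommGroup (RatVec t) := inferInstanceAs (AddCommGroup (Face P → ℚ))

instance : Module ℚ (RatVec t) := inferInstanceAs (Module ℚ (Face P → ℚ))

/-- The lexicographic order on `ℚ^A` induced by `>ᵗ`: the coordinate at the `>ᵗ`-largest face at
which two vectors differ decides. -/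
instance : LinearOrder (RatVec t) :=
  inferInstanceAs (LinearOrder (Colex (OrderedFace t → ℚ)))

theorem lt_iff (a b : RatVec t) :
    a < b ↔ ∃ σ, (∀ τ, t.order.lt σ τ → a τ = b τ) ∧ a σ < b σ := Iff.rfl

instance : IsOrderedAddMonoid (RatVec t) where
  add_le_add_left a b hab c := by
    rcases hab.eq_or_lt with rfl | hlt
    · exact le_refl _
    · refine le_of_lt ?_
      rw [lt_iff] at hlt ⊢
      obtain ⟨σ, h1, h2⟩ := hlt
      refine ⟨σ, fun τ hτ => ?_, ?_⟩
      · change a τ + c τ = b τ + c τ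
        rw [h1 τ hτ]
      · change a σ + c σ < b σ + c σ
        linarith

end RatVec

/-- The inclusion of `M̂` into `M̂_ℚ = ℚ ⊕ M_ℚ`. -/
def toRat (w : WeightLattice n) : ℚ × (Fin n → ℚ) := ((w.1 : ℚ), fun i => (w.2 i : ℚ))

theorem toRat_add (w w' : WeightLattice n) : toRat (w + w') = toRat w + toRat w' := by
  refine Prod.ext ?_ (funext fun i => ?_) <;> simp [toRat]

theorem toRat_zero : toRat (0 : WeightLattice n) = 0 := by
  refine Prod.ext ?_ (funext fun i => ?_) <;> simp [toRat]

namespace SeshadriStratification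

variable {P K} (S : SeshadriStratification P K) (t : Linearization P)

/-- The `T̂`-weight `μ_σ` of `f_σ`. -/
def mu (σ : Face P) : WeightLattice n := (-(S.deg σ : ℤ), S.wt σ)

/-- The marked point `-μ_σ / deg f_σ` in the relative interior of `σ`. -/
def markedPoint (σ : Face P) : Fin n → ℝ := fun i => -(S.wt σ i : ℝ) / (S.deg σ : ℝ)

/-- The simplex `Δ_C` of the associated triangulation of `P`, for a chain `C` of faces. -/
def simplex (C : Set (Face P)) : Set (Fin n → ℝ) := convexHull ℝ (S.markedPoint '' C)

open Classical in
/-- The coordinates in `ℚ^C ⊆ ℚ^A` of an element of `M̂_ℚ` with respect to the basis `(μ_σ)_{σ ∈ C}`,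
for a maximal chain `C`. (These weights always form a basis, so the case distinction only serves to
have the basis at hand.) -/
def coord (C : Flag (Face P)) : (ℚ × (Fin n → ℚ)) →ₗ[ℚ] (Face P → ℚ) :=
  if h : LinearIndependent ℚ (fun σ : C => toRat (S.mu σ)) ∧
      ⊤ ≤ Submodule.span ℚ (Set.range fun σ : C => toRat (S.mu σ)) then
    Finsupp.lcoeFun ∘ₗ Finsupp.lmapDomain ℚ ℚ (Subtype.val : C → Face P) ∘ₗ
      (Module.Basis.mk h.1 h.2).repr.toLinearMap
  else 0

/-- The value of `ν_C` at a `T̂`-eigenfunction of weight `w`. -/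
def eigenValue (C : Flag (Face P)) (w : WeightLattice n) : RatVec t := S.coord C (toRat w)

/-- The valuation `ν_C` for a maximal chain `C`: the minimum over the `T̂`-eigencomponents of `g` of
the coordinates of their weights (and `⊤` for `g = 0`). -/
def nuChain (C : Flag (Face P)) (g : CoordRing P K) : WithTop (RatVec t) :=
  (weightSupport g).inf fun w => (S.eigenValue t C w : WithTop (RatVec t))

/-- The quasi-valuation `ν`, the minimum of the valuations `ν_C` over all maximal chains `C`. -/
def nu (g : CoordRing P K) : WithTop (RatVec t) :=
  (Set.toFinite (Set.univ : Set (Flag (Face P)))).toFinset.inf fun C => S.nuChain t C g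

theorem nu_le {C : Flag (Face P)} {g : CoordRing P K} {w : WeightLattice n}
    (hw : w ∈ weightSupport g) :
    S.nu t g ≤ (S.eigenValue t C w : WithTop (RatVec t)) :=
  (Finset.inf_le (by simp)).trans (Finset.inf_le hw)

theorem le_nu {a : WithTop (RatVec t)} {g : CoordRing P K}
    (h : ∀ C, ∀ w ∈ weightSupport g,
      a ≤ (S.eigenValue t C w : WithTop (RatVec t))) : a ≤ S.nu t g :=
  Finset.le_inf fun C _ => Finset.le_inf fun w hw => h C w hw

theorem exists_nu_eq {g : CoordRing P K} (hg : g ≠ 0) :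
    ∃ C, ∃ w ∈ weightSupport g,
      S.nu t g = (S.eigenValue t C w : WithTop (RatVec t)) := by
  have h1 : (Set.toFinite (Set.univ : Set (Flag (Face P)))).toFinset.Nonempty := by
    rw [Set.Finite.toFinset_nonempty]; exact Set.univ_nonempty
  have h2 : (weightSupport g).Nonempty := by
    rw [Finset.nonempty_iff_ne_empty, ne_eq, weightSupport_eq_empty]; exact hg
  obtain ⟨C, -, hC⟩ := Finset.exists_mem_eq_inf _ h1 fun C => S.nuChain t C g
  obtain ⟨w, hw, hw'⟩ := Finset.exists_mem_eq_inf _ h2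
    fun w => (S.eigenValue t C w : WithTop (RatVec t))
  exact ⟨C, w, hw, hC.trans hw'⟩

/-- The quasi-valuation on `K[X̂_P]` associated to a stratification and a linearization. -/
def quasiValuation : QuasiValuation K (CoordRing P K) (RatVec t) where
  toFun := S.nu t
  eq_top_iff g := by
    constructor
    · intro h
      by_contra hg
      obtain ⟨C, w, -, hw⟩ := S.exists_nu_eq t hg
      exact WithTop.coe_ne_top (hw.symm.trans h)
    · rintro rfl
      refine top_le_iff.1 (S.le_nu t fun C w hw => ?_)
      rw [weightSupport_eq_empty.2 rfl] at hw
      simp at hw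
  min_le_add g h := by
    refine S.le_nu t fun C w hw => ?_
    rcases weightSupport_add hw with hw | hw
    · exact (min_le_left _ _).trans (S.nu_le t hw)
    · exact (min_le_right _ _).trans (S.nu_le t hw)
  smul c g hc := by
    simp only [nu, nuChain, weightSupport_smul hc]
  add_le_mul g h := by
    refine S.le_nu t fun C w hw => ?_
    obtain ⟨w₁, h₁, w₂, h₂, rfl⟩ := weightSupport_mul hw
    have : S.eigenValue t C (w₁ + w₂) = S.eigenValue t C w₁ + S.eigenValue t C w₂ := by
      rw [eigenValue, toRat_add, map_add]; rfl
    rw [this, WithTop.coe_add]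
    exact add_le_add (S.nu_le t (C := C) h₁) (S.nu_le t (C := C) h₂)
  zero_le_one := by
    refine S.le_nu t fun C w hw => ?_
    have : S.eigenValue t C w = 0 := by
      rw [weightSupport_one hw, eigenValue, toRat_zero, map_zero]; rfl
    rw [this]
    exact le_refl _

/-- The image `Γ ⊆ ℚ^A` of the quasi-valuation. -/
def Gam : Set (Face P → ℚ) := (S.quasiValuation t).values

theorem exists_degree (a : S.Gam t) : ∃ m : ℕ, (m : ℚ) = ∑ᶠ σ, a.1 σ * (S.deg σ : ℚ) := by
  classical
  obtain ⟨a, g, hg, ha⟩ := a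
  obtain ⟨C, w, hw, hw'⟩ := S.exists_nu_eq t hg
  have haw : S.coord C (toRat w) = a := WithTop.coe_injective (hw'.symm.trans ha)
  obtain ⟨m, rfl⟩ := exists_monWeight hw
  let _ := Fintype.ofFinite (Face P)
  simp only [finsum_eq_sum_of_fintype]
  rw [← haw]
  by_cases h : LinearIndependent ℚ (fun σ : C => toRat (S.mu σ)) ∧
      ⊤ ≤ Submodule.span ℚ (Set.range fun σ : C => toRat (S.mu σ))
  · refine ⟨m.degree, ?_⟩
    rw [coord, dif_pos h]
    set b := Module.Basis.mk h.1 h.2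
    set x := toRat (monWeight P m)
    have h1 := congrArg Prod.fst (b.linearCombination_repr x)
    rw [Finsupp.linearCombination_apply, Finsupp.sum, Prod.fst_sum] at h1
    have h2 : x.1 = -(m.degree : ℚ) := by
      simp [x, toRat, monWeight_fst]
    rw [h2] at h1
    have h3 : ∀ σ : C, (b σ).1 = -(S.deg σ : ℚ) := by
      intro σ
      rw [Module.Basis.mk_apply]
      simp [toRat, mu]
    simp only [Prod.smul_fst, h3, smul_eq_mul, mul_neg, Finset.sum_neg_distrib] at h1
    rw [← neg_inj.1 h1]
    change _ = ∑ σ, (Finsupp.mapDomain Subtype.val (b.repr x)) σ * _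
    rw [← Finsupp.sum_fintype (Finsupp.mapDomain Subtype.val (b.repr x))
      (fun σ r => r * (S.deg σ : ℚ)) (by simp), Finsupp.sum_mapDomain_index (by simp)
      (by intros; rw [add_mul])]
    rfl
  · refine ⟨0, ?_⟩
    rw [coord, dif_neg h]
    simp

/-- The degree `∑ a_σ deg f_σ` of the element `a` of `Γ`. -/
def gamDeg (a : S.Gam t) : ℕ := (S.exists_degree t a).choose

theorem gamDeg_eq (a : S.Gam t) : (S.gamDeg t a : ℚ) = ∑ᶠ σ, a.1 σ * (S.deg σ : ℚ) :=
  (S.exists_degree t a).choose_spec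

end SeshadriStratification

/-! ### The fan algebra -/

/-- The cone in `ℚ^A` spanned by the basis vectors `e_σ`, `σ ∈ C`. -/
def coneOf {A : Type*} (C : Set A) : Set (A → ℚ) := {a | (∀ σ, 0 ≤ a σ) ∧ ∀ σ, σ ∉ C → a σ = 0}

/-- Two vectors lie in a common cone `K_C`, for a chain `C ⊆ A`. -/
def InCommonCone {A : Type*} [PartialOrder A] (a b : A → ℚ) : Prop :=
  ∃ C : Set A, IsChain (· ≤ ·) C ∧ a ∈ coneOf C ∧ b ∈ coneOf C

/-- The defining relations of the fan algebra: `y_a y_b = y_{a+b}` if `a` and `b` lie in a common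
cone, `y_a y_b = 0` otherwise, and `y_0 = 1`. -/
inductive FanRel (K : Type*) [Field K] {A : Type*} [PartialOrder A] (Γ : Set (A → ℚ)) :
    MvPolynomial Γ K → Prop
  | mul (a b c : Γ) (h : InCommonCone a.1 b.1) (hc : c.1 = a.1 + b.1) :
      FanRel K Γ (MvPolynomial.X a * MvPolynomial.X b - MvPolynomial.X c)
  | zero (a b : Γ) (h : ¬ InCommonCone a.1 b.1) :
      FanRel K Γ (MvPolynomial.X a * MvPolynomial.X b)
  | one (c : Γ) (hc : c.1 = 0) : FanRel K Γ (MvPolynomial.X c - 1)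

/-- The ideal `I(Γ)`. -/
def fanIdeal (K : Type*) [Field K] {A : Type*} [PartialOrder A] (Γ : Set (A → ℚ)) :
    Ideal (MvPolynomial Γ K) := Ideal.span {p | FanRel K Γ p}

/-- The fan algebra `K[Γ]`. -/
abbrev FanAlgebra (K : Type*) [Field K] {A : Type*} [PartialOrder A] (Γ : Set (A → ℚ)) : Type _ :=
  MvPolynomial Γ K ⧸ fanIdeal K Γ

/-- The generator `y_a` of the fan algebra. -/
def fanY (K : Type*) [Field K] {A : Type*} [PartialOrder A] {Γ : Set (A → ℚ)} (a : Γ) :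
    FanAlgebra K Γ := Ideal.Quotient.mk _ (MvPolynomial.X a)

namespace SeshadriStratification

open AlgebraicGeometry

variable {P K} (S : SeshadriStratification P K) (t : Linearization P)

/-- The associated graded algebra `gr_ν K[X̂_P]`. -/
abbrev GrAlg : Type _ := (S.quasiValuation t).Gr

/-- The fan algebra `K[Γ]`. -/
abbrev FanAlg : Type _ := FanAlgebra K (S.Gam t)

attribute [local instance] MvPolynomial.weightedGradedAlgebra

theorem fanIdeal_isHomogeneous : (fanIdeal K (S.Gam t)).IsHomogeneous
    (MvPolynomial.weightedHomogeneousSubmodule K (S.gamDeg t)) := by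
  have hfin : ∀ a : Face P → ℚ, (Function.support fun σ => a σ * (S.deg σ : ℚ)).Finite :=
    fun a => Set.toFinite _
  refine Ideal.homogeneous_span _ _ ?_
  rintro p (⟨a, b, c, h, hc⟩ | ⟨a, b, h⟩ | ⟨c, hc⟩)
  · refine ⟨S.gamDeg t a + S.gamDeg t b, Submodule.sub_mem _ ?_ ?_⟩
    · exact (MvPolynomial.isWeightedHomogeneous_X K _ a).mul
        (MvPolynomial.isWeightedHomogeneous_X K _ b)
    · have : S.gamDeg t a + S.gamDeg t b = S.gamDeg t c := by
        have h' : ((S.gamDeg t a : ℕ) : ℚ) + (S.gamDeg t b : ℕ) = (S.gamDeg t c : ℕ) := by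
          rw [gamDeg_eq, gamDeg_eq, gamDeg_eq, hc, ← finsum_add_distrib (hfin _) (hfin _)]
          exact finsum_congr fun σ => (add_mul _ _ _).symm
        exact_mod_cast h'
      rw [this]
      exact MvPolynomial.isWeightedHomogeneous_X K _ c
  · exact ⟨_, (MvPolynomial.isWeightedHomogeneous_X K _ a).mul
      (MvPolynomial.isWeightedHomogeneous_X K _ b)⟩
  · refine ⟨0, Submodule.sub_mem _ ?_ (MvPolynomial.isWeightedHomogeneous_one K _)⟩
    have : S.gamDeg t c = 0 := by
      have h' : ((S.gamDeg t c : ℕ) : ℚ) = 0 := by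
        rw [gamDeg_eq, hc]; simp
      exact_mod_cast h'
    rw [← this]
    exact MvPolynomial.isWeightedHomogeneous_X K _ c

/-- The grading of `K[Γ]` with `deg y_a = ∑ a_σ deg f_σ`. -/
def fanGrading : ℕ → Submodule K (S.FanAlg t) :=
  quotGrading (MvPolynomial.weightedHomogeneousSubmodule K (S.gamDeg t)) (fanIdeal K (S.Gam t))

instance : GradedAlgebra (S.fanGrading t) :=
  quotGradedAlgebra _ _ (S.fanIdeal_isHomogeneous t)

theorem fanY_mem (a : S.Gam t) : fanY K a ∈ S.fanGrading t (S.gamDeg t a) :=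
  ⟨_, MvPolynomial.isWeightedHomogeneous_X K _ a, rfl⟩

/-- The subset `Γ_C = {a ∈ Γ | supp a ⊆ C}`. -/
def GamChain (C : Set (Face P)) : Set (Face P → ℚ) :=
  {a | a ∈ S.Gam t ∧ Function.support a ⊆ C}

/-- The generators `y_a`, `a ∈ Γ_C`. -/
def chainGenerators (C : Set (Face P)) : Set (S.FanAlg t) :=
  {x | ∃ a : S.Gam t, a.1 ∈ S.GamChain t C ∧ x = fanY K a}

/-- The subalgebra `K[Γ_C]` of `K[Γ]`. -/
abbrev ChainAlg (C : Set (Face P)) : Subalgebra K (S.FanAlg t) :=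
  Algebra.adjoin K (S.chainGenerators t C)

/-- The grading of `K[Γ_C]` induced from that of `K[Γ]`. -/
def chainGrading (C : Set (Face P)) : ℕ → Submodule K (S.ChainAlg t C) :=
  subGrading (S.fanGrading t) (S.ChainAlg t C)

instance (C : Set (Face P)) : GradedAlgebra (S.chainGrading t C) :=
  subGradedAlgebra (S.fanGrading t) (S.chainGenerators t C) (by
    rintro _ ⟨a, -, rfl⟩
    exact ⟨_, S.fanY_mem t a⟩)

/-- The scheme `X_0 = Proj K[Γ]`. -/
def X0 : Scheme := Proj (S.fanGrading t)

/-- The scheme `X_C = Proj K[Γ_C]`. -/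
def XChain (C : Set (Face P)) : Scheme := Proj (S.chainGrading t C)

end SeshadriStratification

/-- The toric variety `X_P`, as the `Proj` of its homogeneous coordinate ring. -/
def toricVariety : AlgebraicGeometry.Scheme := AlgebraicGeometry.Proj (coordGrading P K)

end FanDegeneration

end

open FanDegeneration AlgebraicGeometry

/-! Everything reduces to one statement about convex cones. Normality of P identifies the weights of
the coordinate ring with minus the lattice points of the cone over P (`mem_weightMonoid_iff`).
Monomials of equal weight agree on the dense orbit (`mk_monomial_eq`), so the coordinate ring has
one basis monomial per weight. The vectors -μ_σ lie in the relative interiors of the faces of the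
cone, hence the cones spanned along chains triangulate it, as in a barycentric subdivision: every
point is a nonnegative combination along some chain (`MarkedCone.exists_chain_sum`), in only one way
(`MarkedCone.eq_of_sum_eq`), and maximal chains give bases (`coord_basis`).

So each weight w has a unique chain representation `rep w`. Supporting functionals of faces show
that it is lexicographically smallest among all expansions of w along chains, for every
linearization (`MarkedCone.le_of_sum_eq`). Therefore ν takes the value `rep w` on eigenfunctions of
weight w, and Γ is the image of `rep`, where no linearization enters. Two representations add up to
a representation exactly when they share a cone (`rep_add_iff`); otherwise the product of the
eigenfunctions has strictly larger value and its class vanishes. These are the fan relations, and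
both algebras acquire bases indexed by weights, which gives the isomorphism. Equal triangulations
have equal marked points, so their representations differ by a rescaling of coordinates.

For a maximal chain C the monoid Γ_C is finitely generated by a Gordan-type argument and its
semigroup algebra is a domain. Killing the other generators is a graded retraction of K[Γ] onto it.
These retractions are jointly injective, so K[Γ] is reduced and X_0 is the union of the closed
irreducible images; the generators y_{e_σ} exclude inclusions among them. Finally, Proj of a
finitely generated graded domain has dimension one less than the transcendence degree
(`exists_trdeg_topologicalKrullDim_proj`), and K[Γ_C] and the coordinate ring have the same
transcendence degree, because every weight has a positive multiple that is a difference of elements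
of Γ_C. -/

namespace FanDegeneration

/-! ### Finitely generated cones and Farkas' lemma. -/

section Farkas

/-- Elimination of one inequality at a time. If `A m` is really needed, some x₀ satisfies the other
inequalities with `γ x₀ < 0` and `A m x₀ = -1`; projecting along x₀ onto the kernel of `A m` leaves
only the other constraints. W needs neither a topology nor finite dimension. -/
theorem farkas_dual {W ι : Type*} [AddCommGroup W] [Module ℝ W] (s : Finset ι)
    (A : ι → W →ₗ[ℝ] ℝ) (γ : W →ₗ[ℝ] ℝ) (h : ∀ x, (∀ i ∈ s, 0 ≤ A i x) → 0 ≤ γ x) :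
    ∃ u : ι → ℝ, (∀ i, 0 ≤ u i) ∧ γ = ∑ i ∈ s, u i • A i := by
  classical
  induction s using Finset.induction_on generalizing A γ with
  | empty =>
    refine ⟨0, fun _ => le_refl _, ?_⟩
    ext x
    have h1 := h x (by simp)
    have h2 := h (-x) (by simp)
    rw [map_neg] at h2
    simp
    linarith
  | insert m s hm ih =>
    by_cases h0 : ∀ x, (∀ i ∈ s, 0 ≤ A i x) → 0 ≤ γ x
    · obtain ⟨u, hu, he⟩ := ih A γ h0
      refine ⟨fun i => if i = m then 0 else u i, fun i => ?_, ?_⟩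
      · beta_reduce
        split_ifs
        exacts [le_refl _, hu i]
      · rw [Finset.sum_insert hm]
        beta_reduce
        rw [if_pos rfl, zero_smul, zero_add, he]
        refine Finset.sum_congr rfl fun i hi => ?_
        rw [if_neg (ne_of_mem_of_not_mem hi hm)]
    · push Not at h0
      obtain ⟨x₁, hx₁, hγ₁⟩ := h0
      have hm₁ : A m x₁ < 0 := by
        by_contra hcon
        push Not at hcon
        refine absurd (h x₁ fun i hi => ?_) (not_le.2 hγ₁)
        rcases Finset.mem_insert.1 hi with rfl | hi
        exacts [hcon, hx₁ i hi]
      obtain ⟨x₀, hx₀, hγ₀, hm₀⟩ :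
          ∃ x₀, (∀ i ∈ s, 0 ≤ A i x₀) ∧ γ x₀ < 0 ∧ A m x₀ = -1 := by
        refine ⟨(-(A m x₁))⁻¹ • x₁, fun i hi => ?_, ?_, ?_⟩
        · rw [map_smul, smul_eq_mul]
          exact mul_nonneg (inv_nonneg.2 (by linarith)) (hx₁ i hi)
        · rw [map_smul, smul_eq_mul]
          exact mul_neg_of_pos_of_neg (inv_pos.2 (by linarith)) hγ₁
        · rw [map_smul, smul_eq_mul]
          have := hm₁.ne
          field_simp
      -- These are `A i` and `γ` composed with the projection x ↦ x + `A m x` • x₀.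
      obtain ⟨u, hu, he⟩ := ih (fun i => A i + A i x₀ • A m) (γ + γ x₀ • A m) (by
        intro x hx
        have := h (x + A m x • x₀) (by
          intro i hi
          rcases Finset.mem_insert.1 hi with rfl | hi
          · simp [hm₀]
          · have := hx i hi
            simp only [LinearMap.add_apply, LinearMap.smul_apply, smul_eq_mul] at this
            simp only [map_add, map_smul, smul_eq_mul]
            linarith)
        simp only [map_add, map_smul, smul_eq_mul] at this
        simp only [LinearMap.add_apply, LinearMap.smul_apply, smul_eq_mul]
        linarith)
      refine ⟨fun i => if i = m then ∑ i ∈ s, u i * A i x₀ - γ x₀ else u i, fun i => ?_, ?_⟩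
      · beta_reduce
        split_ifs
        · have := Finset.sum_nonneg fun i hi => mul_nonneg (hu i) (hx₀ i hi)
          linarith
        · exact hu i
      · rw [Finset.sum_insert hm]
        beta_reduce
        rw [if_pos rfl]
        have h2 : ∑ i ∈ s, (if i = m then ∑ i ∈ s, u i * A i x₀ - γ x₀ else u i) • A i
            = ∑ i ∈ s, u i • A i :=
          Finset.sum_congr rfl fun i hi => by rw [if_neg (ne_of_mem_of_not_mem hi hm)]
        have h3 : ∑ i ∈ s, u i • A i x₀ • A m = (∑ i ∈ s, u i * A i x₀) • A m := by
          simp only [Finset.sum_smul, mul_smul]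
        simp only [smul_add, Finset.sum_add_distrib, h3] at he
        rw [h2]
        ext x
        have h4 := LinearMap.congr_fun he x
        simp only [LinearMap.add_apply, LinearMap.smul_apply, smul_eq_mul] at h4 ⊢
        linarith

/-- The convex cone generated by a finite family. -/
def finCone {E κ : Type*} [AddCommGroup E] [Module ℝ E] [Fintype κ] (g : κ → E) : Set E :=
  {x | ∃ c : κ → ℝ, (∀ i, 0 ≤ c i) ∧ x = ∑ i, c i • g i}

variable {E κ : Type*} [AddCommGroup E] [Module ℝ E] [Fintype κ] {g : κ → E}

theorem zero_mem_finCone : (0 : E) ∈ finCone g := ⟨0, fun _ => le_refl _, by simp⟩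

theorem add_mem_finCone {x y : E} (hx : x ∈ finCone g) (hy : y ∈ finCone g) :
    x + y ∈ finCone g := by
  obtain ⟨c, hc, rfl⟩ := hx
  obtain ⟨d, hd, rfl⟩ := hy
  exact ⟨c + d, fun i => add_nonneg (hc i) (hd i), by
    simp [add_smul, Finset.sum_add_distrib]⟩

theorem smul_mem_finCone {x : E} {r : ℝ} (hr : 0 ≤ r) (hx : x ∈ finCone g) :
    r • x ∈ finCone g := by
  obtain ⟨c, hc, rfl⟩ := hx
  exact ⟨r • c, fun i => mul_nonneg hr (hc i), by simp [Finset.smul_sum, mul_smul]⟩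

theorem sum_mem_finCone {ι : Type*} (s : Finset ι) {x : ι → E} (h : ∀ i ∈ s, x i ∈ finCone g) :
    ∑ i ∈ s, x i ∈ finCone g := by
  classical
  induction s using Finset.induction_on with
  | empty => simpa using zero_mem_finCone
  | insert a s ha ih =>
    rw [Finset.sum_insert ha]
    exact add_mem_finCone (h a (Finset.mem_insert_self a s))
      (ih fun i hi => h i (Finset.mem_insert_of_mem hi))

theorem mem_finCone (i : κ) : g i ∈ finCone g := by
  classical
  exact ⟨Pi.single i 1, fun j => by by_cases h : j = i <;> simp [h],
    by simp [Pi.single_apply]⟩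

theorem nonneg_of_mem_finCone {L : E →ₗ[ℝ] ℝ} (hL : ∀ i, 0 ≤ L (g i)) {x : E}
    (hx : x ∈ finCone g) : 0 ≤ L x := by
  obtain ⟨c, hc, rfl⟩ := hx
  simp only [map_sum, map_smul, smul_eq_mul]
  exact Finset.sum_nonneg fun i _ => mul_nonneg (hc i) (hL i)

/-- Farkas' lemma. -/
theorem exists_separating {x : E} (hx : x ∉ finCone g) :
    ∃ L : E →ₗ[ℝ] ℝ, (∀ i, 0 ≤ L (g i)) ∧ L x < 0 := by
  by_contra hcon
  push Not at hcon
  -- The dual form is applied on `Module.Dual ℝ E`; the relation between evaluations descends to E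
  -- because functionals separate points.
  obtain ⟨u, hu, he⟩ := farkas_dual Finset.univ (fun i => Module.Dual.eval ℝ E (g i))
    (Module.Dual.eval ℝ E x) (fun L hL => hcon L fun i => hL i (Finset.mem_univ i))
  refine hx ⟨u, hu, ?_⟩
  rw [← sub_eq_zero, ← Module.forall_dual_apply_eq_zero_iff ℝ]
  intro φ
  have := LinearMap.congr_fun he φ
  simp [LinearMap.sum_apply] at this
  simp [this]

/-- A supporting functional whose zero set is the minimal face of a cone containing a point. -/
theorem exists_exposing {deg : E →ₗ[ℝ] ℝ} (hdeg : ∀ i, 0 < deg (g i)) {x : E}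
    (hx : x ∈ finCone g) :
    ∃ L : E →ₗ[ℝ] ℝ, (∀ i, 0 ≤ L (g i)) ∧ L x = 0 ∧
      ∀ i, L (g i) = 0 → ∃ ε : ℝ, 0 < ε ∧ x - ε • g i ∈ finCone g := by
  have key : ∀ i, ∃ L : E →ₗ[ℝ] ℝ, (∀ j, 0 ≤ L (g j)) ∧ L x ≤ 0 ∧
      (L (g i) = 0 → ∃ ε : ℝ, 0 < ε ∧ x - ε • g i ∈ finCone g) := by
    intro i
    -- If -x and the g j generate -g i, solving for x leaves x minus a positive multiple of g i in
    -- the cone. Otherwise Farkas gives a functional positive at g i. The sum of these functionals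
    -- over i serves all generators at once.
    by_cases hi : -g i ∈ finCone (fun j : Option κ => j.elim (-x) g)
    · refine ⟨0, fun _ => le_refl _, le_refl _, fun _ => ?_⟩
      obtain ⟨c, hc, he⟩ := hi
      rw [Fintype.sum_option] at he
      simp only [Option.elim] at he
      have hc0 : 0 < c none := by
        refine lt_of_le_of_ne (hc none) fun h0 => ?_
        have h1 := congrArg deg he
        rw [← h0, zero_smul, zero_add, map_neg, map_sum] at h1
        have h2 : 0 ≤ ∑ j, deg (c (some j) • g j) := Finset.sum_nonneg fun j _ => by
          rw [map_smul]; exact mul_nonneg (hc _) (hdeg j).le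
        have := hdeg i
        linarith
      refine ⟨(c none)⁻¹, inv_pos.2 hc0, ?_⟩
      have h3 : x - (c none)⁻¹ • g i = (c none)⁻¹ • ∑ j, c (some j) • g j := by
        have h4 : c none • x - g i = ∑ j, c (some j) • g j := by
          rw [sub_eq_add_neg, he, smul_neg]; abel
        rw [← h4, smul_sub, smul_smul, inv_mul_cancel₀ hc0.ne', one_smul]
      rw [h3]
      exact smul_mem_finCone (inv_nonneg.2 hc0.le) ⟨fun j => c (some j), fun j => hc _, rfl⟩
    · obtain ⟨L, hL, hLi⟩ := exists_separating hi
      refine ⟨L, fun j => hL (some j), ?_, fun h => ?_⟩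
      · have := hL none
        simp only [Option.elim, map_neg] at this
        linarith
      · rw [map_neg, h] at hLi
        simp at hLi
  choose L hL hLx hLi using key
  have hpos : ∀ y, y ∈ finCone g → ∀ i, 0 ≤ L i y := fun y hy i => nonneg_of_mem_finCone (hL i) hy
  refine ⟨∑ i, L i, fun j => ?_, ?_, fun j hj => ?_⟩
  · rw [LinearMap.sum_apply]
    exact Finset.sum_nonneg fun i _ => hL i j
  · rw [LinearMap.sum_apply]
    exact Finset.sum_eq_zero fun i _ => le_antisymm (hLx i) (hpos x hx i)
  · rw [LinearMap.sum_apply, Finset.sum_eq_zero_iff_of_nonneg fun i _ => hL i j] at hj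
    exact hLi j (hj j (Finset.mem_univ j))

end Farkas

/-! ### Marked cones and representations along chains. -/

/-- Antisymmetry of the lexicographic order in unfolded form: both inequalities apply at the
t-largest index where a and b differ. -/
theorem eq_of_lex_le_of_lex_le {A β : Type*} [Finite A] [PartialOrder β] (t : LinearOrder A) {a b : A → β}
    (h : ∀ σ, (∀ τ, t.lt σ τ → a τ = b τ) → a σ ≤ b σ)
    (h' : ∀ σ, (∀ τ, t.lt σ τ → b τ = a τ) → b σ ≤ a σ) : a = b := by
  by_contra hne
  have hne' : {σ | a σ ≠ b σ}.Nonempty := by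
    by_contra hemp
    rw [Set.not_nonempty_iff_eq_empty] at hemp
    refine hne (funext fun σ => by_contra fun hσ => ?_)
    exact (Set.eq_empty_iff_forall_notMem.1 hemp σ) hσ
  obtain ⟨σ, hσ, hmax⟩ := @Set.Finite.exists_maximal A t.toPreorder.toLE
    (@instIsTransLe A t.toPreorder) _ (Set.toFinite {σ | a σ ≠ b σ}) hne'
  have hgt : ∀ τ, t.lt σ τ → a τ = b τ := fun τ hτ => by
    by_contra hc
    exact absurd (hmax hc (@le_of_lt _ t.toPreorder _ _ hτ)) (@not_le_of_gt _ t.toPreorder _ _ hτ)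
  exact hσ (le_antisymm (h σ hgt) (h' σ fun τ hτ => (hgt τ hτ).symm))

/-- A cone together with vectors `v σ` marking the faces `σ` of a poset, each face cut out by the
supporting functional `L σ`. -/
structure MarkedCone (E κ A : Type*) [AddCommGroup E] [Module ℝ E] [Fintype κ] [PartialOrder A] where
  /-- The generators. -/
  g : κ → E
  /-- The marking. -/
  v : A → E
  /-- A functional positive on the cone. -/
  deg : E →ₗ[ℝ] ℝ
  /-- The supporting functionals. -/
  L : A → E →ₗ[ℝ] ℝ
  deg_g : ∀ i, 0 < deg (g i)
  deg_v : ∀ σ, 0 < deg (v σ)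
  v_mem : ∀ σ, v σ ∈ finCone g
  L_g : ∀ σ i, 0 ≤ L σ (g i)
  L_v : ∀ σ τ, L σ (v τ) = 0 ↔ τ ≤ σ
  exists_face : ∀ x ∈ finCone g, x ≠ 0 → ∃ ρ, L ρ x = 0 ∧ ∃ ε : ℝ, 0 < ε ∧ x - ε • v ρ ∈ finCone g

namespace MarkedCone

variable {E κ A : Type*} [AddCommGroup E] [Module ℝ E] [Fintype κ] [PartialOrder A]
  (M : MarkedCone E κ A)

theorem L_v_nonneg (σ τ : A) : 0 ≤ M.L σ (M.v τ) := nonneg_of_mem_finCone (M.L_g σ) (M.v_mem τ)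

/-- The functional of the face found for v σ + v τ vanishes on both summands, so ρ lies above both,
strictly by incomparability. This straightening relation trades an incomparable pair for something
higher. -/
theorem exists_lt_of_incomparable {σ τ : A} (h : ¬ σ ≤ τ) (h' : ¬ τ ≤ σ) :
    ∃ ρ, σ < ρ ∧ τ < ρ ∧ ∃ ε : ℝ, 0 < ε ∧ M.v σ + M.v τ - ε • M.v ρ ∈ finCone M.g := by
  have hne : M.v σ + M.v τ ≠ 0 := fun h0 => by
    have := congrArg M.deg h0
    rw [map_add, map_zero] at this
    have h1 := M.deg_v σ
    have h2 := M.deg_v τ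
    linarith
  obtain ⟨ρ, hρ, ε, hε, hmem⟩ := M.exists_face _ (add_mem_finCone (M.v_mem σ) (M.v_mem τ)) hne
  rw [map_add] at hρ
  have h1 := M.L_v_nonneg ρ σ
  have h2 := M.L_v_nonneg ρ τ
  have hσ : σ ≤ ρ := (M.L_v ρ σ).1 (by linarith)
  have hτ : τ ≤ ρ := (M.L_v ρ τ).1 (by linarith)
  exact ⟨ρ, lt_of_le_of_ne hσ fun he => h' (he ▸ hτ), lt_of_le_of_ne hτ fun he => h (he ▸ hσ),
    ε, hε, hmem⟩

variable [Fintype A]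

/-- A nonnegative representation is lexicographically minimal among the representations supported
on chains, the largest face being compared first. -/
theorem le_of_sum_eq (t : LinearOrder A) (ht : ∀ σ τ : A, σ < τ → t.lt σ τ) {a b : A → ℝ}
    (ha : ∀ σ, 0 ≤ a σ) {C : Set A} (hC : IsChain (· ≤ ·) C) (hb : ∀ σ, σ ∉ C → b σ = 0)
    (hab : ∑ σ, a σ • M.v σ = ∑ σ, b σ • M.v σ) (σ : A) (hσ : ∀ τ, t.lt σ τ → a τ = b τ) :
    a σ ≤ b σ := by
  classical
  -- The supporting functional of the largest member of C that is t-below σ, or the degree if there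
  -- is no such member.
  obtain ⟨l, hl, hlσ, hlC⟩ : ∃ l : E →ₗ[ℝ] ℝ, (∀ τ, 0 ≤ l (M.v τ)) ∧ 0 < l (M.v σ) ∧
      ∀ τ ∈ C, t.lt τ σ → l (M.v τ) = 0 := by
    by_cases hne : ∃ τ, τ ∈ C ∧ t.lt τ σ
    · obtain ⟨τ₀, ⟨h₀, h₀'⟩, hmax⟩ := (Set.toFinite {τ | τ ∈ C ∧ t.lt τ σ}).exists_maximal hne
      refine ⟨M.L τ₀, M.L_v_nonneg τ₀, lt_of_le_of_ne (M.L_v_nonneg τ₀ σ) fun h => ?_,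
        fun τ hτ hτσ => ?_⟩
      · have h1 := (M.L_v τ₀ σ).1 h.symm
        rcases h1.eq_or_lt with rfl | h1
        · exact @lt_irrefl _ t.toPreorder _ h₀'
        · exact @lt_asymm _ t.toPreorder _ _ h₀' (ht _ _ h1)
      · rw [M.L_v]
        rcases hC.total hτ h₀ with h | h
        · exact h
        · exact hmax ⟨hτ, hτσ⟩ h
    · exact ⟨M.deg, fun τ => (M.deg_v τ).le, M.deg_v σ,
        fun τ hτ hτσ => absurd ⟨τ, hτ, hτσ⟩ hne⟩
  have h1 : ∑ τ, (a τ - b τ) * l (M.v τ) = 0 := by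
    have := congrArg l hab
    simp only [map_sum, map_smul, smul_eq_mul] at this
    simp only [sub_mul, Finset.sum_sub_distrib, this, sub_self]
  have h2 : (a σ - b σ) * l (M.v σ) ≤ ∑ τ, (a τ - b τ) * l (M.v τ) := by
    -- Indices t-above σ contribute zero by hypothesis; those t-below are killed by l if in C, and
    -- otherwise contribute a τ · l (v τ) ≥ 0.
    rw [← Finset.add_sum_erase _ _ (Finset.mem_univ σ), le_add_iff_nonneg_right]
    refine Finset.sum_nonneg fun τ hτ => ?_
    have hne := Finset.ne_of_mem_erase hτ
    rcases @lt_trichotomy _ t τ σ with h | h | h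
    · by_cases hτC : τ ∈ C
      · rw [hlC τ hτC h, mul_zero]
      · rw [hb τ hτC, sub_zero]
        exact mul_nonneg (ha τ) (hl τ)
    · exact absurd h hne
    · rw [hσ τ h, sub_self, zero_mul]
  rw [h1] at h2
  have h3 := nonpos_of_mul_nonpos_left h2 hlσ
  linarith

/-- Uniqueness of nonnegative representations supported on chains. -/
theorem eq_of_sum_eq (t : LinearOrder A) (ht : ∀ σ τ : A, σ < τ → t.lt σ τ) {a b : A → ℝ}
    (ha : ∀ σ, 0 ≤ a σ) (hb : ∀ σ, 0 ≤ b σ) {C D : Set A} (hC : IsChain (· ≤ ·) C)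
    (hD : IsChain (· ≤ ·) D) (haC : ∀ σ, σ ∉ C → a σ = 0) (hbD : ∀ σ, σ ∉ D → b σ = 0)
    (hab : ∑ σ, a σ • M.v σ = ∑ σ, b σ • M.v σ) : a = b :=
  eq_of_lex_le_of_lex_le t (M.le_of_sum_eq t ht ha hD hbD hab) (M.le_of_sum_eq t ht hb hC haC hab.symm)

/-- Linear independence of the marking along chains. -/
theorem eq_zero_of_sum_eq_zero (t : LinearOrder A) (ht : ∀ σ τ : A, σ < τ → t.lt σ τ) {b : A → ℝ}
    {C : Set A} (hC : IsChain (· ≤ ·) C) (hb : ∀ σ, σ ∉ C → b σ = 0)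
    (h : ∑ σ, b σ • M.v σ = 0) : b = 0 := by
  -- The zero vector is a nonnegative representation of 0, so it is lexicographically below both b
  -- and -b.
  have h1 := M.le_of_sum_eq t ht (a := 0) (b := b) (fun _ => le_refl _) hC hb (by simp [h])
  have h2 := M.le_of_sum_eq t ht (a := 0) (b := -b) (fun _ => le_refl _) hC
    (fun σ hσ => by simp [hb σ hσ]) (by simp [h])
  refine (eq_of_lex_le_of_lex_le t h1 fun σ hσ => ?_).symm
  have := h2 σ fun τ hτ => by simp [hσ τ hτ]
  simpa using this

/-- A height function: straightening an incomparable pair strictly increases ∑ a σ * c σ. By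
finiteness one ε serves all pairs, and c grows geometrically with the number of elements strictly
below. -/
theorem exists_height : ∃ c : A → ℝ, (∀ σ, 0 < c σ) ∧ ∀ σ τ : A, ¬ σ ≤ τ → ¬ τ ≤ σ →
    ∃ ρ, ∃ ε : ℝ, 0 < ε ∧ M.v σ + M.v τ - ε • M.v ρ ∈ finCone M.g ∧ c σ + c τ < ε * c ρ := by
  classical
  have h1 : ∀ p : A × A, ∀ᶠ ε : ℝ in nhdsWithin 0 (Set.Ioi 0), ¬ p.1 ≤ p.2 → ¬ p.2 ≤ p.1 →
      ∃ ρ, p.1 < ρ ∧ p.2 < ρ ∧ M.v p.1 + M.v p.2 - ε • M.v ρ ∈ finCone M.g := by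
    intro p
    by_cases hp : ¬ p.1 ≤ p.2 ∧ ¬ p.2 ≤ p.1
    · obtain ⟨ρ, h1, h2, ε, hε, hmem⟩ := M.exists_lt_of_incomparable hp.1 hp.2
      filter_upwards [Ioc_mem_nhdsGT hε] with δ hδ _ _
      refine ⟨ρ, h1, h2, ?_⟩
      have : M.v p.1 + M.v p.2 - δ • M.v ρ
          = (M.v p.1 + M.v p.2 - ε • M.v ρ) + (ε - δ) • M.v ρ := by
        rw [sub_smul]; abel
      rw [this]
      exact add_mem_finCone hmem (smul_mem_finCone (by linarith [hδ.2]) (M.v_mem ρ))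
    · exact Filter.Eventually.of_forall fun δ h h' => absurd ⟨h, h'⟩ hp
  obtain ⟨ε, hε, hε0⟩ :=
    ((Filter.eventually_all.2 h1).and (self_mem_nhdsWithin (a := (0 : ℝ)) (s := Set.Ioi 0))).exists
  have hε0 : 0 < ε := hε0
  -- Chosen so that ε N > 2: then ε N^(r ρ) exceeds 2 N^(r ρ - 1), which bounds N^(r σ) + N^(r τ).
  set N : ℝ := 2 / ε + 1 with hN
  have hN1 : 1 ≤ N := by
    have : 0 < 2 / ε := by positivity
    linarith
  have hNε : 2 < ε * N := by
    rw [hN, mul_add, mul_div_cancel₀ _ hε0.ne']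
    linarith
  let r : A → ℕ := fun σ => (Finset.univ.filter (· < σ)).card
  have hr : ∀ σ ρ, σ < ρ → r σ < r ρ := fun σ ρ h => by
    refine Finset.card_lt_card ((Finset.ssubset_iff_of_subset ?_).2 ⟨σ, ?_, ?_⟩)
    · intro x hx
      simp only [Finset.mem_filter, Finset.mem_univ, true_and] at hx ⊢
      exact hx.trans h
    · simpa using h
    · simp
  refine ⟨fun σ => N ^ r σ, fun σ => by positivity, fun σ τ h h' => ?_⟩
  obtain ⟨ρ, hσ, hτ, hmem⟩ := hε (σ, τ) h h'
  refine ⟨ρ, ε, hε0, hmem, ?_⟩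
  have h2 : N ^ r σ ≤ N ^ (r ρ - 1) := pow_le_pow_right₀ hN1 (Nat.le_sub_one_of_lt (hr σ ρ hσ))
  have h3 : N ^ r τ ≤ N ^ (r ρ - 1) := pow_le_pow_right₀ hN1 (Nat.le_sub_one_of_lt (hr τ ρ hτ))
  have h4 : N ^ r ρ = N * N ^ (r ρ - 1) := by
    rw [← pow_succ']
    congr 1
    have := hr σ ρ hσ
    omega
  have h5 : 0 < N ^ (r ρ - 1) := by positivity
  beta_reduce
  rw [h4, ← mul_assoc]
  nlinarith

/-- Every point of the cone is a nonnegative combination of the marking along a chain. -/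
theorem exists_chain_sum {x : E} (hx : x ∈ finCone M.g) :
    ∃ a : A → ℝ, (∀ σ, 0 ≤ a σ) ∧ IsChain (· ≤ ·) (Function.support a) ∧
      x = ∑ σ, a σ • M.v σ := by
  classical
  obtain ⟨c, hc, hinc⟩ := M.exists_height
  -- Mixed representations by marking and generators: nonempty by assumption, compact because the
  -- degree is positive on all vectors involved. At a point of maximal height no generator and no
  -- incomparable pair remains.
  let R : Set ((A → ℝ) × (κ → ℝ)) := {p | ((∀ σ, 0 ≤ p.1 σ) ∧ (∀ i, 0 ≤ p.2 i)) ∧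
    ∑ σ, p.1 σ • M.v σ + ∑ i, p.2 i • M.g i = x}
  have hRcl : IsClosed R := by
    -- E carries no topology, so the vector equation is tested by all linear functionals.
    have : R = (⋂ σ, {p | 0 ≤ p.1 σ}) ∩ (⋂ i, {p | 0 ≤ p.2 i}) ∩ ⋂ l : Module.Dual ℝ E,
        {p | ∑ σ, p.1 σ * l (M.v σ) + ∑ i, p.2 i * l (M.g i) = l x} := by
      ext p
      simp only [R, Set.mem_ofPred_eq, Set.mem_inter_iff, Set.mem_iInter]
      refine and_congr_right fun _ => ⟨fun h l => by simp [← h], fun h => ?_⟩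
      rw [← sub_eq_zero, ← Module.forall_dual_apply_eq_zero_iff ℝ]
      intro l
      simp [← h l]
    rw [this]
    refine (IsClosed.inter ?_ ?_).inter ?_
    · exact isClosed_iInter fun σ => isClosed_le continuous_const (by fun_prop)
    · exact isClosed_iInter fun σ => isClosed_le continuous_const (by fun_prop)
    · exact isClosed_iInter fun l => isClosed_eq (by fun_prop) continuous_const
  have hRco : IsCompact R := by
    refine IsCompact.of_isClosed_subset ((isCompact_univ_pi fun σ =>
      isCompact_Icc (a := (0 : ℝ)) (b := M.deg x / M.deg (M.v σ))).prod
      (isCompact_univ_pi fun i => isCompact_Icc (a := (0 : ℝ)) (b := M.deg x / M.deg (M.g i))))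
      hRcl ?_
    rintro ⟨a, b⟩ ⟨⟨ha, hb⟩, he⟩
    have h1 := congrArg M.deg he
    simp only [map_add, map_sum, map_smul, smul_eq_mul] at h1
    have h2 : ∀ σ ∈ Finset.univ, 0 ≤ a σ * M.deg (M.v σ) :=
      fun σ _ => mul_nonneg (ha σ) (M.deg_v σ).le
    have h3 : ∀ i ∈ Finset.univ, 0 ≤ b i * M.deg (M.g i) :=
      fun i _ => mul_nonneg (hb i) (M.deg_g i).le
    refine ⟨fun σ _ => ⟨ha σ, ?_⟩, fun i _ => ⟨hb i, ?_⟩⟩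
    · rw [le_div_iff₀ (M.deg_v σ)]
      have := Finset.single_le_sum h2 (Finset.mem_univ σ)
      have := Finset.sum_nonneg h3
      dsimp only at *
      linarith
    · rw [le_div_iff₀ (M.deg_g i)]
      have := Finset.single_le_sum h3 (Finset.mem_univ i)
      have := Finset.sum_nonneg h2
      dsimp only at *
      linarith
  have hRne : R.Nonempty := by
    obtain ⟨b, hb, rfl⟩ := hx
    exact ⟨(0, b), ⟨fun _ => le_refl _, hb⟩, by simp⟩
  obtain ⟨⟨a, b⟩, ⟨⟨ha, hb⟩, he⟩, hmax⟩ := hRco.exists_isMaxOn hRne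
    (f := fun p => ∑ σ, p.1 σ * c σ) (by fun_prop)
  dsimp only at ha hb he
  have hmax' : ∀ a' b', (a', b') ∈ R → ∑ σ, a' σ * c σ ≤ ∑ σ, a σ * c σ :=
    fun a' b' h => hmax h
  -- A positive multiple of some v ρ can be extracted from a remaining generator, which would raise
  -- the height.
  have hb0 : b = 0 := by
    funext i
    by_contra hi
    have hbi : 0 < b i := lt_of_le_of_ne (hb i) (Ne.symm hi)
    obtain ⟨ρ, -, ε, hε, k, hk, hke⟩ := M.exists_face (M.g i) (mem_finCone i) (fun h => by
      have := M.deg_g i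
      rw [h, map_zero] at this
      exact lt_irrefl _ this)
    have := hmax' (a + Pi.single ρ (b i * ε)) (b - Pi.single i (b i) + b i • k) ⟨⟨?_, ?_⟩, ?_⟩
    · simp only [Pi.add_apply, add_mul, Finset.sum_add_distrib, Pi.single_apply, ite_mul, zero_mul,
        Finset.sum_ite_eq', Finset.mem_univ, if_true] at this
      have := mul_pos (mul_pos hbi hε) (hc ρ)
      linarith
    · intro σ
      refine add_nonneg (ha σ) ?_
      rw [Pi.single_apply]
      split_ifs <;> positivity
    · intro j
      refine add_nonneg ?_ (mul_nonneg hbi.le (hk j))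
      rw [Pi.sub_apply, Pi.single_apply]
      split_ifs with h
      · rw [h, sub_self]
      · rw [sub_zero]; exact hb j
    · dsimp only
      simp only [Pi.add_apply, Pi.sub_apply, add_smul, sub_smul, Finset.sum_add_distrib,
        Finset.sum_sub_distrib, Pi.single_apply, ite_smul, zero_smul, Finset.sum_ite_eq',
        Finset.mem_univ, if_true, Pi.smul_apply, smul_eq_mul, mul_smul, ← Finset.smul_sum, ← hke]
      rw [← he, smul_sub]
      abel
  subst hb0
  refine ⟨a, ha, ?_, by simpa using he.symm⟩
  intro σ hσ τ hτ hne
  by_contra hcomp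
  rw [not_or] at hcomp
  obtain ⟨ρ, ε, hε, ⟨k, hk, hke⟩, hlt⟩ := hinc σ τ hcomp.1 hcomp.2
  -- The largest amount of the incomparable pair that can be exchanged with all coefficients staying
  -- nonnegative.
  set d := min (a σ) (a τ)
  have hd : 0 < d := lt_min (lt_of_le_of_ne (ha σ) (Ne.symm hσ)) (lt_of_le_of_ne (ha τ) (Ne.symm hτ))
  have := hmax' (a - Pi.single σ d - Pi.single τ d + Pi.single ρ (d * ε)) (d • k) ⟨⟨?_, ?_⟩, ?_⟩
  · simp only [Pi.add_apply, Pi.sub_apply, add_mul, sub_mul, Finset.sum_add_distrib,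
      Finset.sum_sub_distrib, Pi.single_apply, ite_mul, zero_mul,
      Finset.sum_ite_eq', Finset.mem_univ, if_true] at this
    nlinarith
  · intro η
    refine add_nonneg ?_ ?_
    · simp only [Pi.sub_apply, Pi.single_apply]
      split_ifs with h1 h2 h2
      · exact absurd (h1.symm.trans h2) hne
      · rw [h1]; linarith [min_le_left (a σ) (a τ)]
      · rw [h2]; linarith [min_le_right (a σ) (a τ)]
      · simpa using ha η
    · rw [Pi.single_apply]
      split_ifs <;> positivity
  · intro j
    exact mul_nonneg hd.le (hk j)
  · dsimp only
    simp only [Pi.add_apply, Pi.sub_apply, add_smul, sub_smul, Finset.sum_add_distrib,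
      Finset.sum_sub_distrib, Pi.single_apply, ite_smul, zero_smul, Finset.sum_ite_eq',
      Finset.mem_univ, if_true, Pi.smul_apply, smul_eq_mul, mul_smul, ← Finset.smul_sum, ← hke]
    rw [← he, smul_sub, smul_add]
    simp only [Pi.zero_apply, zero_smul, Finset.sum_const_zero]
    abel

/-- The marking along a maximal chain spans. -/
theorem exists_sum_of_maximal (t : LinearOrder A) (ht : ∀ σ τ : A, σ < τ → t.lt σ τ) {C : Set A}
    (hC : IsMaxChain (· ≤ ·) C) {π : A} (hπ : π ∈ C)
    (hint : ∀ i, ∃ ε : ℝ, 0 < ε ∧ M.v π - ε • M.g i ∈ finCone M.g)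
    (hspan : Submodule.span ℝ (Set.range M.g) = ⊤) (z : E) :
    ∃ b : A → ℝ, (∀ σ, σ ∉ C → b σ = 0) ∧ z = ∑ σ, b σ • M.v σ := by
  classical
  -- Every generator can be subtracted from v π up to a positive factor, so a large multiple of v π
  -- absorbs z.
  have hz : ∃ T : ℝ, 0 < T ∧ T • M.v π + z ∈ finCone M.g := by
    have : z ∈ Submodule.span ℝ (Set.range M.g) := hspan ▸ Submodule.mem_top
    obtain ⟨k, rfl⟩ := (Submodule.mem_span_range_iff_exists_fun ℝ).1 this
    choose ε hε hmem using hint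
    refine ⟨1 + ∑ i, |k i| / ε i, add_pos_of_pos_of_nonneg one_pos
      (Finset.sum_nonneg fun i _ => div_nonneg (abs_nonneg _) (hε i).le), ?_⟩
    have : (1 + ∑ i, |k i| / ε i) • M.v π + ∑ i, k i • M.g i
        = M.v π + ∑ i, ((|k i| / ε i) • (M.v π - ε i • M.g i) + (k i + |k i|) • M.g i) := by
      rw [add_smul, one_smul, Finset.sum_smul, add_assoc, ← Finset.sum_add_distrib]
      congr 1
      refine Finset.sum_congr rfl fun i _ => ?_
      rw [smul_sub, smul_smul, div_mul_cancel₀ _ (hε i).ne', add_smul]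
      abel
    rw [this]
    refine add_mem_finCone (M.v_mem π) (sum_mem_finCone _ fun i _ => add_mem_finCone ?_ ?_)
    · exact smul_mem_finCone (div_nonneg (abs_nonneg _) (hε i).le) (hmem i)
    · exact smul_mem_finCone (by linarith [neg_abs_le (k i)]) (mem_finCone i)
  obtain ⟨T, hT, hTz⟩ := hz
  -- The sum x₀ of the marking over C has all its coefficients on C positive; the aim is that x₀ + δ
  -- z, for small δ > 0, is still represented along C.
  let o : A → ℝ := fun σ => if σ ∈ C then 1 else 0
  set x₀ := ∑ σ, o σ • M.v σ with hx₀
  -- Closedness of the finitely many cones spanned by subsets of the marking, expressed by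
  -- separating functionals: a cone missing x₀ also misses x₀ + δ z for small δ.
  have hsep : ∀ D : Set A, ∀ᶠ δ : ℝ in nhdsWithin 0 (Set.Ioi 0),
      x₀ ∉ finCone (fun σ : D => M.v σ) → x₀ + δ • z ∉ finCone (fun σ : D => M.v σ) := by
    intro D
    by_cases hD : x₀ ∈ finCone (fun σ : D => M.v σ)
    · exact Filter.Eventually.of_forall fun _ h => absurd hD h
    · obtain ⟨l, hl, hlx⟩ := exists_separating hD
      have hcont : Filter.Tendsto (fun δ : ℝ => l x₀ + δ * l z) (nhdsWithin 0 (Set.Ioi 0))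
          (nhds (l x₀ + 0 * l z)) := by
        refine Filter.Tendsto.mono_left ?_ nhdsWithin_le_nhds
        exact Continuous.tendsto (by fun_prop) 0
      rw [zero_mul, add_zero] at hcont
      filter_upwards [hcont.eventually_lt_const hlx] with δ hδ _ hmem
      have := nonneg_of_mem_finCone hl hmem
      rw [map_add, map_smul, smul_eq_mul] at this
      linarith
  obtain ⟨δ, hδ, hδ0, hδT⟩ := ((Filter.eventually_all.2 hsep).and
    (Ioc_mem_nhdsGT (inv_pos.2 hT))).exists
  have hmem : x₀ + δ • z ∈ finCone M.g := by
    have : x₀ + δ • z = ∑ σ ∈ Finset.univ.erase π, o σ • M.v σ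
        + ((1 - δ * T) • M.v π + δ • (T • M.v π + z)) := by
      rw [hx₀, ← Finset.add_sum_erase _ _ (Finset.mem_univ π)]
      simp only [o, if_pos hπ, one_smul, sub_smul, smul_add, mul_smul]
      abel
    rw [this]
    refine add_mem_finCone (sum_mem_finCone _ fun σ _ => smul_mem_finCone ?_ (M.v_mem σ))
      (add_mem_finCone (smul_mem_finCone ?_ (M.v_mem π)) (smul_mem_finCone hδ0.le hTz))
    · simp only [o]; split_ifs <;> norm_num
    · have := mul_le_mul_of_nonneg_right hδT hT.le
      rw [inv_mul_cancel₀ hT.ne'] at this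
      linarith
  obtain ⟨a, ha, hchain, hsum⟩ := M.exists_chain_sum hmem
  have hext : ∀ (D : Set A) (k : D → ℝ), ∑ σ : D, k σ • M.v σ
      = ∑ σ, (if h : σ ∈ D then k ⟨σ, h⟩ else 0) • M.v σ := by
    intro D k
    rw [← Finset.sum_subset (Finset.subset_univ (Finset.univ.filter (· ∈ D))),
      Finset.sum_subtype (Finset.univ.filter (· ∈ D)) (p := (· ∈ D)) (by simp)]
    · exact Finset.sum_congr rfl fun σ _ => by rw [dif_pos σ.2]
    · intro σ _ hσ
      rw [dif_neg (by simpa using hσ), zero_smul]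
  have hD : x₀ + δ • z ∈ finCone (fun σ : Function.support a => M.v σ) := by
    refine ⟨fun σ => a σ, fun σ => ha σ, ?_⟩
    rw [hsum, hext (Function.support a) fun σ => a σ]
    refine Finset.sum_congr rfl fun σ _ => ?_
    split_ifs with h
    · rfl
    · rw [Function.notMem_support.1 h]
  have hx₀D : x₀ ∈ finCone (fun σ : Function.support a => M.v σ) := by
    by_contra h
    exact hδ _ h hD
  obtain ⟨k, hk, hke⟩ := hx₀D
  rw [hext] at hke
  -- Uniqueness for x₀ puts C inside the support of a, and maximality of C makes them equal.
  have heq : o = _ := M.eq_of_sum_eq t ht (a := o) (fun σ => by simp only [o]; split_ifs <;> norm_num)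
    (fun σ => by split_ifs; exacts [hk _, le_refl _]) hC.1 hchain
    (fun σ hσ => if_neg hσ) (fun σ hσ => dif_neg hσ) (hx₀.symm.trans hke)
  have hsub : C ⊆ Function.support a := by
    intro σ hσ
    by_contra hcon
    have := congrFun heq σ
    simp only [o, if_pos hσ, dif_neg hcon] at this
    exact one_ne_zero this
  have hCa : C = Function.support a := hC.2 hchain hsub
  refine ⟨fun σ => δ⁻¹ * (a σ - o σ), fun σ hσ => ?_, ?_⟩
  · rw [hCa] at hσ
    have h1 := Function.notMem_support.1 hσ
    simp only [o]
    rw [← hCa] at hσ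
    rw [h1, if_neg hσ]; simp
  · simp only [mul_smul, ← Finset.smul_sum, sub_smul, Finset.sum_sub_distrib]
    rw [← hsum, ← hx₀, add_sub_cancel_left, smul_smul, inv_mul_cancel₀ hδ0.ne', one_smul]

end MarkedCone

end FanDegeneration

/-! ### The cone over the polytope as a marked cone. -/

noncomputable section

namespace FanDegeneration

open scoped DirectSum Pointwise

/-- Points of the relative interior can be pushed away from any other point. -/
theorem exists_add_smul_sub_mem {E : Type*} [AddCommGroup E] [Module ℝ E] [TopologicalSpace E]
    [IsTopologicalAddGroup E] [ContinuousSMul ℝ E] {s : Set E} {u y : E}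
    (hu : u ∈ intrinsicInterior ℝ s) (hy : y ∈ s) : ∃ ε : ℝ, 0 < ε ∧ u + ε • (u - y) ∈ s := by
  obtain ⟨u', hu', rfl⟩ := mem_intrinsicInterior.1 hu
  have hline : ∀ ε : ℝ, (u' : E) + ε • ((u' : E) - y) ∈ affineSpan ℝ s := by
    intro ε
    have h := AffineMap.lineMap_mem (k := ℝ) (-ε) u'.2 (subset_affineSpan ℝ s hy)
    rw [AffineMap.lineMap_apply] at h
    convert h using 1
    simp only [vsub_eq_sub, vadd_eq_add]
    module
  let γ : ℝ → affineSpan ℝ s := fun ε => ⟨_, hline ε⟩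
  have hγ : Continuous γ := by
    refine Continuous.subtype_mk ?_ _
    fun_prop
  have h0 : γ 0 = u' := Subtype.ext (by simp [γ])
  have hev : ∀ᶠ ε in nhds (0 : ℝ), γ ε ∈ interior ((↑) ⁻¹' s : Set (affineSpan ℝ s)) :=
    hγ.continuousAt.eventually (by rw [h0]; exact isOpen_interior.mem_nhds hu')
  obtain ⟨ε, hε, hε0⟩ :=
    ((hev.filter_mono nhdsWithin_le_nhds).and
      (self_mem_nhdsWithin (a := (0 : ℝ)) (s := Set.Ioi 0))).exists
  exact ⟨ε, hε0, interior_subset (s := ((↑) ⁻¹' s : Set (affineSpan ℝ s))) hε⟩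

variable {n : ℕ} {P : NormalLatticePolytope n}

namespace NormalLatticePolytope

variable (P) in
/-- A finite set of lattice points with convex hull `P`. -/
def verts : Finset (Fin n → ℤ) := P.isLatticePolytope.choose

theorem carrier_eq : P.carrier = convexHull ℝ (latticePoint '' (P.verts : Set (Fin n → ℤ))) :=
  P.isLatticePolytope.choose_spec

theorem convex : Convex ℝ P.carrier := by rw [carrier_eq]; exact convex_convexHull ℝ _

variable (P) in
/-- The generators of the cone over `P`. -/
def gen (p : P.verts) : ℝ × (Fin n → ℝ) := (1, latticePoint p.1)

theorem latticePoint_mem (p : P.verts) : latticePoint p.1 ∈ P.carrier := by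
  rw [carrier_eq]
  exact subset_convexHull ℝ _ ⟨p.1, p.2, rfl⟩

theorem exists_weights {x : Fin n → ℝ} (hx : x ∈ P.carrier) :
    ∃ c : P.verts → ℝ, (∀ p, 0 ≤ c p) ∧ ∑ p, c p = 1 ∧ x = ∑ p, c p • latticePoint p.1 := by
  have h : P.carrier = convexHull ℝ (Set.range fun p : P.verts => latticePoint p.1) := by
    rw [carrier_eq]
    congr 1
    ext y
    simp
  rw [h, convexHull_range_eq_exists_affineCombination] at hx
  obtain ⟨s, w, hw, hw1, rfl⟩ := hx
  classical
  refine ⟨fun p => if p ∈ s then w p else 0, fun p => ?_, ?_, ?_⟩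
  · beta_reduce
    split_ifs with h
    exacts [hw p h, le_refl _]
  · rw [← hw1, Finset.sum_ite_mem, Finset.univ_inter]
  · rw [Finset.affineCombination_eq_linear_combination _ _ _ hw1]
    simp only [ite_smul, zero_smul, Finset.sum_ite_mem, Finset.univ_inter]

theorem one_mem_finCone {x : Fin n → ℝ} (hx : x ∈ P.carrier) :
    ((1 : ℝ), x) ∈ finCone P.gen := by
  obtain ⟨c, hc, hc1, rfl⟩ := exists_weights hx
  refine ⟨c, hc, Prod.ext ?_ ?_⟩
  · simpa [gen, Prod.fst_sum] using hc1.symm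
  · simp [gen, Prod.snd_sum]

theorem mem_smul_of_mem_finCone {k : ℝ} {x : Fin n → ℝ} (h : (k, x) ∈ finCone P.gen) :
    0 ≤ k ∧ x ∈ k • P.carrier := by
  obtain ⟨c, hc, he⟩ := h
  have h1 : k = ∑ p, c p := by
    have := congrArg Prod.fst he
    simpa [gen, Prod.fst_sum] using this
  have h2 : x = ∑ p, c p • latticePoint p.1 := by
    have := congrArg Prod.snd he
    simpa [gen, Prod.snd_sum] using this
  have hk : 0 ≤ k := h1 ▸ Finset.sum_nonneg fun p _ => hc p
  refine ⟨hk, ?_⟩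
  rcases hk.eq_or_lt with h0 | h0
  · have hz : ∀ p, c p = 0 := fun p =>
      (Finset.sum_eq_zero_iff_of_nonneg fun p _ => hc p).1 (h1.symm.trans h0.symm) p
        (Finset.mem_univ p)
    rw [← h0, Set.zero_smul_set P.nonempty, h2]
    simp [hz]
  · refine ⟨∑ p, (k⁻¹ * c p) • latticePoint p.1, ?_, ?_⟩
    · refine P.convex.sum_mem (fun p _ => mul_nonneg (inv_nonneg.2 hk) (hc p)) ?_
        fun p _ => latticePoint_mem p
      rw [← Finset.mul_sum, ← h1, inv_mul_cancel₀ h0.ne']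
    · simp only [mul_smul, ← Finset.smul_sum]
      rw [h2, smul_smul, mul_inv_cancel₀ h0.ne', one_smul]

/-- Homogenize the exposing functional l: its maximum `l x₀` on P becomes a multiple of the height
coordinate, from which l is subtracted. -/
theorem exists_supporting (σ : Face P) : ∃ L : (ℝ × (Fin n → ℝ)) →ₗ[ℝ] ℝ,
    (∀ y ∈ P.carrier, 0 ≤ L (1, y)) ∧ ∀ y ∈ P.carrier, L (1, y) = 0 ↔ y ∈ σ.1 := by
  obtain ⟨l, hl⟩ := σ.2.2 σ.2.1
  obtain ⟨x₀, hx₀⟩ := σ.2.1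
  have hx₀' := hx₀
  rw [hl] at hx₀'
  refine ⟨l x₀ • LinearMap.fst ℝ ℝ _ - l.toLinearMap ∘ₗ LinearMap.snd ℝ ℝ _, fun y hy => ?_,
    fun y hy => ?_⟩
  · have := hx₀'.2 y hy
    simpa using this
  · rw [hl]
    simp only [LinearMap.sub_apply, LinearMap.smul_apply, LinearMap.fst_apply, smul_eq_mul, mul_one,
      LinearMap.comp_apply, LinearMap.snd_apply, ContinuousLinearMap.coe_coe]
    constructor
    · intro h
      refine ⟨hy, fun z hz => ?_⟩
      have := hx₀'.2 z hz
      linarith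
    · rintro ⟨-, h⟩
      have h1 := h x₀ hx₀'.1
      have h2 := hx₀'.2 y hy
      linarith

variable (P) in
/-- A functional which is nonnegative on the cone over `P` and cuts out the face `σ`. -/
def support (σ : Face P) : (ℝ × (Fin n → ℝ)) →ₗ[ℝ] ℝ := (exists_supporting σ).choose

theorem support_nonneg (σ : Face P) {y : Fin n → ℝ} (hy : y ∈ P.carrier) :
    0 ≤ P.support σ (1, y) := (exists_supporting σ).choose_spec.1 y hy

theorem support_eq_zero (σ : Face P) {y : Fin n → ℝ} (hy : y ∈ P.carrier) :
    P.support σ (1, y) = 0 ↔ y ∈ σ.1 := (exists_supporting σ).choose_spec.2 y hy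

/-- The functional of `exists_exposing` cuts the face out of P. Generators occurring in x lie on it,
so `P.support ρ` vanishes at x as well. A point y of the face is a convex combination of generators
on the face, each of which can be partly subtracted from x; adding these relations gives the same
for y. -/
theorem exists_face_of_mem_finCone {x : ℝ × (Fin n → ℝ)} (hx : x ∈ finCone P.gen) (hx0 : x ≠ 0) :
    ∃ ρ : Face P, P.support ρ x = 0 ∧ ∀ y ∈ ρ.1, ∃ ε : ℝ, 0 < ε ∧
      x - ε • ((1 : ℝ), y) ∈ finCone P.gen := by
  obtain ⟨L, hL, hLx, hLg⟩ := exists_exposing (deg := LinearMap.fst ℝ ℝ (Fin n → ℝ))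
    (g := P.gen) (fun p => by simp [gen]) hx
  have hlin : ∀ y, L (1, y) = L (1, 0) + L (0, y) := fun y => by
    rw [← map_add]; simp
  have hpos : ∀ y ∈ P.carrier, 0 ≤ L (1, y) := fun y hy =>
    nonneg_of_mem_finCone hL (one_mem_finCone hy)
  obtain ⟨c, hc, hce⟩ := id hx
  have hzero : ∀ p, c p ≠ 0 → L (P.gen p) = 0 := by
    intro p hp
    have h1 := hLx
    rw [hce] at h1
    simp only [map_sum, map_smul, smul_eq_mul] at h1
    have h2 := (Finset.sum_eq_zero_iff_of_nonneg fun p _ => mul_nonneg (hc p) (hL p)).1 h1 p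
      (Finset.mem_univ p)
    exact (mul_eq_zero.1 h2).resolve_left hp
  obtain ⟨p₀, hp₀⟩ : ∃ p, c p ≠ 0 := by
    by_contra hcon
    push Not at hcon
    exact hx0 (hce.trans (by simp [hcon]))
  let F : Set (Fin n → ℝ) := {y | y ∈ P.carrier ∧ L (1, y) = 0}
  have hF : IsExposed ℝ P.carrier F := by
    intro _
    refine ⟨LinearMap.toContinuousLinearMap (-(L ∘ₗ LinearMap.inr ℝ ℝ _)), ?_⟩
    ext y
    simp only [F, Set.mem_ofPred_eq, LinearMap.coe_toContinuousLinearMap', LinearMap.neg_apply,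
      LinearMap.comp_apply, LinearMap.inr_apply, neg_le_neg_iff]
    refine and_congr_right fun hy => ⟨fun h z hz => ?_, fun h => ?_⟩
    · have := hpos z hz
      rw [hlin] at this h
      linarith
    · have h1 := h _ (latticePoint_mem p₀)
      have h2 := hzero p₀ hp₀
      have h3 := hpos y hy
      rw [gen, hlin] at h2
      rw [hlin] at h3 ⊢
      linarith
  let ρ : Face P := ⟨F, ⟨_, latticePoint_mem p₀, hzero p₀ hp₀⟩, hF⟩
  refine ⟨ρ, ?_, ?_⟩
  · rw [hce, map_sum]
    refine Finset.sum_eq_zero fun p _ => ?_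
    rw [map_smul]
    by_cases hp : c p = 0
    · rw [hp, zero_smul]
    · rw [gen, (support_eq_zero ρ (latticePoint_mem p)).2 ⟨latticePoint_mem p, hzero p hp⟩,
        smul_zero]
  · rintro y ⟨hy, hLy⟩
    obtain ⟨d, hd, hd1, hdy⟩ := exists_weights hy
    have hy' : ((1 : ℝ), y) = ∑ p, d p • P.gen p := by
      refine Prod.ext ?_ ?_
      · simpa [gen, Prod.fst_sum] using hd1.symm
      · simp [gen, Prod.snd_sum, hdy]
    have hdz : ∀ p, d p ≠ 0 → L (P.gen p) = 0 := by
      intro p hp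
      have h1 := hLy
      rw [hy'] at h1
      simp only [map_sum, map_smul, smul_eq_mul] at h1
      have h2 := (Finset.sum_eq_zero_iff_of_nonneg fun p _ => mul_nonneg (hd p) (hL p)).1 h1 p
        (Finset.mem_univ p)
      exact (mul_eq_zero.1 h2).resolve_left hp
    have hT : ∀ p, ∃ T : ℝ, 0 ≤ T ∧ T • x - d p • P.gen p ∈ finCone P.gen := by
      intro p
      by_cases hp : d p = 0
      · exact ⟨0, le_refl _, by simpa [hp] using zero_mem_finCone⟩
      · obtain ⟨ε, hε, hmem⟩ := hLg p (hdz p hp)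
        refine ⟨d p / ε, div_nonneg (hd p) hε.le, ?_⟩
        have : (d p / ε) • x - d p • P.gen p = (d p / ε) • (x - ε • P.gen p) := by
          rw [smul_sub, smul_smul, div_mul_cancel₀ _ hε.ne']
        rw [this]
        exact smul_mem_finCone (div_nonneg (hd p) hε.le) hmem
    choose T hT0 hTmem using hT
    have hpos : 0 < ∑ p, T p + 1 :=
      add_pos_of_nonneg_of_pos (Finset.sum_nonneg fun p _ => hT0 p) one_pos
    refine ⟨(∑ p, T p + 1)⁻¹, inv_pos.2 hpos, ?_⟩
    have : x - (∑ p, T p + 1)⁻¹ • ((1 : ℝ), y)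
        = (∑ p, T p + 1)⁻¹ • (∑ p, (T p • x - d p • P.gen p) + x) := by
      rw [Finset.sum_sub_distrib, ← Finset.sum_smul, ← hy', sub_add_eq_add_sub]
      nth_rewrite 3 [← one_smul ℝ x]
      rw [← add_smul, smul_sub, smul_smul, inv_mul_cancel₀ hpos.ne', one_smul]
    rw [this]
    exact smul_mem_finCone (inv_nonneg.2 hpos.le)
      (add_mem_finCone (sum_mem_finCone _ fun p _ => hTmem p) hx)

/-- The y with (1, y) in the span form an affine subspace containing P, hence all of ℝⁿ by full
dimensionality. -/
theorem span_gen : Submodule.span ℝ (Set.range P.gen) = ⊤ := by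
  rw [eq_top_iff]
  set W := Submodule.span ℝ (Set.range P.gen)
  have hgen : ∀ x ∈ finCone P.gen, x ∈ W := by
    rintro x ⟨c, -, rfl⟩
    exact Submodule.sum_mem _ fun p _ => Submodule.smul_mem _ _ (Submodule.subset_span ⟨p, rfl⟩)
  let Q : AffineSubspace ℝ (Fin n → ℝ) := W.toAffineSubspace.comap
    ((LinearMap.inr ℝ ℝ (Fin n → ℝ)).toAffineMap + AffineMap.const ℝ _ (1, 0))
  have hQ : ∀ y, y ∈ Q ↔ ((1 : ℝ), y) ∈ W := by
    intro y
    rw [AffineSubspace.mem_comap, Submodule.mem_toAffineSubspace]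
    simp
  have htop : ∀ y : Fin n → ℝ, ((1 : ℝ), y) ∈ W := by
    have : affineSpan ℝ P.carrier ≤ Q :=
      affineSpan_le.2 fun y hy => (hQ y).2 (hgen _ (one_mem_finCone hy))
    rw [P.fullDimensional] at this
    exact fun y => (hQ y).1 (this (AffineSubspace.mem_top ℝ _ y))
  rintro ⟨k, x⟩ -
  have : ((k, x) : ℝ × (Fin n → ℝ)) = (k - 1) • ((1 : ℝ), 0) + (1, x) := by
    ext <;> simp
  rw [this]
  exact Submodule.add_mem _ (Submodule.smul_mem _ _ (htop 0)) (htop x)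

end NormalLatticePolytope

open NormalLatticePolytope

instance : Fintype (Face P) := Fintype.ofFinite _

variable {K : Type*} [Field K]

namespace SeshadriStratification

variable (S : SeshadriStratification P K)

/-- The vector `-μ_σ` in the real cone over `P`. -/
def vec (σ : Face P) : ℝ × (Fin n → ℝ) := ((S.deg σ : ℝ), fun i => -(S.wt σ i : ℝ))

theorem deg_cast_pos (σ : Face P) : (0 : ℝ) < S.deg σ := by
  exact_mod_cast S.deg_pos σ

theorem vec_eq (σ : Face P) : S.vec σ = (S.deg σ : ℝ) • ((1 : ℝ), S.markedPoint σ) := by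
  have := (S.deg_cast_pos σ).ne'
  ext
  · simp [vec]
  · simp only [vec, markedPoint, Prod.smul_mk, Pi.smul_apply, smul_eq_mul]
    field_simp

theorem markedPoint_mem (σ : Face P) : S.markedPoint σ ∈ σ.1 :=
  intrinsicInterior_subset (S.mem_relInt σ)

theorem face_subset (σ : Face P) : σ.1 ⊆ P.carrier := σ.2.2.subset

/-- A supporting functional of σ that vanishes at a relative interior point of τ vanishes on τ:
moving the point slightly away from some y in τ where it is positive would make it negative. -/
theorem markedPoint_mem_iff (σ τ : Face P) : S.markedPoint τ ∈ σ.1 ↔ τ ≤ σ := by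
  refine ⟨fun h y hy => ?_, fun h => h (S.markedPoint_mem τ)⟩
  have hyP := face_subset τ hy
  obtain ⟨ε, hε, hmem⟩ := exists_add_smul_sub_mem (S.mem_relInt τ) hy
  change S.markedPoint τ + ε • (S.markedPoint τ - y) ∈ τ.1 at hmem
  have h1 := support_nonneg σ (face_subset τ hmem)
  have h2 := (support_eq_zero σ (face_subset τ (S.markedPoint_mem τ))).2 h
  have h3 := support_nonneg σ hyP
  have h4 : ((1 : ℝ), S.markedPoint τ + ε • (S.markedPoint τ - y))
      = (1 + ε) • ((1 : ℝ), S.markedPoint τ) - ε • ((1 : ℝ), y) := by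
    refine Prod.ext ?_ ?_
    · simp
    · change _ = (1 + ε) • S.markedPoint τ - ε • y
      rw [add_smul, one_smul, smul_sub]
      abel
  rw [h4, map_sub, map_smul, map_smul, h2] at h1
  simp only [smul_eq_mul, mul_zero, zero_sub, Left.nonneg_neg_iff] at h1
  have h5 : P.support σ (1, y) ≤ 0 := nonpos_of_mul_nonpos_right h1 hε
  exact (support_eq_zero σ hyP).1 (le_antisymm h5 h3)

/-- The cone over `P`, marked by the vectors `-μ_σ`. -/
def markedCone : MarkedCone (ℝ × (Fin n → ℝ)) P.verts (Face P) where
  g := P.gen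
  v := S.vec
  deg := LinearMap.fst ℝ ℝ _
  L := P.support
  deg_g p := by simp [gen]
  deg_v σ := S.deg_cast_pos σ
  v_mem σ := by
    rw [vec_eq]
    exact smul_mem_finCone (S.deg_cast_pos σ).le
      (one_mem_finCone (face_subset σ (S.markedPoint_mem σ)))
  L_g σ p := support_nonneg σ (latticePoint_mem p)
  L_v σ τ := by
    rw [vec_eq, map_smul, smul_eq_mul, mul_eq_zero, or_iff_right (S.deg_cast_pos τ).ne',
      support_eq_zero σ (face_subset τ (S.markedPoint_mem τ)), markedPoint_mem_iff]
  exists_face x hx hx0 := by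
    obtain ⟨ρ, hρ, h⟩ := exists_face_of_mem_finCone hx hx0
    obtain ⟨ε, hε, hmem⟩ := h _ (S.markedPoint_mem ρ)
    refine ⟨ρ, hρ, ε / S.deg ρ, div_pos hε (S.deg_cast_pos ρ), ?_⟩
    rwa [vec_eq, smul_smul, div_mul_cancel₀ _ (S.deg_cast_pos ρ).ne']

/-- The polytope as a face of itself. -/
def topFace (P : NormalLatticePolytope n) : Face P := ⟨P.carrier, P.nonempty, IsExposed.refl _⟩

/-- The face found for this vector contains the marked point of P, hence is P itself and contains
all generators. This is the interiority needed in `MarkedCone.exists_sum_of_maximal`. -/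
theorem exists_vec_topFace_sub_mem (p : P.verts) :
    ∃ ε : ℝ, 0 < ε ∧ S.vec (topFace P) - ε • P.gen p ∈ finCone P.gen := by
  have hne : S.vec (topFace P) ≠ 0 := fun h => (S.deg_cast_pos (topFace P)).ne' (congrArg Prod.fst h)
  obtain ⟨ρ, hρ, h⟩ := exists_face_of_mem_finCone (S.markedCone.v_mem (topFace P)) hne
  exact h _ ((S.markedCone.L_v ρ (topFace P)).1 hρ (latticePoint_mem p))

theorem topFace_mem (C : Flag (Face P)) : topFace P ∈ C := by
  have : insert (topFace P) (C : Set (Face P)) = C := by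
    refine (C.maxChain.2 ?_ (Set.subset_insert _ _)).symm
    exact C.maxChain.1.insert fun τ _ _ => Or.inr fun y hy => face_subset τ hy
  rw [← SetLike.mem_coe, ← this]
  exact Set.mem_insert _ _

end SeshadriStratification

end FanDegeneration

end

/-! ### Weights of the coordinate ring and their chain representations. -/

noncomputable section

namespace FanDegeneration

open scoped DirectSum Pointwise
open NormalLatticePolytope

theorem sum_subtype_smul {A E R : Type*} [Fintype A] [Semiring R] [AddCommMonoid E] [Module R E]
    (D : Set A) [Fintype D] [DecidablePred (· ∈ D)] (k : D → R) (v : A → E) :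
    ∑ σ : D, k σ • v σ = ∑ σ, (if h : σ ∈ D then k ⟨σ, h⟩ else 0) • v σ := by
  rw [← Finset.sum_subset (Finset.subset_univ (Finset.univ.filter (· ∈ D)))]
  · rw [Finset.sum_subtype (F := ‹Fintype D›) (Finset.univ.filter (· ∈ D)) (p := (· ∈ D)) (by simp)]
    exact Finset.sum_congr rfl fun σ _ => by rw [dif_pos σ.2]
  · intro σ _ hσ
    rw [dif_neg (by simpa using hσ), zero_smul]

variable {n : ℕ} {P : NormalLatticePolytope n}

instance : Nonempty (Linearization P) :=
  ⟨{ order := inferInstanceAs (LinearOrder (LinearExtension (Face P)))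
     lt_of_lt := fun _ _ h => lt_of_le_of_ne (toLinearExtension.monotone h.le) h.ne }⟩

theorem monWeight_add (m m' : Lambda P →₀ ℕ) :
    monWeight P (m + m') = monWeight P m + monWeight P m' := by
  rw [monWeight, Finsupp.sum_add_index' (by simp) (by intros; rw [add_smul]), neg_add]
  rfl

variable (P) in
/-- The weight of a monomial, as an additive map. -/
def monWeightHom : (Lambda P →₀ ℕ) →+ WeightLattice n where
  toFun := monWeight P
  map_zero' := by rw [monWeight, Finsupp.sum_zero_index, neg_zero]
  map_add' := monWeight_add

variable (P) in
/-- The weights of `T̂` on `K[X̂_P]`. -/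
def weightMonoid : AddSubmonoid (WeightLattice n) := AddMonoidHom.mrange (monWeightHom P)

theorem mem_weightMonoid {w : WeightLattice n} : w ∈ weightMonoid P ↔ ∃ m, monWeight P m = w :=
  Iff.rfl

theorem monWeight_single (χ : Lambda P) (k : ℕ) :
    monWeight P (Finsupp.single χ k) = -(k • ((1 : ℤ), χ.1)) := by
  rw [monWeight, Finsupp.sum_single_index (by simp)]

theorem exists_monWeight_of_mem_smul (k : ℕ) (χ : Fin n → ℤ)
    (h : latticePoint χ ∈ (k : ℝ) • P.carrier) : ∃ m, monWeight P m = (-(k : ℤ), -χ) := by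
  induction k generalizing χ with
  | zero =>
    rw [Nat.cast_zero, Set.zero_smul_set P.nonempty] at h
    have h0 : χ = 0 := by
      funext i
      have := congrFun (Set.mem_singleton_iff.1 h) i
      simpa [latticePoint] using this
    subst h0
    exact ⟨0, by simp [monWeight]; rfl⟩
  | succ k ih =>
    obtain ⟨α, β, hα, hβ, rfl⟩ := P.normal k 1 χ h
    obtain ⟨m, hm⟩ := ih α hα
    rw [Nat.cast_one, one_smul] at hβ
    refine ⟨m + Finsupp.single ⟨β, hβ⟩ 1, ?_⟩
    rw [monWeight_add, hm, monWeight_single]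
    refine Prod.ext ?_ ?_
    · simp; ring
    · simp; abel_nf

/-- The vector `-w` in the real cone over `P`. -/
def realWeight (w : WeightLattice n) : ℝ × (Fin n → ℝ) := (-(w.1 : ℝ), fun i => -(w.2 i : ℝ))

/-- The place where normality enters: a lattice point of the cone at height k lies in kP and splits
into k lattice points of P, so the weight monoid is saturated and convex geometry decides
membership. -/
theorem mem_weightMonoid_iff {w : WeightLattice n} :
    w ∈ weightMonoid P ↔ realWeight w ∈ finCone P.gen := by
  constructor
  · rintro ⟨m, rfl⟩
    change realWeight (monWeight P m) ∈ _
    induction m using Finsupp.induction with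
    | zero =>
      convert zero_mem_finCone
      ext <;> simp [realWeight, monWeight]
    | single_add χ k m _ _ ih =>
      have : realWeight (monWeight P (Finsupp.single χ k + m))
          = (k : ℝ) • ((1 : ℝ), latticePoint χ.1) + realWeight (monWeight P m) := by
        rw [monWeight_add, monWeight_single]
        ext
        · simp [realWeight]; ring
        · simp [realWeight, latticePoint]; ring
      rw [this]
      exact add_mem_finCone (smul_mem_finCone k.cast_nonneg (one_mem_finCone χ.2)) ih
  · intro h
    obtain ⟨h1, h2⟩ := mem_smul_of_mem_finCone h
    obtain ⟨k, hk⟩ : ∃ k : ℕ, w.1 = -(k : ℤ) := by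
      refine ⟨(-w.1).toNat, ?_⟩
      have : (0 : ℤ) ≤ -w.1 := by exact_mod_cast h1
      omega
    obtain ⟨m, hm⟩ := exists_monWeight_of_mem_smul (P := P) k (-w.2) (by
      convert h2 using 2
      · rw [hk]; push_cast; ring
      · simp [latticePoint])
    exact mem_weightMonoid.2 ⟨m, hm.trans (Prod.ext hk.symm (neg_neg _))⟩

variable {K : Type*} [Field K]

namespace SeshadriStratification

variable (S : SeshadriStratification P K)

/-- Transfers rational relations to the real cone; both `vec` and `realWeight` carry a minus sign.
-/
theorem sum_mu_eq_iff (b : Face P → ℚ) (w : WeightLattice n) :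
    ∑ σ, b σ • toRat (S.mu σ) = toRat w ↔ ∑ σ, (b σ : ℝ) • S.vec σ = realWeight w := by
  have h1 : ∑ σ, b σ • toRat (S.mu σ) = toRat w ↔
      (-∑ σ, b σ * S.deg σ = w.1 ∧ ∀ i, ∑ σ, b σ * S.wt σ i = w.2 i) := by
    rw [Prod.ext_iff, funext_iff]
    simp [Prod.fst_sum, Prod.snd_sum, toRat, mu, Finset.sum_apply]
  have h2 : ∑ σ, (b σ : ℝ) • S.vec σ = realWeight w ↔
      (∑ σ, (b σ : ℝ) * S.deg σ = -w.1 ∧ ∀ i, -∑ σ, (b σ : ℝ) * S.wt σ i = -w.2 i) := by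
    rw [Prod.ext_iff, funext_iff]
    simp [Prod.fst_sum, Prod.snd_sum, realWeight, vec, Finset.sum_apply]
  rw [h1, h2]
  refine and_congr ?_ (forall_congr' fun i => ?_)
  · rw [neg_eq_iff_eq_neg, ← (Rat.cast_injective (α := ℝ)).eq_iff]
    push_cast
    rfl
  · rw [neg_inj, ← (Rat.cast_injective (α := ℝ)).eq_iff]
    push_cast
    rfl

/-- Shows that `coord` always takes its first branch. Over ℝ the marking along C is independent and
spans, so C has n + 1 elements; over ℚ independence persists, and n + 1 independent vectors span. -/
theorem coord_basis (C : Flag (Face P)) :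
    LinearIndependent ℚ (fun σ : C => toRat (S.mu σ)) ∧
      ⊤ ≤ Submodule.span ℚ (Set.range fun σ : C => toRat (S.mu σ)) := by
  classical
  obtain ⟨t⟩ : Nonempty (Linearization P) := inferInstance
  have hchain : IsChain (· ≤ ·) (C : Set (Face P)) := C.maxChain.1
  have hR : LinearIndependent ℝ (fun σ : C => S.vec σ) := by
    rw [Fintype.linearIndependent_iff]
    intro b hb σ
    have := S.markedCone.eq_zero_of_sum_eq_zero t.order t.lt_of_lt (C := C) hchain
      (b := fun σ => if h : σ ∈ (C : Set (Face P)) then b ⟨σ, h⟩ else 0)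
      (fun σ hσ => dif_neg hσ) ((sum_subtype_smul (C : Set (Face P)) b S.vec).symm.trans hb)
    have h2 := congrFun this σ
    rwa [dif_pos (show (σ : Face P) ∈ (C : Set (Face P)) from σ.2)] at h2
  have hQ : LinearIndependent ℚ (fun σ : C => toRat (S.mu σ)) := by
    rw [Fintype.linearIndependent_iff]
    intro b hb σ
    have h1 := (sum_subtype_smul (C : Set (Face P)) b fun σ => toRat (S.mu σ)).symm.trans hb
    rw [← toRat_zero, sum_mu_eq_iff] at h1
    have := S.markedCone.eq_zero_of_sum_eq_zero t.order t.lt_of_lt (C := C) hchain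
      (fun σ hσ => by rw [dif_neg hσ, Rat.cast_zero]) (h1.trans (by ext <;> simp [realWeight]))
    have h2 := congrFun this σ
    rw [dif_pos (show (σ : Face P) ∈ (C : Set (Face P)) from σ.2)] at h2
    exact Rat.cast_eq_zero.1 h2
  refine ⟨hQ, ?_⟩
  have hspan : ⊤ ≤ Submodule.span ℝ (Set.range fun σ : C => S.vec σ) := by
    intro z _
    obtain ⟨b, hb, rfl⟩ := S.markedCone.exists_sum_of_maximal t.order t.lt_of_lt C.maxChain
      (topFace_mem C) S.exists_vec_topFace_sub_mem span_gen z
    refine Submodule.sum_mem _ fun σ _ => ?_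
    by_cases hσ : σ ∈ (C : Set (Face P))
    · exact Submodule.smul_mem _ _ (Submodule.subset_span ⟨⟨σ, hσ⟩, rfl⟩)
    · rw [hb σ hσ, zero_smul]
      exact Submodule.zero_mem _
  rw [hQ.span_eq_top_of_card_eq_finrank']
  rw [← Module.finrank_eq_card_basis (Module.Basis.mk hR hspan)]
  simp

theorem coord_apply_of_notMem (C : Flag (Face P)) (x : ℚ × (Fin n → ℚ)) {σ : Face P}
    (hσ : σ ∉ C) : S.coord C x σ = 0 := by
  rw [coord, dif_pos (S.coord_basis C)]
  refine Finsupp.mapDomain_of_notMem_range _ _ ?_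
  rintro ⟨τ, rfl⟩
  exact hσ τ.2

theorem sum_coord (C : Flag (Face P)) (x : ℚ × (Fin n → ℚ)) :
    ∑ σ, S.coord C x σ • toRat (S.mu σ) = x := by
  rw [coord, dif_pos (S.coord_basis C)]
  set b := Module.Basis.mk (S.coord_basis C).1 (S.coord_basis C).2
  have h1 := b.linearCombination_repr x
  rw [Finsupp.linearCombination_apply] at h1
  refine Eq.trans ?_ h1
  change ∑ σ, (Finsupp.mapDomain Subtype.val (b.repr x)) σ • _ = _
  rw [← Finsupp.sum_fintype (Finsupp.mapDomain Subtype.val (b.repr x))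
    (fun σ r => r • toRat (S.mu σ)) (by simp), Finsupp.sum_mapDomain_index (by simp)
    (by intros; rw [add_smul])]
  refine Finsupp.sum_congr fun σ _ => ?_
  rw [Module.Basis.mk_apply]

/-- `a` represents the weight `w` as a nonnegative combination of the `μ_σ` along a chain. -/
structure IsRep (a : Face P → ℚ) (w : WeightLattice n) : Prop where
  nonneg : ∀ σ, 0 ≤ a σ
  isChain : IsChain (· ≤ ·) (Function.support a)
  sum_eq : ∑ σ, a σ • toRat (S.mu σ) = toRat w

theorem toRat_injective : Function.Injective (toRat (n := n)) := by
  intro w w' h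
  refine Prod.ext ?_ (funext fun i => ?_)
  · have := congrArg Prod.fst h
    simpa [toRat] using this
  · have := congrFun (congrArg Prod.snd h) i
    simpa [toRat] using this

variable {S} {a b : Face P → ℚ} {w w' : WeightLattice n}

theorem IsRep.weight_eq (h : S.IsRep a w) (h' : S.IsRep a w') : w = w' :=
  toRat_injective (h.sum_eq.symm.trans h'.sum_eq)

theorem IsRep.lex_le (h : S.IsRep a w) (t : Linearization P) {C : Set (Face P)}
    (hC : IsChain (· ≤ ·) C) (hb : ∀ σ, σ ∉ C → b σ = 0)
    (hbw : ∑ σ, b σ • toRat (S.mu σ) = toRat w) (σ : Face P)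
    (hσ : ∀ τ, t.order.lt σ τ → a τ = b τ) : a σ ≤ b σ := by
  have := S.markedCone.le_of_sum_eq t.order t.lt_of_lt (a := fun σ => (a σ : ℝ))
    (b := fun σ => (b σ : ℝ)) (fun σ => by exact_mod_cast h.nonneg σ) hC
    (fun σ hσ => by exact_mod_cast hb σ hσ)
    (((S.sum_mu_eq_iff a w).1 h.sum_eq).trans ((S.sum_mu_eq_iff b w).1 hbw).symm) σ
    (fun τ hτ => by exact_mod_cast hσ τ hτ)
  exact_mod_cast this

/-- The nonnegative representation bounds the coordinates of w along all maximal chains from below;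
by `IsRep.coord_eq` the bound is attained at any chain containing its support. -/
theorem IsRep.le_eigenValue (h : S.IsRep a w) (t : Linearization P) (C : Flag (Face P)) :
    (show RatVec t from a) ≤ S.eigenValue t C w := by
  by_contra hlt
  rw [not_le, RatVec.lt_iff] at hlt
  obtain ⟨σ, h1, h2⟩ := hlt
  exact absurd (h.lex_le t C.maxChain.1 (fun σ hσ => S.coord_apply_of_notMem C _ hσ)
    (S.sum_coord C _) σ fun τ hτ => (h1 τ hτ).symm) (not_le.2 h2)

theorem IsRep.coord_eq (h : S.IsRep a w) (C : Flag (Face P))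
    (hC : Function.support a ⊆ C) : S.coord C (toRat w) = a := by
  have hli := (S.coord_basis C).1
  classical
  have h0 : ∀ σ, σ ∉ C → S.coord C (toRat w) σ - a σ = 0 := fun σ hσ => by
    rw [S.coord_apply_of_notMem C _ hσ, Function.notMem_support.1 fun h' => hσ (hC h'), sub_zero]
  have h1 : ∑ σ : (C : Set (Face P)), (S.coord C (toRat w) σ - a σ) • toRat (S.mu σ) = 0 := by
    rw [sum_subtype_smul (C : Set (Face P)) (fun σ => S.coord C (toRat w) σ - a σ)
      fun σ => toRat (S.mu σ)]
    have : ∀ σ, (if _ : σ ∈ (C : Set (Face P)) then S.coord C (toRat w) σ - a σ else 0)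
        = S.coord C (toRat w) σ - a σ := fun σ => by
      split_ifs with h
      · rfl
      · exact (h0 σ h).symm
    simp only [this, sub_smul, Finset.sum_sub_distrib, S.sum_coord, h.sum_eq, sub_self]
  funext σ
  by_cases hσ : σ ∈ C
  · exact sub_eq_zero.1 (Fintype.linearIndependent_iff.1 hli _ h1 ⟨σ, hσ⟩)
  · exact sub_eq_zero.1 (h0 σ hσ)

theorem IsRep.eq (h : S.IsRep a w) (h' : S.IsRep b w) : a = b := by
  obtain ⟨t⟩ : Nonempty (Linearization P) := inferInstance
  exact eq_of_lex_le_of_lex_le (A := Face P) t.order (a := a) (b := b)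
    (h.lex_le t h'.isChain (fun σ hσ => Function.notMem_support.1 hσ) h'.sum_eq)
    (h'.lex_le t h.isChain (fun σ hσ => Function.notMem_support.1 hσ) h.sum_eq)

theorem IsRep.mem_weightMonoid (h : S.IsRep a w) : w ∈ weightMonoid P := by
  rw [mem_weightMonoid_iff, ← (S.sum_mu_eq_iff a w).1 h.sum_eq]
  exact sum_mem_finCone _ fun σ _ => smul_mem_finCone (by exact_mod_cast h.nonneg σ)
    (S.markedCone.v_mem σ)

variable (S) in
-- Existence comes from the real cone. The coefficients are rational because along a flag containing
-- the support they are unique, and the rational coordinates solve the same equation.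
theorem exists_isRep (hw : w ∈ weightMonoid P) : ∃ a, S.IsRep a w := by
  obtain ⟨t⟩ : Nonempty (Linearization P) := inferInstance
  obtain ⟨a, ha, hchain, hsum⟩ := S.markedCone.exists_chain_sum (mem_weightMonoid_iff.1 hw)
  obtain ⟨C, hC⟩ := hchain.exists_subset_flag
  have h1 : ∀ σ, σ ∉ C → S.coord C (toRat w) σ = 0 := fun σ hσ => S.coord_apply_of_notMem C _ hσ
  have h2 := (S.sum_mu_eq_iff _ _).1 (S.sum_coord C (toRat w))
  have h3 : (fun σ => (S.coord C (toRat w) σ : ℝ) - a σ) = 0 := by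
    refine S.markedCone.eq_zero_of_sum_eq_zero t.order t.lt_of_lt (C := C) C.maxChain.1
      (fun σ hσ => ?_) ?_
    · rw [h1 σ hσ, Function.notMem_support.1 fun h' => hσ (hC h'), Rat.cast_zero, sub_zero]
    · simp only [sub_smul, Finset.sum_sub_distrib]
      rw [sub_eq_zero]
      exact h2.trans hsum
  have h4 : ∀ σ, (S.coord C (toRat w) σ : ℝ) = a σ := fun σ => sub_eq_zero.1 (congrFun h3 σ)
  have h5 : Function.support (S.coord C (toRat w)) ⊆ Function.support a := fun σ hσ h0 => hσ (by
    have := h4 σ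
    rw [h0] at this
    exact_mod_cast this)
  refine ⟨S.coord C (toRat w), fun σ => ?_, hchain.mono h5, S.sum_coord C _⟩
  have : (0 : ℝ) ≤ S.coord C (toRat w) σ := by rw [h4]; exact ha σ
  exact_mod_cast this

variable (S) in
/-- The unique representation of a weight. -/
def rep (w : weightMonoid P) : Face P → ℚ := (S.exists_isRep w.2).choose

variable (S) in
theorem isRep_rep (w : weightMonoid P) : S.IsRep (S.rep w) w := (S.exists_isRep w.2).choose_spec

variable (S) in
theorem rep_injective : Function.Injective S.rep := fun w w' h =>
  Subtype.ext ((S.isRep_rep w).weight_eq (h ▸ S.isRep_rep w'))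

/-- Nonnegative entries cannot cancel, so the support of a + b is the union of the two supports. -/
theorem inCommonCone_iff (ha : ∀ σ, 0 ≤ a σ) (hb : ∀ σ, 0 ≤ b σ) :
    InCommonCone a b ↔ IsChain (· ≤ ·) (Function.support (a + b)) := by
  have hsupp : Function.support (a + b) = Function.support a ∪ Function.support b := by
    ext σ
    have := ha σ
    have := hb σ
    simp only [Function.mem_support, Pi.add_apply, Set.mem_union]
    constructor
    · intro h
      by_contra hcon
      push Not at hcon
      exact h (by rw [hcon.1, hcon.2, add_zero])
    · rintro (h | h) h0
      · exact h (by linarith)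
      · exact h (by linarith)
  rw [hsupp]
  constructor
  · rintro ⟨C, hC, h1, h2⟩
    refine hC.mono (Set.union_subset (fun σ hσ => ?_) fun σ hσ => ?_)
    · by_contra h
      exact hσ (h1.2 σ h)
    · by_contra h
      exact hσ (h2.2 σ h)
  · intro h
    exact ⟨_, h, ⟨ha, fun σ hσ => by_contra fun h' => hσ (Or.inl h')⟩,
      ⟨hb, fun σ hσ => by_contra fun h' => hσ (Or.inr h')⟩⟩

theorem IsRep.inCommonCone_iff (h : S.IsRep a w) (h' : S.IsRep b w') :
    InCommonCone a b ↔ S.IsRep (a + b) (w + w') := by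
  rw [SeshadriStratification.inCommonCone_iff h.nonneg h'.nonneg]
  refine ⟨fun hc => ⟨fun σ => add_nonneg (h.nonneg σ) (h'.nonneg σ), hc, ?_⟩, fun hr => hr.isChain⟩
  rw [toRat_add, ← h.sum_eq, ← h'.sum_eq, ← Finset.sum_add_distrib]
  exact Finset.sum_congr rfl fun σ _ => by rw [Pi.add_apply, add_smul]

/-- The sum of two representations has the right weight and nonnegative entries, so only the chain
condition is at stake; uniqueness does the rest. Both kinds of fan relations come from this
dichotomy. -/
theorem rep_add_iff (w w' : weightMonoid P) :
    InCommonCone (S.rep w) (S.rep w') ↔ S.rep (w + w') = S.rep w + S.rep w' := by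
  rw [(S.isRep_rep w).inCommonCone_iff (S.isRep_rep w')]
  exact ⟨fun h => (S.isRep_rep (w + w')).eq h, fun h => h ▸ S.isRep_rep (w + w')⟩

end SeshadriStratification

end FanDegeneration

end

noncomputable section

namespace FanDegeneration

open scoped DirectSum Pointwise

/-! ### The fan algebra -/

section Fan

variable {K A : Type*} [Field K] [PartialOrder A] {Γ : Set (A → ℚ)}

theorem fanY_mul {a b c : Γ} (h : InCommonCone a.1 b.1) (hc : c.1 = a.1 + b.1) :
    fanY K a * fanY K b = fanY K c := by
  rw [fanY, fanY, fanY, ← map_mul, Ideal.Quotient.eq]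
  exact Ideal.subset_span (FanRel.mul a b c h hc)

theorem fanY_mul_eq_zero {a b : Γ} (h : ¬ InCommonCone a.1 b.1) : fanY K a * fanY K b = 0 := by
  rw [fanY, fanY, ← map_mul, Ideal.Quotient.eq_zero_iff_mem]
  exact Ideal.subset_span (FanRel.zero a b h)

theorem fanY_zero {c : Γ} (hc : c.1 = 0) : fanY K c = 1 := by
  rw [fanY, ← map_one (Ideal.Quotient.mk _), Ideal.Quotient.eq]
  exact Ideal.subset_span (FanRel.one c hc)

/-- The universal property of the fan algebra. -/
def fanLift {B : Type*} [CommRing B] [Algebra K B] (f : Γ → B)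
    (hmul : ∀ a b c : Γ, InCommonCone a.1 b.1 → c.1 = a.1 + b.1 → f a * f b = f c)
    (hzero : ∀ a b : Γ, ¬ InCommonCone a.1 b.1 → f a * f b = 0)
    (hone : ∀ c : Γ, c.1 = 0 → f c = 1) : FanAlgebra K Γ →ₐ[K] B :=
  Ideal.Quotient.liftₐ (fanIdeal K Γ) (MvPolynomial.aeval f) (by
    have : fanIdeal K Γ ≤ RingHom.ker (MvPolynomial.aeval f : MvPolynomial Γ K →ₐ[K] B) := by
      refine Ideal.span_le.2 ?_
      rintro p (⟨a, b, c, h, hc⟩ | ⟨a, b, h⟩ | ⟨c, hc⟩)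
      · simp [RingHom.mem_ker, hmul a b c h hc]
      · simp [RingHom.mem_ker, hzero a b h]
      · simp [RingHom.mem_ker, hone c hc]
    exact fun a ha => this ha)

theorem fanLift_fanY {B : Type*} [CommRing B] [Algebra K B] (f : Γ → B)
    (hmul : ∀ a b c : Γ, InCommonCone a.1 b.1 → c.1 = a.1 + b.1 → f a * f b = f c)
    (hzero : ∀ a b : Γ, ¬ InCommonCone a.1 b.1 → f a * f b = 0)
    (hone : ∀ c : Γ, c.1 = 0 → f c = 1) (a : Γ) :
    fanLift (K := K) f hmul hzero hone (fanY K a) = f a := by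
  rw [fanY, fanLift]
  exact (Ideal.Quotient.liftₐ_apply _ _ _ _).trans (MvPolynomial.aeval_X f a)

theorem fanAlgebra_hom_ext {B : Type*} [CommRing B] [Algebra K B] {f g : FanAlgebra K Γ →ₐ[K] B}
    (h : ∀ a, f (fanY K a) = g (fanY K a)) : f = g :=
  Ideal.Quotient.algHom_ext _ (MvPolynomial.algHom_ext h)

/-- A product of two generators is a generator or zero, so their span is stable under multiplication
by generators. -/
theorem span_fanY (h0 : (0 : A → ℚ) ∈ Γ)
    (hadd : ∀ a b : Γ, InCommonCone a.1 b.1 → a.1 + b.1 ∈ Γ) :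
    Submodule.span K (Set.range (fanY K : Γ → FanAlgebra K Γ)) = ⊤ := by
  rw [eq_top_iff]
  rintro x -
  obtain ⟨p, rfl⟩ := Ideal.Quotient.mk_surjective x
  induction p using MvPolynomial.induction_on with
  | C c =>
    have : Ideal.Quotient.mk (fanIdeal K Γ) (MvPolynomial.C c) = c • fanY K (⟨0, h0⟩ : Γ) := by
      rw [fanY_zero (c := (⟨0, h0⟩ : Γ)) rfl, ← Algebra.algebraMap_eq_smul_one]
      rfl
    rw [this]
    exact Submodule.smul_mem _ _ (Submodule.subset_span ⟨_, rfl⟩)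
  | add p q hp hq => rw [map_add]; exact Submodule.add_mem _ hp hq
  | mul_X p a hp =>
    rw [map_mul]
    change Ideal.Quotient.mk _ p * fanY K a ∈ _
    generalize Ideal.Quotient.mk (fanIdeal K Γ) p = y at hp
    induction hp using Submodule.span_induction with
    | mem x hx =>
      obtain ⟨b, rfl⟩ := hx
      by_cases h : InCommonCone b.1 a.1
      · rw [fanY_mul (c := ⟨_, hadd b a h⟩) h rfl]
        exact Submodule.subset_span ⟨_, rfl⟩
      · rw [fanY_mul_eq_zero h]
        exact Submodule.zero_mem _
    | zero => rw [zero_mul]; exact Submodule.zero_mem _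
    | add x y _ _ hx hy => rw [add_mul]; exact Submodule.add_mem _ hx hy
    | smul c x _ hx => rw [smul_mul_assoc]; exact Submodule.smul_mem _ _ hx

/-- A bijection between index sets preserving the fan structure induces an isomorphism of fan
algebras. -/
def fanCongr {A' : Type*} [PartialOrder A'] {Γ' : Set (A' → ℚ)} (e : Γ ≃ Γ')
    (hcone : ∀ a b : Γ, InCommonCone a.1 b.1 ↔ InCommonCone (e a).1 (e b).1)
    (hadd : ∀ a b c : Γ, InCommonCone a.1 b.1 → (c.1 = a.1 + b.1 ↔ (e c).1 = (e a).1 + (e b).1))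
    (hzero : ∀ c : Γ, c.1 = 0 ↔ (e c).1 = 0) : FanAlgebra K Γ ≃ₐ[K] FanAlgebra K Γ' :=
  AlgEquiv.ofAlgHom
    (fanLift (fun a => fanY K (e a))
      (fun a b c h hc => fanY_mul ((hcone a b).1 h) ((hadd a b c h).1 hc))
      (fun a b h => fanY_mul_eq_zero fun h' => h ((hcone a b).2 h'))
      (fun c hc => fanY_zero ((hzero c).1 hc)))
    (fanLift (fun a => fanY K (e.symm a))
      (fun a b c h hc => by
        have h' : InCommonCone (e.symm a).1 (e.symm b).1 := (hcone _ _).2 (by simpa using h)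
        exact fanY_mul h' ((hadd _ _ _ h').2 (by simpa using hc)))
      (fun a b h => fanY_mul_eq_zero fun h' => h (by simpa using (hcone _ _).1 h'))
      (fun c hc => fanY_zero ((hzero _).2 (by simpa using hc))))
    (fanAlgebra_hom_ext fun a => by simp [fanLift_fanY])
    (fanAlgebra_hom_ext fun a => by simp [fanLift_fanY])

theorem fanCongr_fanY {A' : Type*} [PartialOrder A'] {Γ' : Set (A' → ℚ)} (e : Γ ≃ Γ')
    (hcone : ∀ a b : Γ, InCommonCone a.1 b.1 ↔ InCommonCone (e a).1 (e b).1)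
    (hadd : ∀ a b c : Γ, InCommonCone a.1 b.1 → (c.1 = a.1 + b.1 ↔ (e c).1 = (e a).1 + (e b).1))
    (hzero : ∀ c : Γ, c.1 = 0 ↔ (e c).1 = 0) (a : Γ) :
    fanCongr (K := K) e hcone hadd hzero (fanY K a) = fanY K (e a) :=
  fanLift_fanY (fun a => fanY K (e a))
    (fun a b c h hc => fanY_mul ((hcone a b).1 h) ((hadd a b c h).1 hc))
    (fun a b h => fanY_mul_eq_zero fun h' => h ((hcone a b).2 h'))
    (fun c hc => fanY_zero ((hzero c).1 hc)) a

end Fan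

/-! ### Classes in the associated graded algebra -/

namespace QuasiValuation

variable {K R G : Type*} [Field K] [CommRing R] [Algebra K R] [AddCommGroup G] [LinearOrder G]
  [IsOrderedAddMonoid G] (v : QuasiValuation K R G)

theorem leafMk_eq_zero {a : G} {x : v.geSub a} : v.leafMk a x = 0 ↔ x.1 ∈ v.gtSub a :=
  Submodule.Quotient.mk_eq_zero _

theorem mem_gtSub_of_ne {a : G} {x : R} (hx : x ∈ v.geSub a) (h : v.toFun x ≠ a) :
    x ∈ v.gtSub a :=
  show (a : WithTop G) < v.toFun x from lt_of_le_of_ne hx (Ne.symm h)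

theorem of_leafMk_congr {a b : G} (h : a = b) (x : v.geSub a) (y : v.geSub b) (hxy : x.1 = y.1) :
    DirectSum.of v.Leaf a (v.leafMk a x) = DirectSum.of v.Leaf b (v.leafMk b y) :=
  DirectSum.of_eq_of_gradedMonoid_eq (v.mk_leafMk_eq h x y hxy)

theorem of_leafMk_smul {a : G} (c : K) (x : v.geSub a) :
    DirectSum.of v.Leaf a (v.leafMk a (c • x)) = c • DirectSum.of v.Leaf a (v.leafMk a x) :=
  (DirectSum.lof K _ v.Leaf a).map_smul c (v.leafMk a x)

theorem of_leafMk_sum {ι : Type*} (s : Finset ι) {a : G} (x : ι → v.geSub a) :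
    DirectSum.of v.Leaf a (v.leafMk a (∑ i ∈ s, x i))
      = ∑ i ∈ s, DirectSum.of v.Leaf a (v.leafMk a (x i)) := by
  rw [← map_sum]
  congr 1
  exact map_sum (Submodule.mkQ _) _ _

theorem of_leafMk_mul {a b : G} (x : v.geSub a) (y : v.geSub b) :
    DirectSum.of v.Leaf a (v.leafMk a x) * DirectSum.of v.Leaf b (v.leafMk b y)
      = DirectSum.of v.Leaf (a + b) (v.leafMk (a + b) ⟨x.1 * y.1, v.mul_mem_geSub x.2 y.2⟩) :=
  DirectSum.of_mul_of _ _

end QuasiValuation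

/-! ### Eigenfunctions -/

variable {n : ℕ} {P : NormalLatticePolytope n} {K : Type*} [Field K]

theorem aeval_iotaHat_monomial (t : TorusHat K n) (m : Lambda P →₀ ℕ) :
    MvPolynomial.aeval (iotaHat P K t) (MvPolynomial.monomial m (1 : K))
      = (character (-monWeight P m) t : Kˣ) := by
  induction m using Finsupp.induction with
  | zero =>
    have : monWeight P (0 : Lambda P →₀ ℕ) = 0 := map_zero (monWeightHom P)
    rw [this, neg_zero, character_zero]
    simp
  | single_add χ k m _ hk0 ih =>
    clear hk0
    rw [← one_mul (1 : K), ← MvPolynomial.monomial_mul, map_mul, ih, monWeight_add, neg_add,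
      character_add, Units.val_mul, monWeight_single, neg_neg]
    congr 1
    have hk : character (k • ((1 : ℤ), χ.1)) t = character ((1 : ℤ), χ.1) t ^ k := by
      induction k with
      | zero => rw [zero_smul, character_zero, pow_zero]
      | succ k ih => rw [add_smul, one_smul, character_add, ih, pow_succ]
    rw [hk, MvPolynomial.aeval_monomial, map_one, one_mul, Units.val_pow_eq_pow_val]
    exact Finsupp.prod_single_index (pow_zero _)

/-- Both monomials restrict to the same character on the torus orbit, which is dense in the cone. -/
theorem mk_monomial_eq {m m' : Lambda P →₀ ℕ} (h : monWeight P m = monWeight P m') :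
    (Ideal.Quotient.mk (coneIdeal P K) (MvPolynomial.monomial m 1) : CoordRing P K)
      = Ideal.Quotient.mk (coneIdeal P K) (MvPolynomial.monomial m' 1) := by
  rw [Ideal.Quotient.eq, mem_coneIdeal]
  intro t
  rw [map_sub, aeval_iotaHat_monomial, aeval_iotaHat_monomial, h, sub_self]

variable (K) in
/-- The eigenfunction of weight `w` which is a monomial in the coordinates. -/
def mono (w : weightMonoid P) : CoordRing P K :=
  Ideal.Quotient.mk (coneIdeal P K) (MvPolynomial.monomial (mem_weightMonoid.1 w.2).choose 1)

theorem mk_monomial (m : Lambda P →₀ ℕ) :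
    (Ideal.Quotient.mk (coneIdeal P K) (MvPolynomial.monomial m 1) : CoordRing P K)
      = mono K ⟨monWeight P m, m, rfl⟩ :=
  mk_monomial_eq (mem_weightMonoid.1 (⟨m, rfl⟩ : monWeight P m ∈ weightMonoid P)).choose_spec.symm

theorem mono_mem (w : weightMonoid P) : mono K w ∈ weightSpace P K w := by
  have := monomial_mem P K (mem_weightMonoid.1 w.2).choose 1
  rwa [(mem_weightMonoid.1 w.2).choose_spec] at this

theorem mono_zero : mono K (0 : weightMonoid P) = 1 := by
  have h := mk_monomial (P := P) (K := K) 0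
  have h0 : (⟨monWeight P 0, 0, rfl⟩ : weightMonoid P) = 0 := Subtype.ext (map_zero (monWeightHom P))
  rw [h0] at h
  rw [← h]
  exact map_one _

theorem mono_add (w w' : weightMonoid P) : mono K (w + w') = mono K w * mono K w' := by
  obtain ⟨_, m, rfl⟩ := w
  obtain ⟨_, m', rfl⟩ := w'
  have h := mk_monomial (P := P) (K := K) (m + m')
  have h0 : (⟨monWeight P (m + m'), m + m', rfl⟩ : weightMonoid P)
      = ⟨monWeight P m, m, rfl⟩ + ⟨monWeight P m', m', rfl⟩ := Subtype.ext (monWeight_add m m')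
  rw [h0] at h
  refine h.symm.trans ?_
  rw [← one_mul (1 : K), ← MvPolynomial.monomial_mul, map_mul, mk_monomial, mk_monomial]
  rfl

theorem mono_ne_zero (w : weightMonoid P) : mono K w ≠ 0 := by
  intro h
  rw [mono, Ideal.Quotient.eq_zero_iff_mem, mem_coneIdeal] at h
  have := h 1
  rw [aeval_iotaHat_monomial] at this
  exact Units.ne_zero _ this

variable [CharZero K]

theorem mem_weightMonoid_of_mem_weightSupport {g : CoordRing P K} {w : WeightLattice n}
    (hw : w ∈ weightSupport g) : w ∈ weightMonoid P := by
  obtain ⟨m, rfl⟩ := exists_monWeight hw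
  exact ⟨m, rfl⟩

/-- Multiplicity-freeness: all monomials of weight w coincide in the coordinate ring. -/
theorem decompose_mem_span_mono (g : CoordRing P K) (w : weightMonoid P) :
    (DirectSum.decompose (weightSpace P K) g w : CoordRing P K) ∈ Submodule.span K {mono K w} := by
  obtain ⟨p, rfl⟩ := Ideal.Quotient.mk_surjective g
  induction p using MvPolynomial.induction_on' with
  | monomial m c =>
    by_cases hm : monWeight P m = w
    · have h1 := monomial_mem P K m c
      rw [hm] at h1
      rw [DirectSum.decompose_of_mem_same _ h1, ← mul_one c, ← smul_eq_mul,
        ← MvPolynomial.smul_monomial]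
      obtain ⟨w, hw⟩ := w
      subst hm
      refine Submodule.mem_span_singleton.2 ⟨c, ?_⟩
      rw [← mk_monomial]
      rfl
    · rw [DirectSum.decompose_of_mem_ne _ (monomial_mem P K m c) hm]
      exact Submodule.zero_mem _
  | add p q hp hq =>
    rw [map_add, DirectSum.decompose_add, DirectSum.add_apply, Submodule.coe_add]
    exact Submodule.add_mem _ hp hq

theorem exists_eq_smul_mono {g : CoordRing P K} {w : WeightLattice n} (hg : g ∈ weightSpace P K w)
    (h0 : g ≠ 0) : ∃ (hw : w ∈ weightMonoid P) (c : K), c ≠ 0 ∧ g = c • mono K ⟨w, hw⟩ := by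
  have hw : w ∈ weightMonoid P := by
    refine mem_weightMonoid_of_mem_weightSupport (g := g) ?_
    rw [mem_weightSupport, DirectSum.decompose_of_mem_same _ hg]
    exact h0
  have := decompose_mem_span_mono g ⟨w, hw⟩
  rw [DirectSum.decompose_of_mem_same _ hg] at this
  obtain ⟨c, hc⟩ := Submodule.mem_span_singleton.1 this
  refine ⟨hw, c, ?_, hc.symm⟩
  rintro rfl
  exact h0 (by rw [← hc, zero_smul])

theorem weightSupport_of_mem {g : CoordRing P K} {w : WeightLattice n}
    (hg : g ∈ weightSpace P K w) (h0 : g ≠ 0) : weightSupport g = {w} := by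
  ext w'
  rw [mem_weightSupport, Finset.mem_singleton]
  constructor
  · intro h
    by_contra hne
    exact h (DirectSum.decompose_of_mem_ne _ hg (Ne.symm hne))
  · rintro rfl
    rwa [DirectSum.decompose_of_mem_same _ hg]

theorem sum_weightSupport (g : CoordRing P K) :
    ∑ w ∈ weightSupport g, (DirectSum.decompose (weightSpace P K) g w : CoordRing P K) = g := by
  classical
  have := DirectSum.sum_support_decompose (weightSpace P K) g
  rw [weightSupport]
  convert this

theorem mem_span_mono (g : CoordRing P K) : g ∈ Submodule.span K (Set.range (mono K (P := P))) := by
  rw [← sum_weightSupport g]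
  refine Submodule.sum_mem _ fun w hw => ?_
  have := decompose_mem_span_mono g ⟨w, mem_weightMonoid_of_mem_weightSupport hw⟩
  exact Submodule.span_mono (by rintro _ rfl; exact ⟨_, rfl⟩) this

/-! ### The quasi-valuation on eigenfunctions -/

namespace SeshadriStratification

variable (S : SeshadriStratification P K) (t : Linearization P)

/-- The representation of a weight as an element of the ordered group `ℚ^A`. -/
def repVec (w : weightMonoid P) : RatVec t := S.rep w

/-- A maximal chain containing the support of `rep w` has `rep w` as its coordinates of w. Together
with `IsRep.le_eigenValue` this makes ν(g) the least `rep w` over the weights of g. -/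
theorem nu_le_repVec {g : CoordRing P K} (w : weightMonoid P) (hw : w.1 ∈ weightSupport g) :
    S.nu t g ≤ S.repVec t w := by
  obtain ⟨C, hC⟩ := (S.isRep_rep w).isChain.exists_subset_flag
  have := S.nu_le t (C := C) hw
  rwa [eigenValue, (S.isRep_rep w).coord_eq C hC] at this

theorem exists_nu_eq_repVec {g : CoordRing P K} (hg : g ≠ 0) :
    ∃ w : weightMonoid P, w.1 ∈ weightSupport g ∧ S.nu t g = S.repVec t w := by
  obtain ⟨C, w, hw, hC⟩ := S.exists_nu_eq t hg
  refine ⟨⟨w, mem_weightMonoid_of_mem_weightSupport hw⟩, hw,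
    le_antisymm (S.nu_le_repVec t _ hw) ?_⟩
  rw [hC]
  exact WithTop.coe_le_coe.2 ((S.isRep_rep _).le_eigenValue t C)

theorem nu_of_mem {g : CoordRing P K} {w : weightMonoid P} (hg : g ∈ weightSpace P K w)
    (h0 : g ≠ 0) : S.nu t g = S.repVec t w := by
  obtain ⟨w', hw', h⟩ := S.exists_nu_eq_repVec t h0
  rw [weightSupport_of_mem hg h0, Finset.mem_singleton] at hw'
  rw [h, Subtype.ext hw']

/-- Monomials realize every `rep w`. The linearization is absent from the right-hand side, whence
the independence of Γ. -/
theorem mem_Gam {a : Face P → ℚ} : a ∈ S.Gam t ↔ ∃ w : weightMonoid P, S.rep w = a := by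
  constructor
  · rintro ⟨g, hg, ha⟩
    obtain ⟨w, -, h⟩ := S.exists_nu_eq_repVec t hg
    exact ⟨w, WithTop.coe_injective (h.symm.trans ha)⟩
  · rintro ⟨w, rfl⟩
    exact ⟨mono K w, mono_ne_zero w, S.nu_of_mem t (mono_mem w) (mono_ne_zero w)⟩

/-- The bijection between weights and values. -/
def gamEquiv : weightMonoid P ≃ S.Gam t :=
  Equiv.ofBijective (fun w => ⟨S.rep w, (S.mem_Gam t).2 ⟨w, rfl⟩⟩)
    ⟨fun _ _ h => S.rep_injective (congrArg Subtype.val h), fun a => by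
      obtain ⟨w, hw⟩ := (S.mem_Gam t).1 a.2
      exact ⟨w, Subtype.ext hw⟩⟩

theorem gamEquiv_coe (w : weightMonoid P) : (S.gamEquiv t w).1 = S.rep w := rfl

theorem rep_symm (a : S.Gam t) : S.rep ((S.gamEquiv t).symm a) = a.1 :=
  congrArg Subtype.val ((S.gamEquiv t).apply_symm_apply a)

theorem rep_zero : S.rep 0 = 0 := by
  have h : InCommonCone (S.rep 0) (S.rep 0) := by
    rw [inCommonCone_iff (S.isRep_rep 0).nonneg (S.isRep_rep 0).nonneg]
    rw [← two_smul ℚ (S.rep 0), Function.support_const_smul_of_ne_zero _ _ two_ne_zero]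
    exact (S.isRep_rep 0).isChain
  have := (rep_add_iff 0 0).1 h
  rw [add_zero] at this
  exact left_eq_add.1 this

theorem rep_eq_zero_iff {w : weightMonoid P} : S.rep w = 0 ↔ w = 0 := by
  rw [← S.rep_injective.eq_iff, rep_zero]

theorem mem_geSub_mono (w : weightMonoid P) :
    mono K w ∈ (S.quasiValuation t).geSub (S.repVec t w) :=
  (S.nu_of_mem t (mono_mem w) (mono_ne_zero w)).ge

/-- The class of the eigenfunction of weight `w` in the associated graded algebra. -/
def grY (w : weightMonoid P) : S.GrAlg t :=
  DirectSum.of (S.quasiValuation t).Leaf (S.repVec t w)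
    ((S.quasiValuation t).leafMk _ ⟨mono K w, S.mem_geSub_mono t w⟩)

theorem toFun_mono (w : weightMonoid P) :
    (S.quasiValuation t).toFun (mono K w) = S.repVec t w :=
  S.nu_of_mem t (mono_mem w) (mono_ne_zero w)

theorem leafMk_mono_ne_zero (w : weightMonoid P) :
    (S.quasiValuation t).leafMk _ ⟨mono K w, S.mem_geSub_mono t w⟩ ≠ 0 := by
  rw [ne_eq, QuasiValuation.leafMk_eq_zero]
  exact fun h => ne_of_gt (show _ < (S.quasiValuation t).toFun _ from h) (S.toFun_mono t w)

theorem grY_mul (w w' : weightMonoid P) (h : InCommonCone (S.rep w) (S.rep w')) :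
    S.grY t w * S.grY t w' = S.grY t (w + w') := by
  rw [grY, grY, QuasiValuation.of_leafMk_mul]
  have h' : S.repVec t w + S.repVec t w' = S.repVec t (w + w') := ((rep_add_iff w w').1 h).symm
  exact QuasiValuation.of_leafMk_congr _ h' _ _ (mono_add w w').symm

/-- The product has value at least the sum of the values; equality would make `rep` additive on this
pair, so the inequality is strict. -/
theorem grY_mul_eq_zero (w w' : weightMonoid P) (h : ¬ InCommonCone (S.rep w) (S.rep w')) :
    S.grY t w * S.grY t w' = 0 := by
  rw [grY, grY, QuasiValuation.of_leafMk_mul, (QuasiValuation.leafMk_eq_zero _).2, map_zero]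
  refine (S.quasiValuation t).mem_gtSub_of_ne
    ((S.quasiValuation t).mul_mem_geSub (S.mem_geSub_mono t w) (S.mem_geSub_mono t w')) fun he => h ?_
  rw [rep_add_iff]
  dsimp only at he
  rw [← mono_add, toFun_mono] at he
  exact WithTop.coe_injective he

theorem grY_zero : S.grY t 0 = 1 :=
  QuasiValuation.of_leafMk_congr _ (show S.repVec t 0 = (0 : RatVec t) from S.rep_zero) _ ⟨1, QuasiValuation.one_mem_geSub _⟩ mono_zero

theorem symbol_smul_mono (w : weightMonoid P) {c : K} (hc : c ≠ 0) :
    (S.quasiValuation t).symbol (c • mono K w) = c • S.grY t w := by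
  have h0 : c • mono K w ≠ 0 := smul_ne_zero hc (mono_ne_zero w)
  rw [QuasiValuation.symbol, dif_neg h0, grY, ← QuasiValuation.of_leafMk_smul]
  refine QuasiValuation.of_leafMk_congr _ ?_ _ _ rfl
  rw [WithTop.untop_eq_iff]
  exact S.nu_of_mem t (Submodule.smul_mem _ c (mono_mem w)) h0

/-- By injectivity of `rep`, classes of different weights sit in different leaves, and none of them
is zero. -/
theorem linearIndependent_grY : LinearIndependent K (S.grY t) := by
  classical
  rw [linearIndependent_iff']
  intro s c hs w hw
  have h := DFunLike.congr_fun hs (S.repVec t w)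
  have h1 : ∀ w' ∈ s, (c w' • S.grY t w') (S.repVec t w)
      = if w' = w then c w • (S.quasiValuation t).leafMk _ ⟨mono K w, S.mem_geSub_mono t w⟩ else 0 := by
    intro w' _
    rw [DirectSum.smul_apply, grY]
    split_ifs with h
    · subst h
      rw [DirectSum.of_eq_same]
    · rw [DirectSum.of_eq_of_ne (S.repVec t w') (S.repVec t w) _ fun h' => h (S.rep_injective h'.symm), smul_zero]
  rw [DFinsupp.finsetSum_apply] at h
  have h2 := (Finset.sum_congr rfl h1).symm.trans h
  rw [Finset.sum_ite_eq' s w, if_pos hw] at h2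
  exact (smul_eq_zero.1 h2).resolve_right (S.leafMk_mono_ne_zero t w)

theorem of_leafMk_mem_span_grY {a : RatVec t} {g : CoordRing P K} {w : WeightLattice n}
    (hg : g ∈ weightSpace P K w) (hga : g ∈ (S.quasiValuation t).geSub a) :
    DirectSum.of (S.quasiValuation t).Leaf a ((S.quasiValuation t).leafMk a ⟨g, hga⟩)
      ∈ Submodule.span K (Set.range (S.grY t)) := by
  by_cases hgt : g ∈ (S.quasiValuation t).gtSub a
  · rw [(QuasiValuation.leafMk_eq_zero _).2 hgt, map_zero]
    exact Submodule.zero_mem _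
  · have h0 : g ≠ 0 := by
      rintro rfl
      exact hgt (Submodule.zero_mem _)
    obtain ⟨hw, c, hc, rfl⟩ := exists_eq_smul_mono hg h0
    have ha : a = S.repVec t ⟨w, hw⟩ := by
      by_contra hne
      refine hgt (QuasiValuation.mem_gtSub_of_ne _ hga ?_)
      rw [QuasiValuation.smul _ _ _ hc, toFun_mono]
      exact fun h => hne (WithTop.coe_injective h).symm
    rw [QuasiValuation.of_leafMk_congr _ ha _ (c • ⟨mono K ⟨w, hw⟩, S.mem_geSub_mono t _⟩) rfl,
      QuasiValuation.of_leafMk_smul]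
    exact Submodule.smul_mem _ _ (Submodule.subset_span ⟨_, rfl⟩)

theorem decompose_mem_geSub {a : RatVec t} {g : CoordRing P K}
    (hg : g ∈ (S.quasiValuation t).geSub a) (w : WeightLattice n) :
    (DirectSum.decompose (weightSpace P K) g w : CoordRing P K) ∈ (S.quasiValuation t).geSub a := by
  by_cases h0 : (DirectSum.decompose (weightSpace P K) g w : CoordRing P K) = 0
  · rw [h0]
    exact Submodule.zero_mem _
  · have hws : w ∈ weightSupport g := mem_weightSupport.2 h0
    have hnu := S.nu_of_mem t (w := ⟨w, mem_weightMonoid_of_mem_weightSupport hws⟩)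
      (SetLike.coe_mem _) h0
    change (a : WithTop (RatVec t)) ≤ S.nu t _
    rw [hnu]
    exact le_trans hg (S.nu_le_repVec t _ hws)

/-- The eigencomponents of a function stay in `geSub a`, so a class in a leaf is a sum of classes of
eigenfunctions, each zero or a multiple of some `grY`. -/
theorem span_grY : Submodule.span K (Set.range (S.grY t)) = ⊤ := by
  classical
  rw [eq_top_iff]
  rintro x -
  induction x using DirectSum.induction_on with
  | zero => exact Submodule.zero_mem _
  | add x y hx hy => exact Submodule.add_mem _ hx hy
  | of a x =>
    obtain ⟨⟨g, hg⟩, rfl⟩ := (S.quasiValuation t).leafMk_surjective a x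
    have hgy : (⟨g, hg⟩ : (S.quasiValuation t).geSub a)
        = ∑ w ∈ weightSupport g, ⟨_, S.decompose_mem_geSub t hg w⟩ := by
      refine Subtype.ext ?_
      rw [AddSubmonoidClass.coe_finsetSum]
      exact (sum_weightSupport g).symm
    rw [hgy, QuasiValuation.of_leafMk_sum]
    exact Submodule.sum_mem _ fun w _ => S.of_leafMk_mem_span_grY t (SetLike.coe_mem _) _

/-! ### The fan algebra of a stratification -/

/-- The generator of the fan algebra with index the value of the eigenfunction of weight `w`. -/
def fanW (w : weightMonoid P) : S.FanAlg t := fanY K (S.gamEquiv t w)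

theorem fanY_eq_fanW (a : S.Gam t) : fanY K a = S.fanW t ((S.gamEquiv t).symm a) := by
  rw [fanW, Equiv.apply_symm_apply]

theorem fanW_mul {w w' : weightMonoid P} (h : InCommonCone (S.rep w) (S.rep w')) :
    S.fanW t w * S.fanW t w' = S.fanW t (w + w') :=
  fanY_mul h ((rep_add_iff w w').1 h)

theorem fanW_zero : S.fanW t 0 = 1 := fanY_zero S.rep_zero

/-- The universal property of the fan algebra, in terms of weights. -/
def fanWLift {B : Type*} [CommRing B] [Algebra K B] (f : weightMonoid P → B)
    (hmul : ∀ w w', InCommonCone (S.rep w) (S.rep w') → f w * f w' = f (w + w'))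
    (hzero : ∀ w w', ¬ InCommonCone (S.rep w) (S.rep w') → f w * f w' = 0)
    (hone : f 0 = 1) : S.FanAlg t →ₐ[K] B :=
  fanLift (fun a => f ((S.gamEquiv t).symm a))
    (fun a b c h hc => by
      rw [← S.rep_symm t a, ← S.rep_symm t b] at h
      rw [hmul _ _ h]
      congr 1
      refine S.rep_injective ?_
      rw [(rep_add_iff _ _).1 h, rep_symm, rep_symm, rep_symm, hc])
    (fun a b h => by
      rw [← S.rep_symm t a, ← S.rep_symm t b] at h
      exact hzero _ _ h)
    (fun c hc => by
      rw [← S.rep_symm t c, rep_eq_zero_iff] at hc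
      rw [hc, hone])

theorem fanWLift_fanW {B : Type*} [CommRing B] [Algebra K B] (f : weightMonoid P → B)
    (hmul : ∀ w w', InCommonCone (S.rep w) (S.rep w') → f w * f w' = f (w + w'))
    (hzero : ∀ w w', ¬ InCommonCone (S.rep w) (S.rep w') → f w * f w' = 0)
    (hone : f 0 = 1) (w : weightMonoid P) :
    S.fanWLift t f hmul hzero hone (S.fanW t w) = f w := by
  rw [fanW, fanWLift, fanLift_fanY, Equiv.symm_apply_apply]

theorem span_fanW : Submodule.span K (Set.range (S.fanW t)) = ⊤ := by
  have : Set.range (S.fanW t) = Set.range (fanY K : S.Gam t → S.FanAlg t) :=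
    (S.gamEquiv t).surjective.range_comp (fanY K : S.Gam t → S.FanAlg t)
  rw [this]
  refine span_fanY ((S.mem_Gam t).2 ⟨0, S.rep_zero⟩) fun a b h => (S.mem_Gam t).2 ?_
  rw [← S.rep_symm t a, ← S.rep_symm t b] at h
  refine ⟨_, (rep_add_iff _ _).1 h |>.trans ?_⟩
  rw [rep_symm, rep_symm]

/-- The homomorphism from the fan algebra to the associated graded algebra. -/
def fanToGr : S.FanAlg t →ₐ[K] S.GrAlg t :=
  S.fanWLift t (S.grY t) (S.grY_mul t) (S.grY_mul_eq_zero t) (S.grY_zero t)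

theorem fanToGr_fanW (w : weightMonoid P) : S.fanToGr t (S.fanW t w) = S.grY t w :=
  S.fanWLift_fanW t _ _ _ _ w

/-- Independence is read off from the images in the associated graded algebra, which avoids a
normal-form argument in the presentation. -/
theorem linearIndependent_fanW : LinearIndependent K (S.fanW t) := by
  refine LinearIndependent.of_comp (S.fanToGr t).toLinearMap ?_
  have h : ⇑(S.fanToGr t).toLinearMap ∘ S.fanW t = S.grY t := funext (S.fanToGr_fanW t)
  rw [h]
  exact S.linearIndependent_grY t

/-- The basis `(y_a)` of the fan algebra. -/
def fanBasis : Module.Basis (weightMonoid P) K (S.FanAlg t) :=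
  Module.Basis.mk (S.linearIndependent_fanW t) (S.span_fanW t).ge

theorem fanBasis_apply (w : weightMonoid P) : S.fanBasis t w = S.fanW t w :=
  Module.Basis.mk_apply _ _ w

/-- The basis of the associated graded algebra by classes of eigenfunctions. -/
def grBasis : Module.Basis (weightMonoid P) K (S.GrAlg t) :=
  Module.Basis.mk (S.linearIndependent_grY t) (S.span_grY t).ge

theorem fanToGr_bijective : Function.Bijective (S.fanToGr t) := by
  have : (S.fanToGr t).toLinearMap = ((S.fanBasis t).equiv (S.grBasis t) (Equiv.refl _)).toLinearMap := by
    refine (S.fanBasis t).ext fun w => ?_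
    rw [LinearEquiv.coe_coe, Module.Basis.equiv_apply, fanBasis_apply, grBasis,
      Module.Basis.mk_apply]
    exact S.fanToGr_fanW t w
  have h2 : ⇑(S.fanToGr t) = ((S.fanBasis t).equiv (S.grBasis t) (Equiv.refl _)) :=
    congrArg (fun f : S.FanAlg t →ₗ[K] S.GrAlg t => (f : S.FanAlg t → S.GrAlg t)) this
  rw [h2]
  exact LinearEquiv.bijective _

/-- The fan algebra is isomorphic to the associated graded algebra. -/
def fanEquivGr : S.FanAlg t ≃ₐ[K] S.GrAlg t := AlgEquiv.ofBijective _ (S.fanToGr_bijective t)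

theorem fanEquivGr_fanW (w : weightMonoid P) : S.fanEquivGr t (S.fanW t w) = S.grY t w :=
  S.fanToGr_fanW t w

theorem fanEquivGr_fanY_mem (a : S.Gam t) :
    S.fanEquivGr t (fanY K a) ∈ (S.quasiValuation t).leafSub a.1 := by
  have key : ∀ (w : weightMonoid P) (b : RatVec t), S.repVec t w = b →
      S.grY t w ∈ (S.quasiValuation t).leafSub b := by
    rintro w _ rfl
    exact ⟨_, rfl⟩
  rw [fanY_eq_fanW, fanEquivGr_fanW]
  exact key _ _ (S.rep_symm t a)

theorem Gam_eq (t' : Linearization P) : S.Gam t' = S.Gam t := by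
  ext a
  rw [mem_Gam, mem_Gam]

variable {S} {S' : SeshadriStratification P K}

/-- One-element chains recover the marked points, so the weights μ_σ of both stratifications are
proportional with the ratio of degrees; rescaling turns one representation into the other. -/
theorem rep_apply_of_simplex_eq
    (h : ∀ C : Set (Face P), IsChain (· ≤ ·) C → S.simplex C = S'.simplex C)
    (w : weightMonoid P) (σ : Face P) : S'.rep w σ = S.rep w σ * (S.deg σ / S'.deg σ) := by
  have hd : ∀ σ, (0 : ℚ) < S.deg σ := fun σ => by exact_mod_cast S.deg_pos σ
  have hd' : ∀ σ, (0 : ℚ) < S'.deg σ := fun σ => by exact_mod_cast S'.deg_pos σ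
  have hmark : ∀ σ, S.markedPoint σ = S'.markedPoint σ := by
    intro σ
    have := h {σ} (Set.subsingleton_singleton.isChain)
    simpa [simplex] using this
  have hmu : ∀ σ, ((S.deg σ : ℚ) / S'.deg σ) • toRat (S'.mu σ) = toRat (S.mu σ) := by
    intro σ
    have h1 := (hd σ).ne'
    have h2 := (hd' σ).ne'
    refine Prod.ext ?_ (funext fun i => ?_)
    · simp only [toRat, mu, Prod.smul_fst, smul_eq_mul]
      push_cast
      field_simp
    · have h3 := congrFun (hmark σ) i
      simp only [markedPoint] at h3
      have h4 : -(S.wt σ i : ℚ) / S.deg σ = -(S'.wt σ i : ℚ) / S'.deg σ := by exact_mod_cast h3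
      simp only [toRat, mu, Prod.smul_snd, Pi.smul_apply, smul_eq_mul]
      field_simp at h4 ⊢
      linarith
  have hrep : S'.IsRep (fun σ => S.rep w σ * (S.deg σ / S'.deg σ)) w := by
    refine ⟨fun σ => mul_nonneg ((S.isRep_rep w).nonneg σ) (div_pos (hd σ) (hd' σ)).le,
      (S.isRep_rep w).isChain.mono (Function.support_mul_subset_left _ _), ?_⟩
    simp only [mul_smul, hmu]
    exact (S.isRep_rep w).sum_eq
  exact congrFun ((S'.isRep_rep w).eq hrep) σ

theorem inCommonCone_rep_iff_of_simplex_eq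
    (h : ∀ C : Set (Face P), IsChain (· ≤ ·) C → S.simplex C = S'.simplex C)
    (w w' : weightMonoid P) :
    InCommonCone (S.rep w) (S.rep w') ↔ InCommonCone (S'.rep w) (S'.rep w') := by
  rw [inCommonCone_iff (S.isRep_rep w).nonneg (S.isRep_rep w').nonneg,
    inCommonCone_iff (S'.isRep_rep w).nonneg (S'.isRep_rep w').nonneg]
  have : Function.support (S.rep w + S.rep w') = Function.support (S'.rep w + S'.rep w') := by
    ext σ
    have hd : (S.deg σ : ℚ) / S'.deg σ ≠ 0 := by
      have h1 := S.deg_pos σ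
      have h2 := S'.deg_pos σ
      have h3 : (0 : ℚ) < S.deg σ := by exact_mod_cast h1
      have h4 : (0 : ℚ) < S'.deg σ := by exact_mod_cast h2
      exact (div_pos h3 h4).ne'
    simp only [Function.mem_support, Pi.add_apply, rep_apply_of_simplex_eq h, ← add_mul]
    simp [hd]
  rw [this]

/-- Matching elements of the two Γ by weight respects common cones, sums and zero, since supports of
representations agree. Eigenfunctions are multiples of monomials, so following the basis elements
suffices. -/
theorem exists_grEquiv (t t' : Linearization P)
    (h : ∀ C : Set (Face P), IsChain (· ≤ ·) C → S.simplex C = S'.simplex C) :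
    ∃ ψ : S.GrAlg t ≃ₐ[K] S'.GrAlg t', ∀ (w : WeightLattice n), ∀ g ∈ weightSpace P K w,
      ψ ((S.quasiValuation t).symbol g) = (S'.quasiValuation t').symbol g := by
  have hcone := inCommonCone_rep_iff_of_simplex_eq h
  let e : S.Gam t ≃ S'.Gam t' := (S.gamEquiv t).symm.trans (S'.gamEquiv t')
  have he : ∀ w, e (S.gamEquiv t w) = S'.gamEquiv t' w := fun w => by simp [e]
  let F : S.FanAlg t ≃ₐ[K] S'.FanAlg t' := fanCongr e
    (by
      intro a b
      obtain ⟨w, rfl⟩ := (S.gamEquiv t).surjective a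
      obtain ⟨w', rfl⟩ := (S.gamEquiv t).surjective b
      rw [he, he]
      exact hcone w w')
    (by
      intro a b c hab
      obtain ⟨w, rfl⟩ := (S.gamEquiv t).surjective a
      obtain ⟨w', rfl⟩ := (S.gamEquiv t).surjective b
      obtain ⟨w'', rfl⟩ := (S.gamEquiv t).surjective c
      rw [he, he, he]
      simp only [gamEquiv_coe] at hab ⊢
      rw [← (rep_add_iff w w').1 hab, ← (rep_add_iff w w').1 ((hcone w w').1 hab),
        S.rep_injective.eq_iff, S'.rep_injective.eq_iff])
    (by
      intro c
      obtain ⟨w, rfl⟩ := (S.gamEquiv t).surjective c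
      rw [he]
      simp only [gamEquiv_coe, rep_eq_zero_iff])
  have hF : ∀ w, F (S.fanW t w) = S'.fanW t' w := fun w => by
    rw [fanW, fanW, ← he]
    exact fanCongr_fanY _ _ _ _ _
  refine ⟨((S.fanEquivGr t).symm.trans F).trans (S'.fanEquivGr t'), fun w g hg => ?_⟩
  by_cases h0 : g = 0
  · subst h0
    rw [QuasiValuation.symbol, QuasiValuation.symbol, dif_pos rfl, dif_pos rfl, map_zero]
  · obtain ⟨hw, c, hc, rfl⟩ := exists_eq_smul_mono hg h0
    rw [symbol_smul_mono _ _ _ hc, symbol_smul_mono _ _ _ hc, map_smul, AlgEquiv.trans_apply,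
      AlgEquiv.trans_apply, ← fanEquivGr_fanW, AlgEquiv.symm_apply_apply, hF, fanEquivGr_fanW]

end SeshadriStratification

end FanDegeneration

end

noncomputable section

namespace FanDegeneration

open scoped DirectSum Pointwise

/-! ### The algebras of maximal chains -/

variable {n : ℕ} {P : NormalLatticePolytope n} {K : Type*} [Field K]

namespace SeshadriStratification

variable {S : SeshadriStratification P K}

theorem isRep_single (σ : Face P) : S.IsRep (Pi.single σ 1) (S.mu σ) := by
  classical
  refine ⟨fun τ => ?_, ?_, ?_⟩
  · rw [Pi.single_apply]
    split_ifs <;> norm_num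
  · refine Set.Subsingleton.isChain fun a ha b hb => ?_
    have h : ∀ c ∈ Function.support (Pi.single σ (1 : ℚ)), c = σ := fun c hc => by
      by_contra hne
      exact hc (Pi.single_eq_of_ne hne _)
    rw [h a ha, h b hb]
  · rw [Finset.sum_eq_single σ]
    · rw [Pi.single_eq_same, one_smul]
    · intro τ _ h
      rw [Pi.single_eq_of_ne h, zero_smul]
    · exact fun h => absurd (Finset.mem_univ _) h

/-- Coordinates in [0, 1] confine the weight to a box, which contains only finitely many lattice
points. -/
theorem IsRep.mem_Icc {a : Face P → ℚ} {w : WeightLattice n} (h : S.IsRep a w)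
    (h1 : ∀ σ, a σ ≤ 1) :
    w ∈ Set.Icc (-(∑ σ, |(S.mu σ).1|), fun i => -∑ σ, |(S.mu σ).2 i|)
      (∑ σ, |(S.mu σ).1|, fun i => ∑ σ, |(S.mu σ).2 i|) := by
  have key : ∀ (x : Face P → ℤ) (y : ℤ), ∑ σ, a σ * (x σ : ℚ) = y → |y| ≤ ∑ σ, |x σ| := by
    intro x y hxy
    have : |(y : ℚ)| ≤ ∑ σ, |(x σ : ℚ)| := by
      rw [← hxy]
      refine (Finset.abs_sum_le_sum_abs _ _).trans (Finset.sum_le_sum fun σ _ => ?_)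
      rw [abs_mul, abs_of_nonneg (h.nonneg σ)]
      exact mul_le_of_le_one_left (abs_nonneg _) (h1 σ)
    exact_mod_cast this
  have hs := h.sum_eq
  rw [Prod.ext_iff, Prod.fst_sum, Prod.snd_sum, funext_iff] at hs
  have h2 := abs_le.1 (key (fun σ => (S.mu σ).1) w.1 hs.1)
  have h3 := fun i => abs_le.1 (key (fun σ => (S.mu σ).2 i) (w.2 i) (by
    have := hs.2 i
    rwa [Finset.sum_apply] at this))
  exact ⟨⟨h2.1, fun i => (h3 i).1⟩, ⟨h2.2, fun i => (h3 i).2⟩⟩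

variable (S) in
theorem finite_rep_le_one : {w : weightMonoid P | ∀ σ, S.rep w σ ≤ 1}.Finite := by
  classical
  exact ((Set.finite_Icc _ _).preimage Subtype.val_injective.injOn).subset
    fun w hw => (S.isRep_rep w).mem_Icc hw

theorem IsRep.sum_deg {a : Face P → ℚ} {w : WeightLattice n} (h : S.IsRep a w) :
    ∑ σ, a σ * S.deg σ = -w.1 := by
  have := congrArg Prod.fst h.sum_eq
  rw [Prod.fst_sum] at this
  simp only [toRat, mu, Prod.smul_fst, smul_eq_mul] at this
  rw [← this, ← Finset.sum_neg_distrib]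
  exact Finset.sum_congr rfl fun σ _ => by push_cast; ring

theorem IsRep.fst_nonpos {a : Face P → ℚ} {w : WeightLattice n} (h : S.IsRep a w) : w.1 ≤ 0 := by
  have h1 : (0 : ℚ) ≤ -w.1 := by
    rw [← h.sum_deg]
    exact Finset.sum_nonneg fun σ _ => mul_nonneg (h.nonneg σ) (Nat.cast_nonneg _)
  have : (0 : ℤ) ≤ -w.1 := by exact_mod_cast h1
  omega

/-- Coordinate functions have degree one and all deg f_σ ≥ 1, so the coordinates of their weights
are at most 1 and `finite_rep_le_one` applies. -/
theorem finite_Lambda (S : SeshadriStratification P K) : Finite (Lambda P) := by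
  have hmem : ∀ χ : Lambda P, -((1 : ℤ), χ.1) ∈ weightMonoid P := fun χ =>
    mem_weightMonoid.2 ⟨Finsupp.single χ 1, by rw [monWeight_single, one_smul]⟩
  have : Set.Finite (Set.range fun χ : Lambda P => (⟨_, hmem χ⟩ : weightMonoid P)) := by
    refine S.finite_rep_le_one.subset ?_
    rintro _ ⟨χ, rfl⟩ σ
    have h := S.isRep_rep ⟨_, hmem χ⟩
    have h1 := h.sum_deg
    have h2 : S.rep ⟨_, hmem χ⟩ σ * S.deg σ ≤ 1 := by
      refine (Finset.single_le_sum (f := fun τ => S.rep ⟨_, hmem χ⟩ τ * (S.deg τ : ℚ))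
        (fun τ _ => mul_nonneg (h.nonneg τ) (Nat.cast_nonneg _)) (Finset.mem_univ σ)).trans ?_
      rw [h1]
      simp
    have h3 : (1 : ℚ) ≤ S.deg σ := by exact_mod_cast S.deg_pos σ
    exact (le_mul_of_one_le_right (h.nonneg σ) h3).trans h2
  refine Set.finite_range_iff ?_ |>.1 this
  intro χ χ' h
  have h1 := congrArg (fun w : weightMonoid P => w.1.2) h
  exact Subtype.ext (neg_injective h1)

theorem IsRep.sub_single {a : Face P → ℚ} {w : WeightLattice n} (h : S.IsRep a w) {σ : Face P}
    (hσ : 1 ≤ a σ) : S.IsRep (a - Pi.single σ 1) (w - S.mu σ) := by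
  have hle : ∀ τ, Pi.single (M := fun _ => ℚ) σ 1 τ ≤ a τ := fun τ => by
    by_cases hτ : τ = σ
    · subst hτ
      rwa [Pi.single_eq_same]
    · rw [Pi.single_eq_of_ne hτ]
      exact h.nonneg τ
  have hsub : Function.support (a - Pi.single σ (1 : ℚ)) ⊆ Function.support a := by
    intro τ hτ h0
    refine hτ (le_antisymm ?_ (sub_nonneg.2 (hle τ)))
    rw [Pi.sub_apply, h0, zero_sub, neg_nonpos]
    exact (isRep_single (S := S) σ).nonneg τ
  refine ⟨fun τ => sub_nonneg.2 (hle τ), h.isChain.mono hsub, ?_⟩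
  have h1 : toRat w = toRat (w - S.mu σ) + toRat (S.mu σ) := by
    rw [← toRat_add, sub_add_cancel]
  rw [← add_left_inj (toRat (S.mu σ)), ← h1, ← h.sum_eq, ← (isRep_single σ).sum_eq,
    ← Finset.sum_add_distrib]
  refine Finset.sum_congr rfl fun τ _ => ?_
  rw [Pi.sub_apply, sub_smul, sub_add_cancel]

variable (S) in
theorem support_rep_add {w w' : weightMonoid P} (h : InCommonCone (S.rep w) (S.rep w')) :
    Function.support (S.rep (w + w')) = Function.support (S.rep w) ∪ Function.support (S.rep w') := by
  ext σ
  rw [(rep_add_iff w w').1 h, Set.mem_union, Function.mem_support, Function.mem_support,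
    Function.mem_support, Pi.add_apply, ne_eq, add_eq_zero_iff_of_nonneg ((S.isRep_rep w).nonneg σ)
    ((S.isRep_rep w').nonneg σ), not_and_or]

variable [CharZero K] (S) (t : Linearization P)

theorem mem_GamChain {C : Set (Face P)} {a : Face P → ℚ} :
    a ∈ S.GamChain t C ↔ (∃ w, S.IsRep a w) ∧ Function.support a ⊆ C := by
  refine and_congr ((S.mem_Gam t).trans ⟨?_, ?_⟩) Iff.rfl
  · rintro ⟨w, rfl⟩
    exact ⟨w, S.isRep_rep w⟩
  · rintro ⟨w, h⟩
    exact ⟨⟨w, h.mem_weightMonoid⟩, (S.isRep_rep _).eq h⟩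

theorem inCommonCone_of_mem {C : Flag (Face P)} {a b : Face P → ℚ} (ha : a ∈ S.GamChain t C)
    (hb : b ∈ S.GamChain t C) : InCommonCone a b := by
  obtain ⟨⟨w, h⟩, hC⟩ := (S.mem_GamChain t).1 ha
  obtain ⟨⟨w', h'⟩, hC'⟩ := (S.mem_GamChain t).1 hb
  exact ⟨C, C.maxChain.1, ⟨h.nonneg, fun σ hσ => by_contra fun h => hσ (hC h)⟩,
    ⟨h'.nonneg, fun σ hσ => by_contra fun h => hσ (hC' h)⟩⟩

/-- The monoid `Γ_C` of a maximal chain `C`. -/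
def chainMonoid (C : Flag (Face P)) : AddSubmonoid (Face P → ℚ) where
  carrier := S.GamChain t C
  zero_mem' := ⟨(S.mem_Gam t).2 ⟨0, S.rep_zero⟩, by simp⟩
  add_mem' {a b} ha hb := by
    have hc := S.inCommonCone_of_mem t ha hb
    obtain ⟨⟨w, h⟩, hC⟩ := (S.mem_GamChain t).1 ha
    obtain ⟨⟨w', h'⟩, hC'⟩ := (S.mem_GamChain t).1 hb
    exact (S.mem_GamChain t).2 ⟨⟨w + w', (h.inCommonCone_iff h').1 hc⟩,
      (Function.support_add a b).trans (Set.union_subset hC hC')⟩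

/-- A form of Gordan's lemma: subtracting e_σ while a coordinate exceeds 1 lowers the degree by deg
f_σ ≥ 1, so the finitely many elements with coordinates at most 1 generate. -/
theorem chainMonoid_fg (C : Flag (Face P)) : (S.chainMonoid t C).FG := by
  set F : Set (Face P → ℚ) := {a | a ∈ S.GamChain t C ∧ ∀ σ, a σ ≤ 1}
  have hF : F.Finite := by
    refine (S.finite_rep_le_one.image S.rep).subset ?_
    rintro a ⟨ha, h1⟩
    obtain ⟨w, rfl⟩ := (S.mem_Gam t).1 ha.1
    exact ⟨w, h1, rfl⟩
  have hsingle : ∀ σ ∈ C, Pi.single σ (1 : ℚ) ∈ F := by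
    intro σ hσ
    refine ⟨(S.mem_GamChain t).2 ⟨⟨_, isRep_single σ⟩, ?_⟩, fun τ => ?_⟩
    · exact Pi.support_single_subset.trans (Set.singleton_subset_iff.2 hσ)
    · rw [Pi.single_apply]
      split_ifs <;> norm_num
  have key : ∀ (d : ℕ) (a : Face P → ℚ) (w : WeightLattice n), S.IsRep a w →
      Function.support a ⊆ (C : Set (Face P)) → -w.1 ≤ d → a ∈ AddSubmonoid.closure F := by
    intro d
    induction d with
    | zero =>
      intro a w h hC hd
      refine AddSubmonoid.subset_closure ⟨(S.mem_GamChain t).2 ⟨⟨w, h⟩, hC⟩, fun σ => ?_⟩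
      -- Removing e_σ here would produce a representation of negative degree.
      by_contra hσ
      have h1 := (h.sub_single (not_le.1 hσ).le).fst_nonpos
      have h2 := S.deg_pos σ
      simp only [mu, Prod.fst_sub] at h1
      push_cast at hd
      omega
    | succ d ih =>
      intro a w h hC hd
      by_cases ha : ∀ σ, a σ ≤ 1
      · exact AddSubmonoid.subset_closure ⟨(S.mem_GamChain t).2 ⟨⟨w, h⟩, hC⟩, ha⟩
      · push Not at ha
        obtain ⟨σ, hσ⟩ := ha
        have hσC : σ ∈ C := hC (fun h0 : a σ = 0 => by rw [h0] at hσ; norm_num at hσ)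
        have h1 := h.sub_single hσ.le
        rw [← sub_add_cancel a (Pi.single σ 1)]
        refine add_mem (ih _ _ h1 ?_ ?_) (AddSubmonoid.subset_closure (hsingle σ hσC))
        · exact (Function.support_sub _ _).trans (Set.union_subset hC (hsingle σ hσC).1.2)
        · have h2 := S.deg_pos σ
          simp only [mu, Prod.fst_sub]
          push_cast at hd
          omega
  refine (AddSubmonoid.fg_iff _).2 ⟨F, le_antisymm ?_ ?_, hF⟩
  · exact AddSubmonoid.closure_le.2 fun a ha => ha.1
  · intro a ha
    obtain ⟨⟨w, h⟩, hC⟩ := (S.mem_GamChain t).1 ha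
    exact key _ a w h hC (Int.self_le_toNat _)

theorem linearIndependent_fanY : LinearIndependent K (fun a : S.Gam t => (fanY K a : S.FanAlg t)) := by
  have := (S.linearIndependent_fanW t).comp (S.gamEquiv t).symm (S.gamEquiv t).symm.injective
  have h : S.fanW t ∘ (S.gamEquiv t).symm = fun a : S.Gam t => (fanY K a : S.FanAlg t) :=
    funext fun a => (S.fanY_eq_fanW t a).symm
  rwa [h] at this

variable (C : Flag (Face P))

/-- The generator `y_a` of `K[Γ_C]`. -/
def chainY (a : S.chainMonoid t C) : S.ChainAlg t C :=
  ⟨fanY K ⟨a.1, a.2.1⟩, Algebra.subset_adjoin ⟨⟨a.1, a.2.1⟩, a.2, rfl⟩⟩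

theorem chainY_add (a b : S.chainMonoid t C) :
    S.chainY t C (a + b) = S.chainY t C a * S.chainY t C b := by
  refine Subtype.ext (Eq.symm ?_)
  exact fanY_mul (a := (⟨a.1, a.2.1⟩ : S.Gam t)) (b := ⟨b.1, b.2.1⟩)
    (c := ⟨(a + b).1, (a + b).2.1⟩) (S.inCommonCone_of_mem t a.2 b.2) rfl

/-- The homomorphism from the semigroup algebra of `Γ_C`. -/
def chainLift : AddMonoidAlgebra K (S.chainMonoid t C) →ₐ[K] S.ChainAlg t C :=
  AddMonoidAlgebra.lift K (S.ChainAlg t C) (S.chainMonoid t C)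
    { toFun := fun a => S.chainY t C a.toAdd
      map_one' := Subtype.ext (fanY_zero rfl)
      map_mul' := fun a b => S.chainY_add t C a.toAdd b.toAdd }

theorem chainLift_single (a : S.chainMonoid t C) (c : K) :
    S.chainLift t C (AddMonoidAlgebra.single a c) = c • S.chainY t C a := by
  rw [chainLift, AddMonoidAlgebra.lift_single]
  rfl

theorem chainLift_bijective : Function.Bijective (S.chainLift t C) := by
  constructor
  · have hli : LinearIndependent K (S.chainY t C) := by
      refine LinearIndependent.of_comp (Subalgebra.val (S.ChainAlg t C)).toLinearMap ?_
      exact (S.linearIndependent_fanY t).comp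
        (fun a : S.chainMonoid t C => (⟨a.1, a.2.1⟩ : S.Gam t))
        fun a b h => Subtype.ext (congrArg (fun x : S.Gam t => x.1) h)
    intro x y h
    rw [chainLift, AddMonoidAlgebra.lift_apply, AddMonoidAlgebra.lift_apply] at h
    have := hli (a₁ := x.coeff) (a₂ := y.coeff) h
    exact AddMonoidAlgebra.coeff_injective this
  · have h : S.ChainAlg t C ≤ ((S.ChainAlg t C).val.comp (S.chainLift t C)).range := by
      refine Algebra.adjoin_le ?_
      rintro _ ⟨a, ha, rfl⟩
      refine ⟨AddMonoidAlgebra.single ⟨a.1, ha⟩ 1, ?_⟩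
      change ((S.chainLift t C _ : S.ChainAlg t C) : S.FanAlg t) = _
      rw [chainLift_single, one_smul]
      rfl
    rintro ⟨x, hx⟩
    obtain ⟨y, hy⟩ := h hx
    exact ⟨y, Subtype.ext hy⟩

/-- `K[Γ_C]` is the semigroup algebra of `Γ_C`. -/
def chainEquiv : AddMonoidAlgebra K (S.chainMonoid t C) ≃ₐ[K] S.ChainAlg t C :=
  AlgEquiv.ofBijective _ (S.chainLift_bijective t C)

theorem chainEquiv_single (a : S.Gam t) (ha : a.1 ∈ S.chainMonoid t C) :
    (S.chainEquiv t C (AddMonoidAlgebra.single ⟨a.1, ha⟩ 1) : S.FanAlg t) = fanY K a := by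
  have := S.chainLift_single t C ⟨a.1, ha⟩ 1
  rw [one_smul] at this
  exact congrArg Subtype.val this

/-- Submonoids of a rational vector space have two unique sums, which excludes zero divisors in the
semigroup algebra. -/
instance : IsDomain (S.ChainAlg t C) := by
  have : TwoUniqueSums (S.chainMonoid t C) :=
    TwoUniqueSums.of_injective_addHom (S.chainMonoid t C).subtype.toAddHom Subtype.val_injective
      inferInstance
  have : IsDomain (AddMonoidAlgebra K (S.chainMonoid t C)) := NoZeroDivisors.to_isDomain _
  exact (S.chainEquiv t C).symm.toMulEquiv.isDomain _

instance : Algebra.FiniteType K (S.ChainAlg t C) := by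
  have : AddMonoid.FG (S.chainMonoid t C) :=
    (AddMonoid.fg_iff_addSubmonoid_fg _).2 (S.chainMonoid_fg t C)
  exact Algebra.FiniteType.equiv inferInstance (S.chainEquiv t C)

/-! ### Projections to the chain algebras -/

open Classical in
/-- The image of a generator under the projection to `K[Γ_C]`. -/
def chainProjW (w : weightMonoid P) : S.ChainAlg t C :=
  if h : Function.support (S.rep w) ⊆ C then
    S.chainY t C ⟨S.rep w, (S.mem_Gam t).2 ⟨w, rfl⟩, h⟩ else 0

theorem chainProjW_of_subset {w : weightMonoid P} (h : Function.support (S.rep w) ⊆ C) :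
    (S.chainProjW t C w : S.FanAlg t) = S.fanW t w := by
  rw [chainProjW, dif_pos h]
  rfl

theorem chainProjW_of_not_subset {w : weightMonoid P} (h : ¬ Function.support (S.rep w) ⊆ C) :
    S.chainProjW t C w = 0 := by
  rw [chainProjW, dif_neg h]

/-- The projection `K[Γ] → K[Γ_C]`. -/
def chainProj : S.FanAlg t →ₐ[K] S.ChainAlg t C :=
  S.fanWLift t (S.chainProjW t C)
    (fun w w' h => by
      by_cases h1 : Function.support (S.rep w) ⊆ C
      · by_cases h2 : Function.support (S.rep w') ⊆ C
        · refine Subtype.ext ?_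
          change (S.chainProjW t C w : S.FanAlg t) * (S.chainProjW t C w' : S.FanAlg t) = _
          rw [chainProjW_of_subset _ _ _ h1, chainProjW_of_subset _ _ _ h2,
            chainProjW_of_subset _ _ _ (by rw [S.support_rep_add h]; exact Set.union_subset h1 h2),
            fanW_mul _ _ h]
        · rw [chainProjW_of_not_subset _ _ _ h2, mul_zero, chainProjW_of_not_subset]
          rw [S.support_rep_add h]
          exact fun h => h2 (Set.subset_union_right.trans h)
      · rw [chainProjW_of_not_subset _ _ _ h1, zero_mul, chainProjW_of_not_subset]
        rw [S.support_rep_add h]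
        exact fun h => h1 (Set.subset_union_left.trans h))
    (fun w w' h => by
      by_cases h1 : Function.support (S.rep w) ⊆ C
      · by_cases h2 : Function.support (S.rep w') ⊆ C
        · exact absurd (S.inCommonCone_of_mem t ⟨(S.mem_Gam t).2 ⟨w, rfl⟩, h1⟩
            ⟨(S.mem_Gam t).2 ⟨w', rfl⟩, h2⟩) h
        · rw [chainProjW_of_not_subset _ _ _ h2, mul_zero]
      · rw [chainProjW_of_not_subset _ _ _ h1, zero_mul])
    (Subtype.ext (by
      rw [chainProjW_of_subset _ _ _ (by rw [rep_zero]; simp), fanW_zero]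
      rfl))

theorem chainProj_fanW (w : weightMonoid P) :
    S.chainProj t C (S.fanW t w) = S.chainProjW t C w := S.fanWLift_fanW t _ _ _ _ w

theorem chainProj_fanY_of_mem {a : S.Gam t} (ha : a.1 ∈ S.GamChain t C) :
    (S.chainProj t C (fanY K a) : S.FanAlg t) = fanY K a := by
  rw [fanY_eq_fanW, chainProj_fanW, chainProjW_of_subset]
  rw [rep_symm]
  exact ha.2

theorem chainProj_fanY_of_notMem {a : S.Gam t} (ha : a.1 ∉ S.GamChain t C) :
    S.chainProj t C (fanY K a) = 0 := by
  rw [fanY_eq_fanW, chainProj_fanW, chainProjW_of_not_subset]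
  rw [rep_symm]
  exact fun h => ha ⟨a.2, h⟩

theorem chainProj_coe (x : S.ChainAlg t C) : S.chainProj t C (x : S.FanAlg t) = x := by
  have : ((S.chainProj t C).comp (S.ChainAlg t C).val) = AlgHom.id K _ := by
    refine AlgHom.adjoin_ext ?_
    rintro _ ⟨a, ha, rfl⟩
    exact Subtype.ext (S.chainProj_fanY_of_mem t C ha)
  exact DFunLike.congr_fun this x

theorem chainProj_surjective : Function.Surjective (S.chainProj t C) :=
  fun x => ⟨x, S.chainProj_coe t C x⟩

open Classical in
theorem repr_chainProj (x : S.FanAlg t) (w : weightMonoid P) :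
    (S.fanBasis t).repr (S.chainProj t C x : S.FanAlg t) w
      = if Function.support (S.rep w) ⊆ C then (S.fanBasis t).repr x w else 0 := by
  set f : S.FanAlg t →ₗ[K] K := (Finsupp.lapply w) ∘ₗ (S.fanBasis t).repr.toLinearMap ∘ₗ
    (S.ChainAlg t C).val.toLinearMap ∘ₗ (S.chainProj t C).toLinearMap
  set g : S.FanAlg t →ₗ[K] K := if Function.support (S.rep w) ⊆ C then
    (Finsupp.lapply w) ∘ₗ (S.fanBasis t).repr.toLinearMap else 0
  have hfg : f = g := by
    refine (S.fanBasis t).ext fun w' => ?_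
    have hf : f (S.fanBasis t w') = (S.fanBasis t).repr (S.chainProjW t C w' : S.FanAlg t) w := by
      rw [← chainProj_fanW, ← fanBasis_apply]
      rfl
    rw [hf]
    by_cases h' : Function.support (S.rep w') ⊆ C
    · rw [chainProjW_of_subset _ _ _ h', ← fanBasis_apply, Module.Basis.repr_self]
      by_cases h : Function.support (S.rep w) ⊆ C
      · simp [g, if_pos h]
      · have : w' ≠ w := by
          rintro rfl
          exact h h'
        simp [g, if_neg h, Finsupp.single_eq_of_ne' this]
    · rw [chainProjW_of_not_subset _ _ _ h', ZeroMemClass.coe_zero, map_zero]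
      by_cases h : Function.support (S.rep w) ⊆ C
      · have : w' ≠ w := by
          rintro rfl
          exact h' h
        simp [g, if_pos h, Finsupp.single_eq_of_ne' this]
      · simp [g, if_neg h]
  have := DFunLike.congr_fun hfg x
  refine this.trans ?_
  simp only [g]
  split_ifs <;> rfl

/-- The coefficient at w survives in the projection to any flag containing the support of `rep w`.
Thus K[Γ] embeds into a product of domains. -/
theorem eq_zero_of_chainProj_eq_zero {x : S.FanAlg t} (h : ∀ C, S.chainProj t C x = 0) :
    x = 0 := by
  rw [← (S.fanBasis t).repr.map_eq_zero_iff]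
  ext w
  obtain ⟨C, hC⟩ := (S.isRep_rep w).isChain.exists_subset_flag
  have := S.repr_chainProj t C x w
  rw [h C, if_pos hC, ZeroMemClass.coe_zero, map_zero] at this
  exact this.symm

instance : _root_.IsReduced (S.FanAlg t) where
  eq_zero _ hx := S.eq_zero_of_chainProj_eq_zero t fun C => (hx.map (S.chainProj t C)).eq_zero

/-- The generator `y_{e_σ}`. -/
def vertexY (σ : Face P) : S.FanAlg t :=
  fanY K ⟨Pi.single σ 1, (S.mem_Gam t).2 ⟨⟨_, (isRep_single σ).mem_weightMonoid⟩,
    (S.isRep_rep _).eq (isRep_single σ)⟩⟩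

theorem vertexY_mem (σ : Face P) : S.vertexY t σ ∈ S.fanGrading t (S.deg σ) := by
  have h := S.fanY_mem t ⟨Pi.single σ 1, (S.mem_Gam t).2 ⟨⟨_, (isRep_single σ).mem_weightMonoid⟩,
    (S.isRep_rep _).eq (isRep_single σ)⟩⟩
  have : S.gamDeg t ⟨Pi.single σ 1, (S.mem_Gam t).2 ⟨⟨_, (isRep_single σ).mem_weightMonoid⟩,
    (S.isRep_rep _).eq (isRep_single σ)⟩⟩ = S.deg σ := by
    have h1 := S.gamDeg_eq t ⟨Pi.single σ 1, (S.mem_Gam t).2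
      ⟨⟨_, (isRep_single σ).mem_weightMonoid⟩, (S.isRep_rep _).eq (isRep_single σ)⟩⟩
    rw [finsum_eq_single _ σ] at h1
    · simpa using h1
    · intro τ hτ
      simp [Pi.single_eq_of_ne hτ]
  rwa [this] at h

theorem chainProj_vertexY_ne_zero {σ : Face P} (hσ : σ ∈ C) :
    S.chainProj t C (S.vertexY t σ) ≠ 0 := by
  intro h
  have h1 := S.chainProj_fanY_of_mem t C (a := ⟨Pi.single σ 1, (S.mem_Gam t).2
    ⟨⟨_, (isRep_single σ).mem_weightMonoid⟩, (S.isRep_rep _).eq (isRep_single σ)⟩⟩)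
    ⟨Subtype.mem _, Pi.support_single_subset.trans (Set.singleton_subset_iff.2 hσ)⟩
  change (S.chainProj t C (S.vertexY t σ) : S.FanAlg t) = _ at h1
  rw [h] at h1
  exact (S.linearIndependent_fanY t).ne_zero _ h1.symm

theorem chainProj_vertexY_eq_zero {σ : Face P} (hσ : σ ∉ C) :
    S.chainProj t C (S.vertexY t σ) = 0 := by
  refine S.chainProj_fanY_of_notMem t C fun h => hσ (h.2 ?_)
  simp

/-- If σ lies in C but not in C', then y_{e_σ} is killed only by the projection to C'. So C ⊆ C',
and C is maximal. -/
theorem eq_of_ker_chainProj_le {C C' : Flag (Face P)}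
    (h : RingHom.ker (S.chainProj t C') ≤ RingHom.ker (S.chainProj t C)) : C = C' := by
  refine SetLike.coe_injective (C.maxChain.2 C'.maxChain.1 fun σ hσ => ?_)
  by_contra h'
  exact S.chainProj_vertexY_ne_zero t C hσ (h (S.chainProj_vertexY_eq_zero t C' h'))

theorem chainProj_mem {i : ℕ} {x : S.FanAlg t} (hx : x ∈ S.fanGrading t i) :
    S.chainProj t C x ∈ S.chainGrading t C i := by
  obtain ⟨p, hp, rfl⟩ := hx
  change S.chainProj t C (Ideal.Quotient.mk _ p) ∈ _
  rw [p.as_sum, map_sum, map_sum]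
  refine Submodule.sum_mem _ fun m hm => ?_
  have hY : ∀ a : S.Gam t, S.chainProj t C (fanY K a) ∈ S.chainGrading t C (S.gamDeg t a) := by
    intro a
    by_cases ha : a.1 ∈ S.GamChain t C
    · change (S.chainProj t C (fanY K a) : S.FanAlg t) ∈ S.fanGrading t _
      rw [S.chainProj_fanY_of_mem t C ha]
      exact S.fanY_mem t a
    · rw [S.chainProj_fanY_of_notMem t C ha]
      exact Submodule.zero_mem _
  have hdeg : Finsupp.weight (S.gamDeg t) m = i := hp (MvPolynomial.mem_support_iff.1 hm)
  have hmon : S.chainProj t C (Ideal.Quotient.mk _ (MvPolynomial.monomial m (p.coeff m)))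
      = p.coeff m • ∏ a ∈ m.support, S.chainProj t C (fanY K a) ^ m a := by
    rw [MvPolynomial.monomial_eq, map_mul, map_mul, Algebra.smul_def, Finsupp.prod, map_prod,
      map_prod]
    congr 1
    · exact (S.chainProj t C).commutes _
    · refine Finset.prod_congr rfl fun a _ => ?_
      rw [map_pow, map_pow]
      rfl
  rw [hmon, ← hdeg, Finsupp.weight_apply, Finsupp.sum]
  exact Submodule.smul_mem _ _ (SetLike.prod_pow_mem_graded _ _ _ _ fun a _ => hY a)

/-- The projection `K[Γ] → K[Γ_C]` as a homomorphism of graded algebras. -/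
def chainGradedProj : S.fanGrading t →ₐᵍ[K] S.chainGrading t C :=
  { S.chainProj t C with map_mem := S.chainProj_mem t C }

end SeshadriStratification

end FanDegeneration

end

noncomputable section

namespace FanDegeneration

/-! ### Generalities on `Proj` -/

section Topology

/-- An irreducible set covered by finitely many closed sets lies in one of them; without inclusions
among the Z i, these are the maximal irreducible sets. -/
theorem irreducibleComponents_eq_range_of_finite {X ι : Type*} [TopologicalSpace X] [Finite ι]
    (Z : ι → Set X) (hcl : ∀ i, IsClosed (Z i)) (hirr : ∀ i, IsIrreducible (Z i))
    (huniv : ⋃ i, Z i = Set.univ) (hsub : ∀ i j, Z i ⊆ Z j → i = j) :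
    irreducibleComponents X = Set.range Z := by
  have key : ∀ W : Set X, IsIrreducible W → ∃ i, W ⊆ Z i := fun W hW => by
    obtain ⟨z, hz, h⟩ := isIrreducible_iff_sUnion_isClosed.1 hW
      (Set.finite_range Z).toFinset (by simpa using hcl) (by simp [huniv])
    rw [Set.Finite.mem_toFinset] at hz
    obtain ⟨i, rfl⟩ := hz
    exact ⟨i, h⟩
  ext W
  constructor
  · intro hW
    obtain ⟨i, hi⟩ := key W hW.1
    exact ⟨i, le_antisymm (hW.2 (hirr i) hi) hi⟩
  · rintro ⟨i, rfl⟩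
    refine ⟨hirr i, fun V hV hiV => ?_⟩
    obtain ⟨j, hj⟩ := key V hV
    rw [hsub i j (hiV.trans hj)]
    exact hj

theorem not_subset_iUnion_of_isIrreducible {X ι : Type*} [TopologicalSpace X] [Finite ι]
    (Z : ι → Set X) (hcl : ∀ i, IsClosed (Z i)) (hirr : ∀ i, IsIrreducible (Z i))
    (hsub : ∀ i j, Z i ⊆ Z j → i = j) (i : ι) : ¬ Z i ⊆ ⋃ (j : ι) (_ : j ≠ i), Z j := by
  intro h
  obtain ⟨_, hz, h'⟩ := isIrreducible_iff_sUnion_isClosed.1 (hirr i)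
    (Set.toFinite (Z '' {j | j ≠ i})).toFinset (by
      intro z hz
      rw [Set.Finite.mem_toFinset] at hz
      obtain ⟨j, -, rfl⟩ := hz
      exact hcl j) (by simpa using h)
  rw [Set.Finite.mem_toFinset] at hz
  obtain ⟨j, hj, rfl⟩ := hz
  exact hj (hsub i j h').symm

end Topology

section Proj

open AlgebraicGeometry CategoryTheory HomogeneousLocalization HomogeneousIdeal

universe u

variable {A B σ τ : Type u} [CommRing A] [SetLike σ A] [AddSubgroupClass σ A]
  [CommRing B] [SetLike τ B] [AddSubgroupClass τ B] {𝒜 : ℕ → σ} {ℬ : ℕ → τ}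
  [GradedRing 𝒜] [GradedRing ℬ] (f : 𝒜 →+*ᵍ ℬ)

theorem exists_mem_of_surjective (hf : Function.Surjective f) {i : ℕ} {b : B} (hb : b ∈ ℬ i) :
    ∃ a ∈ 𝒜 i, f a = b := by
  obtain ⟨a, rfl⟩ := hf b
  refine ⟨DirectSum.decompose 𝒜 a i, SetLike.coe_mem _, ?_⟩
  rw [f.map_directSumDecompose, DirectSum.decompose_of_mem_same _ hb]

theorem irrelevant_le_map_of_surjective (hf : Function.Surjective f) :
    irrelevant ℬ ≤ (irrelevant 𝒜).map f := by
  rw [HomogeneousIdeal.irrelevant_le]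
  intro i hi b hb
  obtain ⟨a, ha, rfl⟩ := exists_mem_of_surjective f hf hb
  exact Ideal.mem_map_of_mem _ (HomogeneousIdeal.mem_irrelevant_of_mem _ hi ha)

theorem awayMap_surjective (hf : Function.Surjective f) {d : ℕ} {s : A} (hs : s ∈ 𝒜 d) :
    Function.Surjective (Away.map f s) := by
  intro x
  obtain ⟨n, b, hb, rfl⟩ := Away.mk_surjective ℬ (f.2 hs) x
  obtain ⟨a, ha, rfl⟩ := exists_mem_of_surjective f hf hb
  exact ⟨Away.mk 𝒜 hs n a ha, Away.map_mk f s hs n a ha⟩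

/-- The chart isomorphisms identify the restriction with Spec of the surjection `Away.map f s`. -/
theorem isClosedImmersion_projMap_restrict (hf : Function.Surjective f)
    (h : irrelevant ℬ ≤ (irrelevant 𝒜).map f) {d : ℕ} (hd : 0 < d) {s : A} (hs : s ∈ 𝒜 d) :
    IsClosedImmersion (Proj.map f h ∣_ Proj.basicOpen 𝒜 s) := by
  let e : Spec (.of (Away ℬ (f s))) ⟶ (Proj.map f h ⁻¹ᵁ Proj.basicOpen 𝒜 s).toScheme :=
    (Proj.basicOpenIsoSpec ℬ (f s) (f.2 hs) hd).inv
  have he : IsIso e := inferInstanceAs (IsIso (Proj.basicOpenIsoSpec ℬ (f s) (f.2 hs) hd).inv)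
  have he' : e ≫ (Proj.map f h ⁻¹ᵁ Proj.basicOpen 𝒜 s).ι = Proj.awayι ℬ (f s) (f.2 hs) hd := rfl
  have h2 : e ≫ (Proj.map f h ∣_ Proj.basicOpen 𝒜 s)
      = Spec.map (CommRingCat.ofHom (Away.map f s)) ≫
        (Proj.basicOpenIsoSpec 𝒜 s hs hd).inv := by
    rw [← cancel_mono (Proj.basicOpen 𝒜 s).ι, Category.assoc, Category.assoc,
      morphismRestrict_ι, Proj.basicOpenIsoSpec_inv_ι, ← Proj.awayι_comp_map f h hd s hs,
      ← Category.assoc, he']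
  have h4 : IsClosedImmersion (Spec.map (CommRingCat.ofHom (Away.map f s))) :=
    IsClosedImmersion.spec_of_surjective _ (awayMap_surjective f hf hs)
  rw [← MorphismProperty.cancel_left_of_respectsIso @IsClosedImmersion e, h2]
  infer_instance

theorem isClosedImmersion_projMap (hf : Function.Surjective f)
    (h : irrelevant ℬ ≤ (irrelevant 𝒜).map f) : IsClosedImmersion (Proj.map f h) := by
  have htop : ⨆ s : (Σ i : PNat, 𝒜 i), Proj.basicOpen 𝒜 (s.2 : A) = ⊤ := by
    refine Proj.iSup_basicOpen_eq_top 𝒜 _ ?_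
    rw [toIdeal_irrelevant_le]
    exact fun i hi x hx => Ideal.subset_span ⟨⟨⟨i, hi⟩, ⟨x, hx⟩⟩, rfl⟩
  refine (IsZariskiLocalAtTarget.iff_of_iSup_eq_top (P := @IsClosedImmersion) _ htop).2 fun s => ?_
  exact isClosedImmersion_projMap_restrict f hf h s.1.2 s.2.2

/-- A homogeneous prime containing ker f is the pullback of its image, and the image is relevant
because its pullback is. -/
theorem mem_range_projMap (hf : Function.Surjective f)
    (h : irrelevant ℬ ≤ (irrelevant 𝒜).map f) (p : Proj 𝒜) :
    p ∈ Set.range (Proj.map f h) ↔ RingHom.ker f ≤ p.asHomogeneousIdeal.toIdeal := by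
  constructor
  · rintro ⟨q, rfl⟩ x hx
    change f x ∈ q.asHomogeneousIdeal
    rw [(RingHom.mem_ker).1 hx]
    exact Ideal.zero_mem _
  · intro hp
    have hcm : (p.asHomogeneousIdeal.map f).toIdeal.comap f = p.asHomogeneousIdeal.toIdeal := by
      rw [toIdeal_map]
      refine (Ideal.comap_map_of_surjective f hf _).trans ?_
      exact sup_eq_left.2 hp
    have hprime := p.isPrime
    refine ⟨⟨p.asHomogeneousIdeal.map f, Ideal.map_isPrime_of_surjective hf hp, fun hle => ?_⟩, ?_⟩
    · refine p.not_irrelevant_le ?_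
      change (irrelevant 𝒜).toIdeal ≤ p.asHomogeneousIdeal.toIdeal
      rw [toIdeal_irrelevant_le]
      intro i hi x hx
      change x ∈ p.asHomogeneousIdeal.toIdeal
      rw [← hcm]
      exact hle (HomogeneousIdeal.mem_irrelevant_of_mem _ hi (f.2 hx))
    · exact ProjectiveSpectrum.ext (HomogeneousIdeal.ext hcm)

/-- Stalks are degree-zero parts of localizations of A, hence subrings of reduced rings. -/
theorem isReduced_proj [_root_.IsReduced A] : AlgebraicGeometry.IsReduced (Proj 𝒜) := by
  have : ∀ x : Proj 𝒜, _root_.IsReduced ((Proj 𝒜).presheaf.stalk x) := fun x => by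
    have hprime := x.isPrime
    have h1 : _root_.IsReduced (AtPrime 𝒜 x.asHomogeneousIdeal.toIdeal) :=
      isReduced_of_injective (algebraMap _
        (Localization x.asHomogeneousIdeal.toIdeal.primeCompl)) (val_injective _)
    exact isReduced_of_injective (Proj.stalkIso 𝒜 x).hom.hom
      (ConcreteCategory.bijective_of_isIso (Proj.stalkIso 𝒜 x).hom).1
  exact isReduced_of_isReduced_stalk _

variable (𝒜) in
/-- The generic point of the `Proj` of a domain. -/
def genericPointProj [IsDomain A] {i : ℕ} (hi : 0 < i) {a : A} (ha : a ∈ 𝒜 i) (h0 : a ≠ 0) :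
    Proj 𝒜 where
  asHomogeneousIdeal := ⊥
  isPrime := Ideal.isPrime_bot
  not_irrelevant_le h := h0 (h (HomogeneousIdeal.mem_irrelevant_of_mem _ hi ha))

theorem closure_genericPointProj [IsDomain A] {i : ℕ} (hi : 0 < i) {a : A} (ha : a ∈ 𝒜 i)
    (h0 : a ≠ 0) : closure {genericPointProj 𝒜 hi ha h0} = Set.univ := by
  rw [Set.eq_univ_iff_forall]
  intro x
  rw [← specializes_iff_mem_closure]
  refine (ProjectiveSpectrum.le_iff_mem_closure _ (genericPointProj 𝒜 hi ha h0) x).1 ?_ |>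
    specializes_iff_mem_closure.2
  exact bot_le (a := x.asHomogeneousIdeal)

theorem isIntegral_proj [IsDomain A] {i : ℕ} (hi : 0 < i) {a : A} (ha : a ∈ 𝒜 i) (h0 : a ≠ 0) :
    AlgebraicGeometry.IsIntegral (Proj 𝒜) := by
  have h1 : IrreducibleSpace (Proj 𝒜) := by
    have : IsIrreducible (Set.univ : Set (Proj 𝒜)) := by
      rw [← closure_genericPointProj hi ha h0]
      exact isIrreducible_singleton.closure
    exact (irreducibleSpace_def _).2 this
  have h2 := isReduced_proj (𝒜 := 𝒜)
  exact isIntegral_of_irreducibleSpace_of_isReduced _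

/-- The generic point of Proj of the domain B is sent to the prime ker f; then `mem_range_projMap`
for g applies to that point. -/
theorem ker_le_of_range_projMap_subset {C ψ : Type u} [CommRing C] [SetLike ψ C]
    [AddSubgroupClass ψ C] {𝒞 : ℕ → ψ} [GradedRing 𝒞] (g : 𝒜 →+*ᵍ 𝒞)
    (h : irrelevant ℬ ≤ (irrelevant 𝒜).map f)
    (hg : Function.Surjective g) (h' : irrelevant 𝒞 ≤ (irrelevant 𝒜).map g) [IsDomain B]
    {i : ℕ} (hi : 0 < i) {b : B} (hb : b ∈ ℬ i) (h0 : b ≠ 0)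
    (hsub : Set.range (Proj.map f h) ⊆ Set.range (Proj.map g h')) :
    RingHom.ker g ≤ RingHom.ker f := by
  have := (mem_range_projMap g hg h' _).1 (hsub ⟨genericPointProj ℬ hi hb h0, rfl⟩)
  exact this

end Proj

end FanDegeneration

end

noncomputable section

namespace FanDegeneration

/-! ### Dimension and transcendence degree -/

section Krull

/-- Incomparability bounds the left side above; lying over and going up lift chains of primes. -/
theorem ringKrullDim_eq_of_isIntegral {R S : Type*} [CommRing R] [CommRing S] [Algebra R S]
    [Algebra.IsIntegral R S] [FaithfulSMul R S] : ringKrullDim S = ringKrullDim R := by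
  refine le_antisymm ?_ ?_
  · refine Order.krullDim_le_of_strictMono (PrimeSpectrum.comap (algebraMap R S)) fun p q h => ?_
    exact Ideal.IsIntegral.comap_lt_comap h
  · refine iSup_le fun l => ?_
    obtain ⟨⟨Q, hQ, hl⟩⟩ := Ideal.nonempty_primesOver (S := S) (RelSeries.head l).asIdeal
    obtain ⟨L, hL, -⟩ := Ideal.exists_ltSeries_of_hasGoingUp l Q
    rw [← hL]
    exact le_iSup (fun p : LTSeries (PrimeSpectrum S) => (p.length : WithBot ℕ∞)) L

universe u v w

theorem trdeg_eq_of_isAlgebraic {K : Type w} {R : Type u} {S : Type v} [Field K] [CommRing R]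
    [CommRing S] [NoZeroDivisors S] [Algebra K R] [Algebra K S] [Algebra R S] [IsScalarTower K R S]
    [FaithfulSMul R S] [Nontrivial R] [Algebra.IsAlgebraic R S] :
    Cardinal.lift.{v} (Algebra.trdeg K R) = Cardinal.lift.{u} (Algebra.trdeg K S) := by
  rw [← lift_trdeg_add_eq K R S, trdeg_eq_zero (R := R) (A := S), Cardinal.lift_zero, add_zero]

/-- By Noether normalization both invariants are the number of polynomial variables. -/
theorem ringKrullDim_eq_trdeg {K B : Type*} [Field K] [CommRing B] [IsDomain B] [Algebra K B]
    [Algebra.FiniteType K B] : ∃ m : ℕ, Algebra.trdeg K B = m ∧ ringKrullDim B = m := by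
  obtain ⟨m, g, hg, hint⟩ := exists_integral_inj_algHom_of_fg K B
  let _ : Algebra (MvPolynomial (Fin m) K) B := g.toRingHom.toAlgebra
  have h1 : IsScalarTower K (MvPolynomial (Fin m) K) B :=
    IsScalarTower.of_algebraMap_eq fun x => (g.commutes x).symm
  have h2 : Algebra.IsIntegral (MvPolynomial (Fin m) K) B := ⟨hint⟩
  have h3 : FaithfulSMul (MvPolynomial (Fin m) K) B :=
    (faithfulSMul_iff_algebraMap_injective _ _).2 hg
  refine ⟨m, ?_, ?_⟩
  · have := trdeg_eq_of_isAlgebraic (K := K) (R := MvPolynomial (Fin m) K) (S := B)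
    rw [MvPolynomial.trdeg_of_isDomain] at this
    simpa using this.symm
  · rw [ringKrullDim_eq_of_isIntegral (R := MvPolynomial (Fin m) K),
      MvPolynomial.ringKrullDim_of_isNoetherianRing]
    simp

/-- The coheight of an irreducible closed set can be computed in any chart that meets it. -/
theorem topologicalKrullDim_eq_of_openCover {X ι : Type*} [TopologicalSpace X] [Nonempty ι]
    {U : ι → Type*} [∀ i, TopologicalSpace (U i)] (f : ∀ i, U i → X)
    (hf : ∀ i, Topology.IsOpenEmbedding (f i)) (hcover : ∀ x, ∃ i, x ∈ Set.range (f i))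
    {d : WithBot ℕ∞} (hd : ∀ i, topologicalKrullDim (U i) = d) : topologicalKrullDim X = d := by
  refine le_antisymm ?_ ?_
  · rw [topologicalKrullDim, Order.krullDim_eq_iSup_coheight]
    refine iSup_le fun Z => ?_
    obtain ⟨z, hz⟩ := Z.2.nonempty
    obtain ⟨i, y, rfl⟩ := hcover z
    have hZ := (TopologicalSpace.IrreducibleCloseds.orderIsoOfIsOpenEmbedding (f i) (hf i)).apply_symm_apply
      ⟨Z, ⟨y, hz⟩⟩
    have hZ' := congrArg Subtype.val hZ
    change TopologicalSpace.IrreducibleCloseds.map (f i) (hf i).continuous _ = Z at hZ'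
    rw [← hZ', (hf i).coheight_map, ← hd i, topologicalKrullDim, Order.krullDim_eq_iSup_coheight]
    exact le_iSup (fun W => ((Order.coheight W : ℕ∞) : WithBot ℕ∞)) _
  · obtain ⟨i⟩ := ‹Nonempty ι›
    rw [← hd i]
    exact (hf i).isInducing.topologicalKrullDim_le

end Krull

section Graded

variable {K A : Type*} [Field K] [CommRing A] [Algebra K A] (𝒜 : ℕ → Submodule K A)
  [GradedAlgebra 𝒜]

theorem eq_zero_of_sum_mem_graded {ι : Type*} (s : Finset ι) (k : ι → ℕ)
    (hk : Function.Injective k) (x : ι → A) (hx : ∀ i ∈ s, x i ∈ 𝒜 (k i))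
    (hsum : ∑ i ∈ s, x i = 0) : ∀ i ∈ s, x i = 0 := by
  classical
  intro i hi
  have h1 := congrArg (fun a => (DirectSum.decompose 𝒜 a (k i) : A)) hsum
  beta_reduce at h1
  rw [DirectSum.decompose_sum, DFinsupp.finsetSum_apply, AddSubmonoidClass.coe_finsetSum,
    DirectSum.decompose_zero, DirectSum.zero_apply, ZeroMemClass.coe_zero,
    Finset.sum_eq_single i] at h1
  · rwa [DirectSum.decompose_of_mem_same _ (hx i hi)] at h1
  · intro j hj hne
    exact DirectSum.decompose_of_mem_ne _ (hx j hj) fun h => hne (hk h)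
  · exact fun h => absurd hi h

variable {L B : Type*} [CommRing L] [IsDomain L] [Algebra A L] [FaithfulSMul A L] [CommRing B]
  [Algebra B L] {f : A} {d : ℕ}

/-- Multiplied by a power f^N that clears denominators, a polynomial relation for f over B has terms
in distinct degrees (N + i) d, so each term vanishes. -/
theorem transcendental_of_degree_zero [FaithfulSMul B L] (hf : f ∈ 𝒜 d) (hd : 0 < d) (h0 : f ≠ 0)
    (hB : ∀ b : B, ∃ n, ∃ a ∈ 𝒜 (n * d), algebraMap B L b * algebraMap A L f ^ n = algebraMap A L a) :
    Transcendental B (algebraMap A L f) := by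
  rw [transcendental_iff]
  intro p hp
  choose n a ha hna using hB
  set N := ∑ i ∈ p.support, n (p.coeff i)
  have hle : ∀ i ∈ p.support, n (p.coeff i) ≤ N := fun i hi =>
    Finset.single_le_sum (f := fun i => n (p.coeff i)) (fun _ _ => Nat.zero_le _) hi
  have hfL : algebraMap A L f ≠ 0 := by
    rwa [ne_eq, FaithfulSMul.algebraMap_eq_zero_iff]
  have hcoeff : ∀ i ∈ p.support, algebraMap A L (a (p.coeff i) * f ^ (N - n (p.coeff i)) * f ^ i)
      = algebraMap B L (p.coeff i) * algebraMap A L f ^ i * algebraMap A L f ^ N := by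
    intro i hi
    have : algebraMap A L f ^ N
        = algebraMap A L f ^ (n (p.coeff i)) * algebraMap A L f ^ (N - n (p.coeff i)) := by
      rw [← pow_add, Nat.add_sub_cancel' (hle i hi)]
    rw [this, map_mul, map_mul, ← hna, map_pow, map_pow]
    ring
  have hsum : ∑ i ∈ p.support, a (p.coeff i) * f ^ (N - n (p.coeff i)) * f ^ i = 0 := by
    apply FaithfulSMul.algebraMap_injective A L
    rw [map_sum, map_zero, Finset.sum_congr rfl hcoeff, ← Finset.sum_mul]
    rw [Polynomial.aeval_def, Polynomial.eval₂_eq_sum, Polynomial.sum_def] at hp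
    rw [hp, zero_mul]
  have hz := eq_zero_of_sum_mem_graded 𝒜 p.support (fun i => N * d + i * d)
    (fun i j hij => by simpa [hd.ne'] using hij) _ (fun i hi => by
      have h1 := SetLike.mul_mem_graded (SetLike.mul_mem_graded (ha (p.coeff i))
        (SetLike.pow_mem_graded (N - n (p.coeff i)) hf)) (SetLike.pow_mem_graded i hf)
      have h2 : n (p.coeff i) * d + (N - n (p.coeff i)) • d + i • d = N * d + i * d := by
        rw [smul_eq_mul, smul_eq_mul, ← add_mul, Nat.add_sub_cancel' (hle i hi)]
      rwa [h2] at h1) hsum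
  by_contra hp0
  obtain ⟨i, hi⟩ := Polynomial.nonempty_support_iff.2 hp0
  have h1 := hcoeff i hi
  rw [hz i hi, map_zero, eq_comm, mul_eq_zero, mul_eq_zero] at h1
  rcases h1 with (h1 | h1) | h1
  · rw [FaithfulSMul.algebraMap_eq_zero_iff] at h1
    exact Polynomial.mem_support_iff.1 hi h1
  · exact pow_ne_zero _ hfL h1
  · exact pow_ne_zero _ hfL h1

/-- For a homogeneous of degree i the quotient a^d / f^i has degree zero, so a^d lies in B[f]. Thus
A is integral over B[f], and L only inverts f. -/
theorem isAlgebraic_adjoin_degree_zero [IsDomain A] [IsDomain B] (hd : 0 < d) (h0 : f ≠ 0)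
    [IsLocalization.Away f L]
    (hB : ∀ n, ∀ a ∈ 𝒜 (n * d), ∃ b : B,
      algebraMap B L b * algebraMap A L f ^ n = algebraMap A L a) :
    Algebra.IsAlgebraic (Algebra.adjoin B {algebraMap A L f}) L := by
  set D := Algebra.adjoin B {algebraMap A L f}
  have hfD : algebraMap A L f ∈ D := Algebra.subset_adjoin rfl
  have hhom : ∀ i, ∀ a ∈ 𝒜 i, IsIntegral D (algebraMap A L a) := by
    intro i a ha
    obtain ⟨b, hb⟩ := hB i (a ^ d) (by
      have := SetLike.pow_mem_graded d ha
      rwa [smul_eq_mul, mul_comm] at this)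
    refine IsIntegral.of_pow hd ?_
    rw [← map_pow, ← hb]
    exact isIntegral_algebraMap (R := D) (x := (⟨_, D.mul_mem (D.algebraMap_mem b) (D.pow_mem hfD i)⟩ : D))
  have hA : ∀ a : A, IsIntegral D (algebraMap A L a) := by
    classical
    intro a
    rw [← DirectSum.sum_support_decompose 𝒜 a, map_sum]
    exact IsIntegral.sum _ fun i _ => hhom i _ (SetLike.coe_mem _)
  refine ⟨fun x => ?_⟩
  obtain ⟨n, a, ha⟩ := IsLocalization.Away.surj f x
  rw [IsAlgebraic.iff_exists_smul_integral]
  refine ⟨⟨_, D.pow_mem hfD n⟩, ?_, ?_⟩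
  · intro h
    have h1 : algebraMap A L f ^ n = 0 := congrArg Subtype.val h
    rw [← map_pow, FaithfulSMul.algebraMap_eq_zero_iff] at h1
    exact pow_ne_zero _ h0 h1
  · have : (⟨_, D.pow_mem hfD n⟩ : D) • x = algebraMap A L a := by
      rw [Subalgebra.smul_def, smul_eq_mul, mul_comm]
      exact ha
    rw [this]
    exact hA a

end Graded

/-- Localizing at f keeps the transcendence degree, and L has transcendence degree one over B,
contributed by f. -/
theorem trdeg_eq_trdeg_degree_zero_add_one {K A L B : Type*} [Field K] [CommRing A] [IsDomain A]
    [Algebra K A] (𝒜 : ℕ → Submodule K A) [GradedAlgebra 𝒜]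
    [CommRing L] [IsDomain L] [Algebra A L] [FaithfulSMul A L] [CommRing B] [IsDomain B]
    [Algebra B L] [FaithfulSMul B L] [Algebra K L] [Algebra K B] [IsScalarTower K A L]
    [IsScalarTower K B L] {f : A} {d : ℕ} [IsLocalization.Away f L]
    (hf : f ∈ 𝒜 d) (hd : 0 < d) (h0 : f ≠ 0)
    (hB : ∀ b : B, ∃ n, ∃ a ∈ 𝒜 (n * d), algebraMap B L b * algebraMap A L f ^ n = algebraMap A L a)
    (hB' : ∀ n, ∀ a ∈ 𝒜 (n * d), ∃ b : B,
      algebraMap B L b * algebraMap A L f ^ n = algebraMap A L a) {m : ℕ}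
    (hm : Algebra.trdeg K B = m) : Algebra.trdeg K A = m + 1 := by
  have h1 := IsLocalization.isAlgebraic (R := A) (S := L) (M := Submonoid.powers f)
  have h2 := trdeg_eq_of_isAlgebraic (K := K) (R := A) (S := L)
  have h3 := isAlgebraic_adjoin_degree_zero 𝒜 hd h0 hB'
  have h4 : Algebra.Transcendental B L := ⟨_, transcendental_of_degree_zero 𝒜 hf hd h0 hB⟩
  have h5 : Algebra.trdeg B L = 1 := by
    refine le_antisymm ?_ (Cardinal.one_le_iff_pos.2 (trdeg_pos B L))
    refine (Algebra.IsAlgebraic.trdeg_le_cardinalMk B {algebraMap A L f}).trans ?_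
    simp
  have h6 := lift_trdeg_add_eq (R := K) (S := B) (A := L)
  rw [h5, hm] at h6
  have h7 : Algebra.trdeg K L = m + 1 := by
    apply Cardinal.lift_injective
    rw [← h6]
    simp
  apply Cardinal.lift_injective
  rw [h2, h7]
  simp

/-- Projection of A onto its degree-zero part is a surjective ring homomorphism, so `𝒜 0` and then B
are of finite type over K and `ringKrullDim_eq_trdeg` applies to B. -/
theorem exists_trdeg_ringKrullDim_degree_zero {K A L B : Type*} [Field K] [CommRing A] [IsDomain A]
    [Algebra K A] [Algebra.FiniteType K A] (𝒜 : ℕ → Submodule K A) [GradedAlgebra 𝒜]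
    [CommRing L] [IsDomain L] [Algebra A L] [FaithfulSMul A L] [CommRing B]
    [Algebra (𝒜 0) B] [Algebra.FiniteType (𝒜 0) B]
    [Algebra B L] [FaithfulSMul B L] [Algebra K L] [IsScalarTower K A L]
    {f : A} {d : ℕ} [IsLocalization.Away f L]
    (hf : f ∈ 𝒜 d) (hd : 0 < d) (h0 : f ≠ 0)
    (hmap : ∀ a : 𝒜 0, algebraMap B L (algebraMap (𝒜 0) B a) = algebraMap A L a)
    (hB : ∀ b : B, ∃ n, ∃ a ∈ 𝒜 (n * d), algebraMap B L b * algebraMap A L f ^ n = algebraMap A L a)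
    (hB' : ∀ n, ∀ a ∈ 𝒜 (n * d), ∃ b : B,
      algebraMap B L b * algebraMap A L f ^ n = algebraMap A L a) :
    ∃ m : ℕ, Algebra.trdeg K A = m + 1 ∧ ringKrullDim B = m := by
  let _ : Algebra K B := ((algebraMap (𝒜 0) B).comp (algebraMap K (𝒜 0))).toAlgebra
  have h1 : IsScalarTower K B L := IsScalarTower.of_algebraMap_eq fun x => by
    rw [RingHom.algebraMap_toAlgebra, RingHom.comp_apply, hmap,
      IsScalarTower.algebraMap_apply K A L]
    rfl
  have h2 : IsDomain B := (FaithfulSMul.algebraMap_injective B L).isDomain (algebraMap B L)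
  have h3 : Algebra.FiniteType K B := by
    have h4 : (algebraMap K (𝒜 0)).FiniteType := by
      have := RingHom.FiniteType.comp_surjective
        ((RingHom.finiteType_algebraMap (A := K) (B := A)).2 inferInstance)
        (GradedRing.projZeroRingHom'_surjective 𝒜)
      convert this using 1
      ext x
      change algebraMap K A x = ((GradedRing.projZeroRingHom' 𝒜 (algebraMap K A x) : 𝒜 0) : A)
      exact congrArg Subtype.val
        (GradedRing.projZeroRingHom'_apply_coe 𝒜 (algebraMap K (𝒜 0) x)).symm
    have h5 : (algebraMap (𝒜 0) B).FiniteType := RingHom.finiteType_algebraMap.2 inferInstance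
    exact RingHom.finiteType_algebraMap.1 (h5.comp h4)
  obtain ⟨m, hm, hm'⟩ := ringKrullDim_eq_trdeg (K := K) (B := B)
  exact ⟨m, trdeg_eq_trdeg_degree_zero_add_one 𝒜 hf hd h0 hB hB' hm, hm'⟩

section Proj

open AlgebraicGeometry HomogeneousLocalization

variable {K A : Type u} [Field K] [CommRing A] [IsDomain A] [Algebra K A]
  [Algebra.FiniteType K A] (𝒜 : ℕ → Submodule K A) [GradedAlgebra 𝒜]

theorem exists_trdeg_ringKrullDim_away {f : A} {d : ℕ} (hf : f ∈ 𝒜 d) (hd : 0 < d) (h0 : f ≠ 0) :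
    ∃ m : ℕ, Algebra.trdeg K A = m + 1 ∧ ringKrullDim (Away 𝒜 f) = m := by
  have hle : Submonoid.powers f ≤ nonZeroDivisors A :=
    powers_le_nonZeroDivisors_of_noZeroDivisors h0
  have h1 : IsDomain (Localization.Away f) := IsLocalization.isDomain_localization hle
  have h2 : FaithfulSMul A (Localization.Away f) :=
    (faithfulSMul_iff_algebraMap_injective _ _).2 (IsLocalization.injective _ hle)
  have h3 : FaithfulSMul (Away 𝒜 f) (Localization.Away f) :=
    (faithfulSMul_iff_algebraMap_injective _ _).2 (val_injective _)
  have h5 : Algebra.FiniteType (𝒜 0) A := by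
    rw [← RingHom.finiteType_algebraMap]
    refine RingHom.FiniteType.of_comp_finiteType (f := algebraMap K (𝒜 0)) ?_
    exact (RingHom.finiteType_algebraMap (A := K) (B := A)).2 inferInstance
  have h6 := Away.finiteType f d hf
  have hmk : ∀ n, ∀ a (ha : a ∈ 𝒜 (n • d)), algebraMap (Away 𝒜 f) (Localization.Away f)
      (Away.mk 𝒜 hf n a ha) * algebraMap A _ f ^ n = algebraMap A _ a := by
    intro n a ha
    change (Away.mk 𝒜 hf n a ha).val * _ = _
    rw [Away.val_mk, ← map_pow, Localization.mk_eq_mk']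
    exact IsLocalization.mk'_spec _ a (⟨f ^ n, n, rfl⟩ : Submonoid.powers f)
  refine exists_trdeg_ringKrullDim_degree_zero 𝒜 (L := Localization.Away f) hf hd h0 ?_ ?_ ?_
  · intro a
    rfl
  · intro b
    obtain ⟨n, a, ha, rfl⟩ := Away.mk_surjective 𝒜 hf b
    exact ⟨n, a, ha, hmk n a ha⟩
  · exact fun n a ha => ⟨_, hmk n a ha⟩

theorem exists_trdeg_topologicalKrullDim_proj {f : A} {d : ℕ} (hf : f ∈ 𝒜 d) (hd : 0 < d)
    (h0 : f ≠ 0) :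
    ∃ m : ℕ, Algebra.trdeg K A = m + 1 ∧ topologicalKrullDim (Proj 𝒜) = m := by
  obtain ⟨m, hm, hm'⟩ := exists_trdeg_ringKrullDim_away 𝒜 hf hd h0
  refine ⟨m, hm, ?_⟩
  -- The charts of zero elements are empty and would spoil the constancy of the dimension.
  let I := {s : Σ i : PNat, 𝒜 i // (s.2 : A) ≠ 0}
  have hI : Nonempty I := ⟨⟨⟨⟨d, hd⟩, ⟨f, hf⟩⟩, h0⟩⟩
  have htop : ⨆ s : (Σ i : PNat, 𝒜 i), Proj.basicOpen 𝒜 (s.2 : A) = ⊤ := by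
    refine Proj.iSup_basicOpen_eq_top 𝒜 _ ?_
    rw [HomogeneousIdeal.toIdeal_irrelevant_le]
    exact fun i hi x hx => Ideal.subset_span ⟨⟨⟨i, hi⟩, ⟨x, hx⟩⟩, rfl⟩
  refine topologicalKrullDim_eq_of_openCover (ι := I)
    (fun s => (Proj.awayι 𝒜 (s.1.2 : A) s.1.2.2 s.1.1.2 : _ → _))
    (fun s => ?_) ?_ ?_
  · have := Proj.instIsOpenImmersionAwayι 𝒜 (s.1.2 : A) s.1.2.2 s.1.1.2
    exact Scheme.Hom.isOpenEmbedding _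
  · intro x
    obtain ⟨s, hs⟩ := TopologicalSpace.Opens.mem_iSup.1 (htop.ge (Set.mem_univ x))
    refine ⟨⟨s, fun h => ?_⟩, ?_⟩
    · rw [h, Proj.basicOpen_zero] at hs
      exact hs
    · rw [← Proj.opensRange_awayι 𝒜 (s.2 : A) s.2.2 s.1.2] at hs
      exact hs
  · intro s
    obtain ⟨m', h1, h2⟩ := exists_trdeg_ringKrullDim_away 𝒜 s.1.2.2 s.1.1.2 s.2
    have : m' = m := by
      rw [hm] at h1
      exact_mod_cast (Cardinal.add_one_inj.1 h1).symm
    rw [← this, ← h2]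
    exact PrimeSpectrum.topologicalKrullDim_eq_ringKrullDim _

end Proj

end FanDegeneration

end

noncomputable section

namespace FanDegeneration

open AlgebraicGeometry

/-! ### Dimensions -/

section MonoidAlgebra

universe u v w

variable {K : Type w} {N : Type u} {W : Type v} [Field K] [AddCommMonoid N] [AddCommMonoid W]

/-- The relation `M • w + g a = g b` makes each monomial of K[W] a root of a nonzero binomial over
K[N], so the extension is algebraic. -/
theorem trdeg_addMonoidAlgebra_eq [IsDomain (AddMonoidAlgebra K W)] (g : N →+ W)
    (hg : Function.Injective g)
    (h : ∀ w, ∃ M : ℕ, 0 < M ∧ ∃ a b : N, M • w + g a = g b) :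
    Cardinal.lift.{max v w} (Algebra.trdeg K (AddMonoidAlgebra K N))
      = Cardinal.lift.{max u w} (Algebra.trdeg K (AddMonoidAlgebra K W)) := by
  let φ := AddMonoidAlgebra.mapDomainAlgHom K K g
  have hφ : Function.Injective φ := AddMonoidAlgebra.mapDomain_injective hg
  have hφs : ∀ a c, φ (AddMonoidAlgebra.single a c) = AddMonoidAlgebra.single (g a) c :=
    fun a c => AddMonoidAlgebra.mapDomain_single
  let _ : Algebra (AddMonoidAlgebra K N) (AddMonoidAlgebra K W) := φ.toRingHom.toAlgebra
  have h1 : IsScalarTower K (AddMonoidAlgebra K N) (AddMonoidAlgebra K W) :=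
    IsScalarTower.of_algebraMap_eq fun x => (φ.commutes x).symm
  have h2 : FaithfulSMul (AddMonoidAlgebra K N) (AddMonoidAlgebra K W) :=
    (faithfulSMul_iff_algebraMap_injective _ _).2 hφ
  have h3 : IsDomain (AddMonoidAlgebra K N) := hφ.isDomain φ.toRingHom
  have hs : ∀ w c, IsAlgebraic (AddMonoidAlgebra K N)
      (AddMonoidAlgebra.single w c : AddMonoidAlgebra K W) := by
    intro w c
    obtain ⟨M, hM, a, b, hab⟩ := h w
    refine ⟨Polynomial.C (AddMonoidAlgebra.single a 1) * Polynomial.X ^ M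
      - Polynomial.C (AddMonoidAlgebra.single b (c ^ M)), fun h0 => ?_, ?_⟩
    · have h4 := congrArg (fun p => Polynomial.coeff p M) h0
      simp [Polynomial.coeff_C, hM.ne'] at h4
    · rw [map_sub, map_mul, map_pow, Polynomial.aeval_C, Polynomial.aeval_C, Polynomial.aeval_X]
      change φ _ * _ - φ _ = 0
      rw [hφs, hφs, AddMonoidAlgebra.single_pow, AddMonoidAlgebra.single_mul_single, one_mul,
        add_comm, hab, sub_self]
  have h5 : Algebra.IsAlgebraic (AddMonoidAlgebra K N) (AddMonoidAlgebra K W) := ⟨fun x => by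
    induction x using AddMonoidAlgebra.induction_linear with
    | zero => exact isAlgebraic_zero
    | add x y hx hy => exact hx.add hy
    | single w c => exact hs w c⟩
  exact trdeg_eq_of_isAlgebraic

end MonoidAlgebra

variable {n : ℕ} {P : NormalLatticePolytope n} {K : Type*} [Field K]

theorem SeshadriStratification.exists_coordGrading_ne_zero (S : SeshadriStratification P K) : ∃ d, 0 < d ∧ ∃ f ∈ coordGrading P K d, f ≠ 0 := by
  obtain ⟨m, hm⟩ := mem_weightMonoid.1 (SeshadriStratification.isRep_single (S := S) (SeshadriStratification.topFace P)).mem_weightMonoid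
  refine ⟨m.degree, ?_, Ideal.Quotient.mk _ (MvPolynomial.monomial m 1),
    ⟨_, MvPolynomial.isHomogeneous_monomial 1 rfl, rfl⟩, ?_⟩
  · have h1 := congrArg Prod.fst hm
    rw [monWeight_fst] at h1
    have h2 := S.deg_pos (SeshadriStratification.topFace P)
    simp only [mu] at h1
    omega
  · rw [mk_monomial]
    exact mono_ne_zero _

variable [CharZero K]

section CoordRing

variable (P K)

/-- The coordinate ring of the cone over `X_P` as a semigroup algebra. -/
def coordLift : AddMonoidAlgebra K (weightMonoid P) →ₐ[K] CoordRing P K :=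
  AddMonoidAlgebra.lift K (CoordRing P K) (weightMonoid P)
    { toFun := fun w => mono K w.toAdd
      map_one' := mono_zero
      map_mul' := fun w w' => mono_add w.toAdd w'.toAdd }

theorem coordLift_bijective : Function.Bijective (coordLift P K) := by
  have hsmul : ∀ x, coordLift P K x = x.coeff.sum fun w c => c • mono K w := fun x => by
    rw [coordLift, AddMonoidAlgebra.lift_apply]
    rfl
  constructor
  · have hli : LinearIndependent K (mono K (P := P)) :=
      ((iSupIndep_weightSpace P K).comp Subtype.val_injective).linearIndependent _ mono_mem
        mono_ne_zero
    intro x y h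
    rw [hsmul, hsmul] at h
    exact AddMonoidAlgebra.coeff_injective (hli (a₁ := x.coeff) (a₂ := y.coeff) h)
  · intro x
    obtain ⟨c, rfl⟩ := Finsupp.mem_span_range_iff_exists_finsupp.1 (mem_span_mono x)
    exact ⟨AddMonoidAlgebra.ofCoeff c, hsmul _⟩

/-- The coordinate ring of the cone over `X_P` is the semigroup algebra of its weights. -/
def coordEquiv : AddMonoidAlgebra K (weightMonoid P) ≃ₐ[K] CoordRing P K :=
  AlgEquiv.ofBijective _ (coordLift_bijective P K)

instance : IsDomain (AddMonoidAlgebra K (weightMonoid P)) := by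
  have : TwoUniqueSums (weightMonoid P) :=
    TwoUniqueSums.of_injective_addHom (weightMonoid P).subtype.toAddHom Subtype.val_injective
      inferInstance
  exact NoZeroDivisors.to_isDomain _

instance : IsDomain (CoordRing P K) := (coordEquiv P K).symm.toMulEquiv.isDomain _

end CoordRing

namespace SeshadriStratification

variable (S : SeshadriStratification P K) (t : Linearization P) (C : Flag (Face P))

/-- The weight represented by an element of `Γ_C`. -/
def chainWeight : S.chainMonoid t C →+ weightMonoid P where
  toFun a := (S.gamEquiv t).symm ⟨a.1, a.2.1⟩
  map_zero' := S.rep_injective (by rw [rep_symm, rep_zero]; rfl)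
  map_add' a b := S.rep_injective (by
    have h : InCommonCone (S.rep ((S.gamEquiv t).symm ⟨a.1, a.2.1⟩))
        (S.rep ((S.gamEquiv t).symm ⟨b.1, b.2.1⟩)) := by
      rw [rep_symm, rep_symm]
      exact S.inCommonCone_of_mem t a.2 b.2
    rw [(rep_add_iff _ _).1 h, rep_symm, rep_symm, rep_symm]
    rfl)

theorem rep_chainWeight (a : S.chainMonoid t C) : S.rep (S.chainWeight t C a) = a :=
  S.rep_symm t ⟨a.1, a.2.1⟩

theorem chainWeight_injective : Function.Injective (S.chainWeight t C) := fun a b h =>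
  Subtype.ext (by rw [← rep_chainWeight, ← rep_chainWeight, h])

theorem natCast_mem_chainMonoid {k : Face P → ℕ} (hk : ∀ σ, σ ∉ C → k σ = 0) :
    (fun σ => (k σ : ℚ)) ∈ S.chainMonoid t C := by
  have hsupp : Function.support (fun σ => (k σ : ℚ)) ⊆ C := fun σ hσ => by
    by_contra h
    exact hσ (by simp [hk σ h])
  refine (S.mem_GamChain t).2 ⟨⟨∑ σ, k σ • S.mu σ, fun σ => Nat.cast_nonneg _,
    C.maxChain.1.mono hsupp, ?_⟩, hsupp⟩
  refine Prod.ext ?_ (funext fun i => ?_) <;>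
    simp [toRat, Prod.fst_sum, Prod.snd_sum]

/-- Expand w in the basis attached to C, clear denominators, and split the integer coordinates into
positive and negative parts; vectors with natural entries on C lie in Γ_C. -/
theorem exists_smul_add_chainWeight (w : weightMonoid P) :
    ∃ M : ℕ, 0 < M ∧ ∃ a b : S.chainMonoid t C,
      M • w + S.chainWeight t C a = S.chainWeight t C b := by
  set x := S.coord C (toRat w.1)
  set M := ∏ σ, (x σ).den
  have hz : ∀ σ, ∃ z : ℤ, (z : ℚ) = M * x σ := by
    intro σ
    obtain ⟨k, hk⟩ := Finset.dvd_prod_of_mem (fun σ => (x σ).den) (Finset.mem_univ σ)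
    refine ⟨k * (x σ).num, ?_⟩
    change (M : ℕ) = _ at hk
    rw [hk]
    push_cast
    rw [mul_comm ((x σ).den : ℚ), mul_assoc, Rat.den_mul_eq_num]
  choose z hz using hz
  have hM : 0 < M := Finset.prod_pos fun σ _ => (x σ).den_pos
  have hzC : ∀ σ, σ ∉ C → z σ = 0 := fun σ hσ => by
    have : (z σ : ℚ) = 0 := by rw [hz, show x σ = 0 from S.coord_apply_of_notMem C _ hσ, mul_zero]
    exact_mod_cast this
  let a : S.chainMonoid t C := ⟨_, S.natCast_mem_chainMonoid t C (k := fun σ => (-z σ).toNat)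
    fun σ hσ => by simp [hzC σ hσ]⟩
  let b : S.chainMonoid t C := ⟨_, S.natCast_mem_chainMonoid t C (k := fun σ => (z σ).toNat)
    fun σ hσ => by simp [hzC σ hσ]⟩
  refine ⟨M, hM, a, b, Subtype.ext (toRat_injective ?_)⟩
  have h1 : toRat (M • w + S.chainWeight t C a : weightMonoid P).1
      = (M : ℚ) • toRat w.1 + toRat (S.chainWeight t C a).1 := by
    refine Prod.ext ?_ (funext fun i => ?_) <;> simp [toRat]
  rw [h1, ← (S.isRep_rep (S.chainWeight t C a)).sum_eq, ← (S.isRep_rep (S.chainWeight t C b)).sum_eq,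
    rep_chainWeight, rep_chainWeight, ← S.sum_coord C (toRat w.1), Finset.smul_sum,
    ← Finset.sum_add_distrib]
  refine Finset.sum_congr rfl fun σ _ => ?_
  rw [smul_smul, ← add_smul, ← hz]
  congr 1
  have h2 : z σ + (-z σ).toNat = (z σ).toNat := by omega
  change (z σ : ℚ) + ((-z σ).toNat : ℚ) = ((z σ).toNat : ℚ)
  exact_mod_cast h2

theorem trdeg_chainAlg : Algebra.trdeg K (S.ChainAlg t C) = Algebra.trdeg K (CoordRing P K) := by
  have h := trdeg_addMonoidAlgebra_eq (K := K) (S.chainWeight t C) (S.chainWeight_injective t C)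
    (S.exists_smul_add_chainWeight t C)
  rw [Cardinal.lift_id, Cardinal.lift_id] at h
  rw [← (S.chainEquiv t C).trdeg_eq, h, (coordEquiv P K).trdeg_eq]

theorem topologicalKrullDim_XChain :
    topologicalKrullDim (S.XChain t C) = topologicalKrullDim (toricVariety P K) := by
  have := S.finite_Lambda
  have : Algebra.FiniteType K (CoordRing P K) :=
    Algebra.FiniteType.of_surjective (Ideal.Quotient.mkₐ K (coneIdeal P K))
      Ideal.Quotient.mk_surjective
  obtain ⟨d, hd, f, hf, h0⟩ := S.exists_coordGrading_ne_zero
  obtain ⟨m, hm, hm'⟩ := exists_trdeg_topologicalKrullDim_proj (coordGrading P K) hf hd h0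
  obtain ⟨k, hk, hk'⟩ := exists_trdeg_topologicalKrullDim_proj (S.chainGrading t C)
    (S.chainProj_mem t C (S.vertexY_mem t (topFace P))) (S.deg_pos _)
    (S.chainProj_vertexY_ne_zero t C (topFace_mem C))
  rw [trdeg_chainAlg, hm] at hk
  have : m = k := by exact_mod_cast Cardinal.add_one_inj.1 hk
  exact hk'.trans (by rw [← this]; exact hm'.symm)

end SeshadriStratification

end FanDegeneration

end

/-! ### Irreducible components of X_0 and the final assembly. -/

noncomputable section

namespace FanDegeneration

open AlgebraicGeometry

variable {n : ℕ} {P : NormalLatticePolytope n} {K : Type*} [Field K] [CharZero K]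

namespace SeshadriStratification

variable (S : SeshadriStratification P K) (t : Linearization P)

/-- Otherwise choose in each kernel an element outside p; their product is killed by every
projection, hence is zero and lies in p. -/
theorem exists_ker_chainProj_le (p : Ideal (S.FanAlg t)) [p.IsPrime] :
    ∃ C, RingHom.ker (S.chainProj t C) ≤ p := by
  by_contra! h
  choose x hx hxp using fun C => SetLike.not_le_iff_exists.1 (h C)
  have := Fintype.ofFinite (Flag (Face P))
  have h0 : ∏ C, x C = 0 := S.eq_zero_of_chainProj_eq_zero t fun C => by
    rw [map_prod]
    exact Finset.prod_eq_zero (Finset.mem_univ C) (hx C)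
  obtain ⟨C, -, hC⟩ := (Ideal.IsPrime.prod_mem_iff (s := Finset.univ) (x := x) (p := p)).1
    (h0 ▸ p.zero_mem)
  exact hxp C hC

variable (C : Flag (Face P))

theorem irrelevant_le_map_chainGradedProj :
    HomogeneousIdeal.irrelevant (S.chainGrading t C) ≤
      (HomogeneousIdeal.irrelevant (S.fanGrading t)).map (S.chainGradedProj t C).toGradedRingHom :=
  irrelevant_le_map_of_surjective _ (S.chainProj_surjective t C)

/-- The closed immersion `X_C → X_0`. -/
def chainImmersion : S.XChain t C ⟶ S.X0 t :=
  Proj.map (S.chainGradedProj t C).toGradedRingHom (S.irrelevant_le_map_chainGradedProj t C)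

instance : IsClosedImmersion (S.chainImmersion t C) :=
  isClosedImmersion_projMap _ (S.chainProj_surjective t C) _

instance : IsIntegral (S.XChain t C) :=
  isIntegral_proj (S.deg_pos _) (S.chainProj_mem t C (S.vertexY_mem t (topFace P)))
    (S.chainProj_vertexY_ne_zero t C (topFace_mem C))

theorem isClosed_range_chainImmersion : IsClosed (Set.range (S.chainImmersion t C)) :=
  (S.chainImmersion t C).isClosedEmbedding.isClosed_range

theorem isIrreducible_range_chainImmersion : IsIrreducible (Set.range (S.chainImmersion t C)) := by
  rw [← Set.image_univ]
  exact (IrreducibleSpace.isIrreducible_univ _).image _ (S.chainImmersion t C).continuous.continuousOn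

theorem iUnion_range_chainImmersion : ⋃ C, Set.range (S.chainImmersion t C) = Set.univ := by
  refine Set.eq_univ_of_forall fun p => ?_
  have := ProjectiveSpectrum.isPrime p
  obtain ⟨C, hC⟩ := S.exists_ker_chainProj_le t (ProjectiveSpectrum.asHomogeneousIdeal p).toIdeal
  exact Set.mem_iUnion.2 ⟨C, (mem_range_projMap _ (S.chainProj_surjective t C) _ p).2 hC⟩

theorem eq_of_range_chainImmersion_subset {C C' : Flag (Face P)}
    (h : Set.range (S.chainImmersion t C) ⊆ Set.range (S.chainImmersion t C')) : C = C' :=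
  S.eq_of_ker_chainProj_le t <| ker_le_of_range_projMap_subset
    (S.chainGradedProj t C).toGradedRingHom (S.chainGradedProj t C').toGradedRingHom
    (S.irrelevant_le_map_chainGradedProj t C) (S.chainProj_surjective t C')
    (S.irrelevant_le_map_chainGradedProj t C') (S.deg_pos (topFace P))
    (S.chainProj_mem t C (S.vertexY_mem t (topFace P)))
    (S.chainProj_vertexY_ne_zero t C (topFace_mem C)) h

theorem irreducibleComponents_X0 :
    irreducibleComponents (S.X0 t) = Set.range fun C => Set.range (S.chainImmersion t C) :=
  irreducibleComponents_eq_range_of_finite _ (S.isClosed_range_chainImmersion t)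
    (S.isIrreducible_range_chainImmersion t) (S.iUnion_range_chainImmersion t)
    fun _ _ => S.eq_of_range_chainImmersion_subset t

theorem topologicalKrullDim_range_chainImmersion :
    topologicalKrullDim (Set.range (S.chainImmersion t C))
      = topologicalKrullDim (toricVariety P K) := by
  rw [← S.topologicalKrullDim_XChain t C]
  exact ((S.chainImmersion t C).isClosedEmbedding.isEmbedding.toHomeomorph.isHomeomorph
    |>.topologicalKrullDim_eq).symm

end SeshadriStratification

end FanDegeneration

end

theorem mainTheorem2 {K : Type*} [Field K] [IsAlgClosed K] [CharZero K] {n : ℕ}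
    (P : NormalLatticePolytope n) (S : SeshadriStratification P K) (t : Linearization P) :
    -- `gr_ν K[X̂_P]` is isomorphic to the fan algebra, compatibly with the leaves
    (∃ φ : S.FanAlg t ≃ₐ[K] S.GrAlg t,
      ∀ a : S.Gam t, φ (fanY K a) ∈ (S.quasiValuation t).leafSub a.1) ∧
    -- `Γ`, hence `K[Γ]`, does not depend on the linearization
    (∀ t' : Linearization P, S.Gam t' = S.Gam t) ∧
    -- up to isomorphism, `gr_ν K[X̂_P]` depends only on the triangulation
    (∀ (S' : SeshadriStratification P K) (t' : Linearization P),
      (∀ C : Set (Face P), IsChain (· ≤ ·) C → S.simplex C = S'.simplex C) →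
      ∃ ψ : S.GrAlg t ≃ₐ[K] S'.GrAlg t', ∀ (w : WeightLattice n), ∀ g ∈ weightSpace P K w,
        ψ ((S.quasiValuation t).symbol g) = (S'.quasiValuation t').symbol g) ∧
    -- `X_0` is reduced
    IsReduced (S.X0 t) ∧
    -- for a maximal chain `C`, `Γ_C` is a finitely generated monoid with semigroup algebra `K[Γ_C]`
    (∀ C : Flag (Face P), ∃ N : AddSubmonoid (Face P → ℚ),
      (N : Set (Face P → ℚ)) = S.GamChain t C ∧ N.FG ∧
      ∃ e : AddMonoidAlgebra K N ≃ₐ[K] S.ChainAlg t C,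
        ∀ (a : S.Gam t) (ha : a.1 ∈ N),
          (e (AddMonoidAlgebra.single ⟨a.1, ha⟩ 1) : S.FanAlg t) = fanY K a) ∧
    -- `X_0` is the irredundant union of the `X_C`, which are its irreducible components
    (∃ (π : ∀ C : Flag (Face P), S.fanGrading t →ₐᵍ[K] S.chainGrading t C)
      (hπ : ∀ C : Flag (Face P), HomogeneousIdeal.irrelevant (S.chainGrading t C) ≤
        (HomogeneousIdeal.irrelevant (S.fanGrading t)).map (π C).toGradedRingHom),
      (∀ (C : Flag (Face P)) (a : S.Gam t),
        (a.1 ∈ S.GamChain t C → (π C (fanY K a) : S.FanAlg t) = fanY K a) ∧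
        (a.1 ∉ S.GamChain t C → π C (fanY K a) = 0)) ∧
      ∃ ι : ∀ C : Flag (Face P), S.XChain t C ⟶ S.X0 t,
        (∀ C, ι C = Proj.map (π C).toGradedRingHom (hπ C)) ∧
        (∀ C : Flag (Face P), IsIntegral (S.XChain t C)) ∧
        (∀ C, IsClosedImmersion (ι C)) ∧
        (⋃ C, Set.range (ι C)) = Set.univ ∧
        (∀ C, ¬ Set.range (ι C) ⊆ ⋃ (C' : Flag (Face P)) (_ : C' ≠ C), Set.range (ι C')) ∧
        irreducibleComponents (S.X0 t) = Set.range (fun C => Set.range (ι C))) ∧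
    -- `X_0` is equidimensional of dimension `dim X_P`
    (∀ Z ∈ irreducibleComponents (S.X0 t),
      topologicalKrullDim Z = topologicalKrullDim (toricVariety P K)) := by
  refine ⟨⟨S.fanEquivGr t, S.fanEquivGr_fanY_mem t⟩, S.Gam_eq t,
    fun S' t' h => SeshadriStratification.exists_grEquiv t t' h, isReduced_proj,
    fun C => ⟨S.chainMonoid t C, rfl, S.chainMonoid_fg t C, S.chainEquiv t C,
      S.chainEquiv_single t C⟩,
    ⟨S.chainGradedProj t, S.irrelevant_le_map_chainGradedProj t,
      fun C a => ⟨S.chainProj_fanY_of_mem t C, S.chainProj_fanY_of_notMem t C⟩,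
      S.chainImmersion t, fun _ => rfl, fun _ => inferInstance, fun _ => inferInstance,
      S.iUnion_range_chainImmersion t,
      not_subset_iUnion_of_isIrreducible _ (S.isClosed_range_chainImmersion t)
        (S.isIrreducible_range_chainImmersion t)
        fun _ _ => S.eq_of_range_chainImmersion_subset t,
      S.irreducibleComponents_X0 t⟩, ?_⟩
  intro Z hZ
  rw [S.irreducibleComponents_X0 t] at hZ
  obtain ⟨C, rfl⟩ := hZ
  exact S.topologicalKrullDim_range_chainImmersion t C
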